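/- The king graph of size $n\times n$ has the cells $(x,y)\in\{0,\dots,n-1\}^2$ as its vertices, two distinct cells $(x',y')$, $(x'',y'')$ being adjacent when $|x'-x''|\le 1$ and $|y'-y''|\le 1$. A path in a graph $G$ is a subgraph of $G$ that is a tree with all degrees at most two (so a path and its reversal are the same path), and its length is its number of edges. A snake path in $G$ is a path in $G$ that is an induced subgraph of $G$. Theorem. Let $n$ be an even positive integer. Then the greatest length of a snake path in the king graph of size $n\times n$ is $n^2/2-1$. If moreover $n\ge 6$, then there are exactly $16n$ snake paths of this greatest length (rotations and reflections counted separately), and each of them is shaped like a spiral in the following sense. Put $k=n/2$ and $B=\{0,\dots,k-1\}^2$, and for $b\in B$ let $\Phi(b)=2b+\{0,1\}^2$. For a snake path $P$, let $\varrho$ be the graph on $B$ in which distinct $b'$, $b''$ are adjacent when $P$ has an edge joining a cell of $\Phi(b')$ to a cell of $\Phi(b'')$. For $0\le i\le\lceil k/2\rceil-1$, the $i$-th frame of $B$ is the boundary of the square $\{i,\dots,k-1-i\}^2$. Write $j=k-1-i$, and let $a=(i,i)$, $b=(j,i)$, $c=(j,j)$, $d=(i,j)$ be its corners. Write $u\to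 v$ for the straight path from $u$ to $v$ along a row or column. The $i$-th frame has one of the following types relative to a graph $R$ on $B$ when $R$ contains the paths listed: - type I: $a\to b\to c\to d\to a+(0,1)\to a+(1,1)$; - type II (only if $k-2i\ge 4$): $a\to b\to c\to d\to a+(0,2)\to a+(1,2)$ and $a+(0,1)\to a+(1,1)$; - type III: $a\to b\to c\to d+(1,0)\to d+(1,-1)$ and $d\to a+(0,1)\to a+(1,1)$; - type IV: $a\to b\to c+(0,-1)\to c+(-1,-1)$ and $c\to d\to a+(0,1)\to a+(1,1)$; - type V: $a\to b+(-1,0)\to b+(-1,1)$ and $b\to c\to d\to a+(0,1)\to a+(1,1)$. Call $R$ regular when either all frames of index $0,\dots,\lceil k/2\rceil-2$ have type I, or, for some $T\in\{\mathrm{II},\mathrm{III},\mathrm{IV},\mathrm{V}\}$ and some $0\le s\le\lceil k/2\rceil-2$, the frames of index $0,\dots,s-1$ have type I and those of index $s,\dots,\lceil k/2\rceil-2$ have type $T$. Then, for every snake path $P$ of length $n^2/2-1$ (with $n\ge 6$), $\varrho$ is a Hamiltonian path of the grid graph on $B$ (in which cells sharing a side are adjacent), and some symmetry of the square $B$ maps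 $\varrho$ onto a regular Hamiltonian path. -/

import Mathlib

namespace KingSnake

/-- The standard board with `m` rows and `n` columns: the cells `(x, y)` with `0 ≤ x ≤ n - 1`
and `0 ≤ y ≤ m - 1`. -/
def board (m n : ℕ) : Set (ℤ × ℤ) :=
  {c | (0 ≤ c.1 ∧ c.1 < n) ∧ (0 ≤ c.2 ∧ c.2 < m)}

/-- The king graph on a set of cells. -/
def kingGraph (S : Set (ℤ × ℤ)) : SimpleGraph S where
  Adj a b := a ≠ b ∧ |a.1.1 - b.1.1| ≤ 1 ∧ |a.1.2 - b.1.2| ≤ 1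
  symm := ⟨fun a b h => ⟨h.1.symm, by rw [abs_sub_comm]; exact h.2.1,
    by rw [abs_sub_comm]; exact h.2.2⟩⟩
  loopless := ⟨fun _ h => h.1 rfl⟩

/-- Two cells that share a side. -/
def GridAdj (a b : ℤ × ℤ) : Prop := |a.1 - b.1| + |a.2 - b.2| = 1

/-- The grid graph on a set of cells. -/
def gridGraph (S : Set (ℤ × ℤ)) : SimpleGraph S where
  Adj a b := GridAdj a.1 b.1
  symm := ⟨fun a b h => by
    unfold GridAdj at *
    rw [abs_sub_comm b.1.1, abs_sub_comm b.1.2]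
    exact h⟩
  loopless := ⟨fun a h => by simp [GridAdj] at h⟩

/-- A path of `G`, as a subgraph: a tree in which all degrees are at most two. -/
def IsPath {V : Type*} {G : SimpleGraph V} (P : G.Subgraph) : Prop :=
  P.coe.IsTree ∧ ∀ v, (P.neighborSet v).encard ≤ 2

/-- A snake path of `G`: a path of `G` that is an induced subgraph of `G`. -/
def IsSnakePath {V : Type*} {G : SimpleGraph V} (P : G.Subgraph) : Prop :=
  IsPath P ∧ P.IsInduced

/-- The length of a path: the number of its edges. -/
noncomputable def length {V : Type*} {G : SimpleGraph V} (P : G.Subgraph) : ℕ :=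
  P.edgeSet.ncard

/-- `R` is a Hamiltonian path of `H`: a spanning subgraph of `H` that is a tree with all degrees at
most two. -/
def IsHamiltonianPath {V : Type*} (H R : SimpleGraph V) : Prop :=
  R ≤ H ∧ R.IsTree ∧ ∀ v, (R.neighborSet v).encard ≤ 2

/-- The `2 × 2` block `Φ(b) = 2 b + {0, 1}²`. -/
def block (b : ℤ × ℤ) : Set (ℤ × ℤ) :=
  {a | (a.1 = 2 * b.1 ∨ a.1 = 2 * b.1 + 1) ∧ (a.2 = 2 * b.2 ∨ a.2 = 2 * b.2 + 1)}

/-- The graph on the cells of the board of side `n / 2` in which two distinct cells `b` and `c` are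
joined when `P` has an edge with one end in the block of `b` and the other in the block of `c`. -/
def blockGraph {n : ℕ} (P : (kingGraph (board n n)).Subgraph) :
    SimpleGraph (board (n / 2) (n / 2)) where
  Adj b c := b ≠ c ∧ ∃ u v, P.Adj u v ∧ u.1 ∈ block b.1 ∧ v.1 ∈ block c.1
  symm := ⟨fun _ _ h => by
    obtain ⟨hne, u, v, huv, hu, hv⟩ := h
    exact ⟨hne.symm, v, u, huv.symm, hv, hu⟩⟩
  loopless := ⟨fun _ h => h.1 rfl⟩

/-- `HasEdge R a b`: the cells `a` and `b` lie in `S` and are joined by an edge of `R`. -/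
def HasEdge {S : Set (ℤ × ℤ)} (R : SimpleGraph S) (a b : ℤ × ℤ) : Prop :=
  ∃ (ha : a ∈ S) (hb : b ∈ S), R.Adj ⟨a, ha⟩ ⟨b, hb⟩

/-- `R` contains the straight path along the row or column through `a` and `b` from `a` to `b`.
(For such `a` and `b`, `Set.uIcc a b` is the set of the cells of that path.) -/
def HasSegment {S : Set (ℤ × ℤ)} (R : SimpleGraph S) (a b : ℤ × ℤ) : Prop :=
  ∀ c ∈ Set.uIcc a b, ∀ d ∈ Set.uIcc a b, GridAdj c d → HasEdge R c d

/-- `R` contains the consecutive straight paths between the successive cells of a list. -/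
def HasChain {S : Set (ℤ × ℤ)} (R : SimpleGraph S) (l : List (ℤ × ℤ)) : Prop :=
  l.IsChain (HasSegment R)

/-- The five ways in which a spiral can run through a frame. -/
inductive FrameType
  | I | II | III | IV | V

/-- The `i`-th frame of the board of side `k`, which is the boundary of the square
`[i, k - 1 - i]²`, is of the given type relative to `R`. Its corners are `(i, i)`, `(j, i)`,
`(j, j)`, `(i, j)` with `j = k - 1 - i`. Type II is meant only for frames of side at least four. -/
def FrameHasType {k : ℕ} (R : SimpleGraph (board k k)) (i : ℕ) (t : FrameType) : Prop :=
  let p : ℤ := i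
  let q : ℤ := k - 1 - i
  match t with
  | .I => HasChain R [(p, p), (q, p), (q, q), (p, q), (p, p + 1), (p + 1, p + 1)]
  | .II => 2 * i + 4 ≤ k ∧
      HasChain R [(p, p), (q, p), (q, q), (p, q), (p, p + 2), (p + 1, p + 2)] ∧
      HasChain R [(p, p + 1), (p + 1, p + 1)]
  | .III => HasChain R [(p, p), (q, p), (q, q), (p + 1, q), (p + 1, q - 1)] ∧
      HasChain R [(p, q), (p, p + 1), (p + 1, p + 1)]
  | .IV => HasChain R [(p, p), (q, p), (q, q - 1), (q - 1, q - 1)] ∧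
      HasChain R [(q, q), (p, q), (p, p + 1), (p + 1, p + 1)]
  | .V => HasChain R [(p, p), (q - 1, p), (q - 1, p + 1)] ∧
      HasChain R [(q, p), (q, q), (p, q), (p, p + 1), (p + 1, p + 1)]

/-- All frames other than the innermost one (the frames of index less than `⌈k / 2⌉ - 1`) are of
type I, or, for one of the types `t` and some `s`, the first `s` frames are of type I and the others
(at least one), except the innermost one, are of type `t`. -/
def IsRegular {k : ℕ} (R : SimpleGraph (board k k)) : Prop :=
  (∀ i < (k + 1) / 2 - 1, FrameHasType R i .I) ∨
  ∃ t : FrameType, ∃ s < (k + 1) / 2 - 1, t ≠ .I ∧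
    (∀ i < s, FrameHasType R i .I) ∧
    (∀ i < (k + 1) / 2 - 1, s ≤ i → FrameHasType R i t)

/-- A symmetry of a set of cells: a permutation of it that preserves (squared) Euclidean
distances. -/
def IsSymmetry {S : Set (ℤ × ℤ)} (f : Equiv.Perm S) : Prop :=
  ∀ a b : S, ((f a).1.1 - (f b).1.1) ^ 2 + ((f a).1.2 - (f b).1.2) ^ 2 =
    (a.1.1 - b.1.1) ^ 2 + (a.1.2 - b.1.2) ^ 2

/-- `P` is shaped like a spiral: up to a symmetry of the board of `2 × 2` blocks, it runs through
the blocks along a regular Hamiltonian path. -/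
def IsSpiral {n : ℕ} (P : (kingGraph (board n n)).Subgraph) : Prop :=
  IsHamiltonianPath (gridGraph (board (n / 2) (n / 2))) (blockGraph P) ∧
  ∃ f : Equiv.Perm (board (n / 2) (n / 2)), IsSymmetry f ∧
    IsRegular ((blockGraph P).map f)

end KingSnake

/-! ### Block types, their local compatibility conditions, and the symmetries of the square -/

namespace KingSnake

/-! Cut the board into `k²` blocks of size `2 × 2`. Three cells of one block form a triangle, so a
snake has at most two cells in each block, hence at most `n² / 2` cells (`card_le_of_no_triangle`),
and a path has one edge fewer than it has cells. In the case of equality every block carries exactly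
two cells, so the snake is encoded by one of six nonempty types for each block. The absence of
triangles and of vertices of degree three turns into local conditions on neighbouring types, and
connectedness says that a union of components meeting the square contains all of it (`IsValid`,
`exists_isValid`). Neighbouring blocks share an edge of the snake exactly when both are `hor` (for a
horizontal neighbour) or both are `ver` (for a vertical one). Thus the blocks themselves form a
path, and at most two of them are joined to at most one other block (`IsValid.ends`).

This scarcity of ends drives the classification. A block that turns its side to the next one, such
as `R` in the bottom row, forces the same type on all further blocks of that row, each of which is
an end; so the blocks of the outer sides are, with few exceptions, joined along these sides. If all
four corners were turns, the outermost frame would be a separate cycle, so some corner is an end. By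
symmetry it is the lower left one, and the path starts along the bottom. Following the frame around,
the position of the second end leaves the five types (`exists_frame`). Without the frame there
remains a path in the smaller square (`IsValid.inner_of_frame`), which again starts in its lower
left corner along the bottom (`Frame.inner_corner`). A type other than I is inherited by the next
frame (`Frame.inner_frame`), because the second attachment of the frame would otherwise be a third
join of a turning block. Induction over the frames gives regularity.

For the count, call a path normalised if it starts in the lower left corner along the bottom. On
squares of side at least five the frame is determined by its type (`Frame.eq_ext`). Conversely, a
frame of type I fits around every normalised path, and one of another type `T` fits around the
normalised paths whose outer frame has type `T` (`isValid_ext`). So when the side grows by two, the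
numbers for the types II to V stay constant and the new number for type I is the old total. The
initial numbers, for the types I to V in order, are `8, 0, 1, 6, 1` for side three and `9, 6, 1, 0,
1` for side four; they come from an enumeration verified by evaluation (`encard_frames_of_tally`). A
path with `c` ends in corners is normalised by exactly `c` of the eight symmetries, which weights
the types I and II by `8` and the others by `4`; the total is `32 k = 16 n`.

In the other direction, a valid arrangement containing a corner cell of the board is a snake path:
it is connected, has degrees at most two, and the corner cell has degree at most one
(`isSnakePath_snake`). This also shows that the bound on the length is attained. -/

/-- The ways in which a `2 × 2` block can meet a snake: not at all, in a side, or in one of the two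
diagonals (`S` rising, `Z` falling). -/
inductive Ty
  | E | L | R | B | T | S | Z
  deriving DecidableEq

instance : Fintype Ty := ⟨{.E, .L, .R, .B, .T, .S, .Z}, fun x => by cases x <;> decide⟩

namespace Ty

/-- `bl`, `br`, `tl`, `tr` tell whether the bottom left, bottom right, top left, top right cell
belongs to the snake. -/
def bl : Ty → Bool
  | L | B | S => true
  | _ => false

def br : Ty → Bool
  | R | B | Z => true
  | _ => false

def tl : Ty → Bool
  | L | T | Z => true
  | _ => false

def tr : Ty → Bool
  | R | T | S => true
  | _ => false

/-- One cell in each column: the block can be joined to its left and right neighbours. -/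
def hor : Ty → Bool
  | B | T | S | Z => true
  | _ => false

/-- One cell in each row: the block can be joined to its lower and upper neighbours. -/
def ver : Ty → Bool
  | L | R | S | Z => true
  | _ => false

/-- Compatibility of a block with its right neighbour. -/
def hOK (a b : Ty) : Bool :=
  -- All cells of the two facing columns are mutually adjacent: a product of two or more means a
  -- triangle, and a product of one means a single edge.
  (a.br.toNat + a.tr.toNat) * (b.bl.toNat + b.tl.toNat) ≤ 1

/-- Compatibility of a block with its upper neighbour. -/
def vOK (a b : Ty) : Bool :=
  (a.tl.toNat + a.tr.toNat) * (b.bl.toNat + b.br.toNat) ≤ 1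

/-- Compatibility of a block with its upper right neighbour. -/
def dOK (a b : Ty) : Bool := !(a.tr && b.bl)

/-- Compatibility of a block with its lower right neighbour. -/
def eOK (a b : Ty) : Bool := !(a.br && b.tl)

/-- Compatibility of a block with its left, right, lower, and upper neighbours; the arguments tell
whether these neighbours are ready to be joined to it. -/
def turnOK (c : Ty) (l r d u : Bool) : Bool :=
  match c with
  -- The left and lower neighbours of an `S` both attach to its bottom left cell, which would then
  -- have degree three; the other conditions are analogous.
  | S => !(l && d) && !(r && u)
  | Z => !(l && u) && !(r && d)
  | _ => true

/-- Rotation by a quarter turn counterclockwise. -/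
def rot : Ty → Ty
  | E => E
  | L => B
  | B => R
  | R => T
  | T => L
  | S => Z
  | Z => S

/-- Reflection in the rising diagonal. -/
def swap : Ty → Ty
  | E => E
  | L => B
  | B => L
  | R => T
  | T => R
  | S => S
  | Z => Z

end Ty

open Ty

/-- The local conditions on the blocks of a snake. -/
structure IsLocal (t : ℤ → ℤ → Ty) : Prop where
  h : ∀ x y, hOK (t x y) (t (x + 1) y)
  v : ∀ x y, vOK (t x y) (t x (y + 1))
  d : ∀ x y, dOK (t x y) (t (x + 1) (y + 1))
  e : ∀ x y, eOK (t x (y + 1)) (t (x + 1) y)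
  turn : ∀ x y, turnOK (t x y) (t (x - 1) y).hor (t (x + 1) y).hor (t x (y - 1)).ver
    (t x (y + 1)).ver

/-- `A` is a union of connected components. -/
def Closed (t : ℤ → ℤ → Ty) (A : ℤ → ℤ → Prop) : Prop :=
  (∀ x y, (t x y).hor → (t (x + 1) y).hor → (A x y ↔ A (x + 1) y)) ∧
  ∀ x y, (t x y).ver → (t x (y + 1)).ver → (A x y ↔ A x (y + 1))

def InSq (lo hi x y : ℤ) : Prop := (lo ≤ x ∧ x ≤ hi) ∧ lo ≤ y ∧ y ≤ hi

instance (lo hi x y : ℤ) : Decidable (InSq lo hi x y) := by unfold InSq; infer_instance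

/-- `t` describes a snake with two cells in each block of the square `[lo, hi]²`. -/
structure IsValid (lo hi : ℤ) (t : ℤ → ℤ → Ty) : Prop where
  supp : ∀ x y, t x y ≠ E ↔ InSq lo hi x y
  loc : IsLocal t
  conn : ∀ A, Closed t A → ∀ x y x' y', t x y ≠ E → t x' y' ≠ E → A x y → A x' y'

/-- The number of neighbours to which a block is joined. -/
def deg (t : ℤ → ℤ → Ty) (x y : ℤ) : ℕ :=
  ((t x y).hor && (t (x - 1) y).hor).toNat + ((t x y).hor && (t (x + 1) y).hor).toNat +
  (((t x y).ver && (t x (y - 1)).ver).toNat + ((t x y).ver && (t x (y + 1)).ver).toNat)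

/-- For `s = lo + hi` this is the counterclockwise quarter turn of the square `[lo, hi]²` about its
centre. -/
def rotate (s : ℤ) (t : ℤ → ℤ → Ty) : ℤ → ℤ → Ty := fun x y => (t y (s - x)).rot

def reflect (t : ℤ → ℤ → Ty) : ℤ → ℤ → Ty := fun x y => (t y x).swap

/-- A block that is not diagonal is joined in one direction only, and `turnOK` splits the four
neighbours of a diagonal block into two pairs, each used at most once. -/
theorem IsLocal.deg_le {t : ℤ → ℤ → Ty} (h : IsLocal t) (x y : ℤ) : deg t x y ≤ 2 := by
  have := h.turn x y
  unfold deg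
  revert this
  generalize t x y = c, (t (x - 1) y).hor = l, (t (x + 1) y).hor = r, (t x (y - 1)).ver = d,
    (t x (y + 1)).ver = u
  revert c l r d u; decide

theorem Ty.rot_eq_E {a : Ty} : a.rot = E ↔ a = E := by revert a; decide
theorem Ty.swap_eq_E {a : Ty} : a.swap = E ↔ a = E := by revert a; decide
theorem Ty.hor_rot (a : Ty) : a.rot.hor = a.ver := by revert a; decide
theorem Ty.ver_rot (a : Ty) : a.rot.ver = a.hor := by revert a; decide
theorem Ty.hor_swap (a : Ty) : a.swap.hor = a.ver := by revert a; decide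
theorem Ty.ver_swap (a : Ty) : a.swap.ver = a.hor := by revert a; decide

theorem IsLocal.rotate {t : ℤ → ℤ → Ty} (h : IsLocal t) (s : ℤ) : IsLocal (rotate s t) where
  h x y := by
    have := h.v y (s - (x + 1))
    rw [show s - (x + 1) + 1 = s - x by ring] at this
    unfold KingSnake.rotate
    revert this
    generalize t y (s - x) = a, t y (s - (x + 1)) = b
    revert a b; decide
  v x y := by
    have := h.h y (s - x)
    unfold KingSnake.rotate
    revert this
    generalize t y (s - x) = a, t (y + 1) (s - x) = b
    revert a b; decide
  d x y := by
    have := h.e y (s - (x + 1))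
    rw [show s - (x + 1) + 1 = s - x by ring] at this
    unfold KingSnake.rotate
    revert this
    generalize t y (s - x) = a, t (y + 1) (s - (x + 1)) = b
    revert a b; decide
  e x y := by
    have := h.d y (s - (x + 1))
    rw [show s - (x + 1) + 1 = s - x by ring] at this
    unfold KingSnake.rotate
    revert this
    generalize t (y + 1) (s - x) = a, t y (s - (x + 1)) = b
    revert a b; decide
  turn x y := by
    have := h.turn y (s - x)
    rw [show s - x - 1 = s - (x + 1) by ring, show s - x + 1 = s - (x - 1) by ring] at this
    simp only [KingSnake.rotate, hor_rot, ver_rot]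
    revert this
    generalize t y (s - x) = c, (t (y - 1) (s - x)).hor = l, (t (y + 1) (s - x)).hor = r,
      (t y (s - (x + 1))).ver = d, (t y (s - (x - 1))).ver = u
    revert c l r d u; decide

theorem IsLocal.reflect {t : ℤ → ℤ → Ty} (h : IsLocal t) : IsLocal (reflect t) where
  h x y := by
    have := h.v y x
    unfold KingSnake.reflect
    revert this
    generalize t y x = a, t y (x + 1) = b
    revert a b; decide
  v x y := by
    have := h.h y x
    unfold KingSnake.reflect
    revert this
    generalize t y x = a, t (y + 1) x = b
    revert a b; decide
  d x y := by
    have := h.d y x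
    unfold KingSnake.reflect
    revert this
    generalize t y x = a, t (y + 1) (x + 1) = b
    revert a b; decide
  e x y := by
    have := h.e y x
    unfold KingSnake.reflect
    revert this
    generalize t y (x + 1) = a, t (y + 1) x = b
    revert a b; decide
  turn x y := by
    have := h.turn y x
    simp only [KingSnake.reflect, hor_swap, ver_swap]
    revert this
    generalize t y x = c, (t (y - 1) x).hor = l, (t (y + 1) x).hor = r, (t y (x - 1)).ver = d,
      (t y (x + 1)).ver = u
    revert c l r d u; decide

theorem IsValid.rotate {lo hi : ℤ} {t : ℤ → ℤ → Ty} (h : IsValid lo hi t) :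
    IsValid lo hi (rotate (lo + hi) t) where
  supp x y := by
    have := h.supp y (lo + hi - x)
    simp only [KingSnake.rotate, ne_eq, rot_eq_E, InSq] at this ⊢
    rw [this]; omega
  loc := h.loc.rotate _
  conn A hA x y x' y' hxy hxy' hx := by
    have key := h.conn (fun u v => A (lo + hi - v) u) ⟨fun u v h1 h2 => ?_, fun u v h1 h2 => ?_⟩
      y (lo + hi - x) y' (lo + hi - x')
      (by simpa [KingSnake.rotate, rot_eq_E] using hxy)
      (by simpa [KingSnake.rotate, rot_eq_E] using hxy')
      (by simpa using hx)
    · simpa using key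
    · exact hA.2 (lo + hi - v) u (by simpa [KingSnake.rotate, ver_rot] using h1)
        (by simpa [KingSnake.rotate, ver_rot] using h2)
    · have := hA.1 (lo + hi - (v + 1)) u (by simpa [KingSnake.rotate, hor_rot] using h2)
        (by simpa [KingSnake.rotate, hor_rot,
          show lo + hi - (lo + hi - (v + 1) + 1) = v by ring] using h1)
      rw [show lo + hi - (v + 1) + 1 = lo + hi - v by ring] at this
      exact this.symm

theorem IsValid.reflect {lo hi : ℤ} {t : ℤ → ℤ → Ty} (h : IsValid lo hi t) :
    IsValid lo hi (reflect t) where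
  supp x y := by
    have := h.supp y x
    simp only [KingSnake.reflect, ne_eq, swap_eq_E, InSq] at this ⊢
    rw [this]; omega
  loc := h.loc.reflect
  conn A hA x y x' y' hxy hxy' hx := by
    refine h.conn (fun u v => A v u) ⟨fun u v h1 h2 => ?_, fun u v h1 h2 => ?_⟩ y x y' x'
      (by simpa [KingSnake.reflect, swap_eq_E] using hxy)
      (by simpa [KingSnake.reflect, swap_eq_E] using hxy') hx
    · exact hA.2 v u (by simpa [KingSnake.reflect, ver_swap] using h1)
        (by simpa [KingSnake.reflect, ver_swap] using h2)
    · exact hA.1 v u (by simpa [KingSnake.reflect, hor_swap] using h1)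
        (by simpa [KingSnake.reflect, hor_swap] using h2)

theorem reflect_reflect (t : ℤ → ℤ → Ty) : reflect (reflect t) = t := by
  funext x y
  have : ∀ a : Ty, a.swap.swap = a := by decide
  simp [reflect, this]

theorem rotate_rotate_rotate_rotate (s : ℤ) (t : ℤ → ℤ → Ty) :
    rotate s (rotate s (rotate s (rotate s t))) = t := by
  funext x y
  have : ∀ a : Ty, a.rot.rot.rot.rot = a := by decide
  simp [rotate, this]

end KingSnake

/-! ### Ends of connected graphs of maximum degree two -/

namespace KingSnake

/-- A connected finite graph of maximum degree at most two has at most two vertices of degree at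
most one. -/
theorem eq_of_degree_le_one {V : Type*} [Fintype V] {G : SimpleGraph V} [DecidableRel G.Adj]
    (hG : G.Connected) (h2 : ∀ v, G.degree v ≤ 2) {a b c : V} (ha : G.degree a ≤ 1)
    (hb : G.degree b ≤ 1) (hc : G.degree c ≤ 1) : a = b ∨ a = c ∨ b = c := by
  classical
  by_contra! hne
  have h1 := hG.card_vert_le_card_edgeSet_add_one
  have h3 := G.sum_degrees_eq_twice_card_edges
  -- Each of the three vertices lacks one in degree, so `2 |E| + 3 ≤ 2 |V|`, against `|V| ≤ |E| +
  -- 1`.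
  have h4 : ∑ v, (G.degree v + if v ∈ ({a, b, c} : Finset V) then 1 else 0) ≤ ∑ _v : V, 2 := by
    refine Finset.sum_le_sum fun v _ => ?_
    split_ifs with h
    · simp only [Finset.mem_insert, Finset.mem_singleton] at h
      rcases h with rfl | rfl | rfl <;> omega
    · exact h2 v
  rw [Finset.sum_add_distrib, h3, Finset.sum_ite_mem, Finset.univ_inter] at h4
  have h5 : ({a, b, c} : Finset V).card = 3 := Finset.card_eq_three.2
      ⟨a, b, c, hne.1, hne.2.1, hne.2.2, rfl⟩
  simp only [Finset.sum_const, h5, Finset.card_univ, smul_eq_mul] at h4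
  rw [Nat.card_eq_fintype_card, Nat.card_eq_fintype_card, ← SimpleGraph.edgeFinset_card] at h1
  omega

/-- A connected finite graph of maximum degree at most two with a vertex of degree at most one is a
tree. -/
theorem isTree_of_degree_le_one {V : Type*} [Fintype V] {G : SimpleGraph V} [DecidableRel G.Adj]
    (hG : G.Connected) (h2 : ∀ v, G.degree v ≤ 2) {a : V} (ha : G.degree a ≤ 1) : G.IsTree := by
  classical
  rw [SimpleGraph.isTree_iff_connected_and_card]
  refine ⟨hG, ?_⟩
  have h1 := hG.card_vert_le_card_edgeSet_add_one
  have h3 := G.sum_degrees_eq_twice_card_edges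
  have h4 : ∑ v, (G.degree v + if v ∈ ({a} : Finset V) then 1 else 0) ≤ ∑ _v : V, 2 := by
    refine Finset.sum_le_sum fun v _ => ?_
    split_ifs with h
    · simp only [Finset.mem_singleton] at h
      subst h; omega
    · exact h2 v
  rw [Finset.sum_add_distrib, h3, Finset.sum_ite_mem, Finset.univ_inter] at h4
  simp only [Finset.sum_const, Finset.card_singleton, Finset.card_univ, smul_eq_mul] at h4
  rw [Nat.card_eq_fintype_card, Nat.card_eq_fintype_card, ← SimpleGraph.edgeFinset_card] at h1 ⊢
  omega

end KingSnake

/-! ### The graph of joined blocks -/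

namespace KingSnake

open Ty

/-- Two neighbouring blocks are joined by an edge of the snake. -/
def Joined (t : ℤ → ℤ → Ty) (a b : ℤ × ℤ) : Prop :=
  (a.2 = b.2 ∧ (b.1 = a.1 + 1 ∨ a.1 = b.1 + 1) ∧ (t a.1 a.2).hor ∧ (t b.1 b.2).hor) ∨
  (a.1 = b.1 ∧ (b.2 = a.2 + 1 ∨ a.2 = b.2 + 1) ∧ (t a.1 a.2).ver ∧ (t b.1 b.2).ver)

theorem Joined.symm {t : ℤ → ℤ → Ty} {a b : ℤ × ℤ} (h : Joined t a b) : Joined t b a := by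
  unfold Joined at *; grind

/-- The graph of the blocks in `U`. -/
def joinGraph (t : ℤ → ℤ → Ty) (U : Set (ℤ × ℤ)) : SimpleGraph U where
  Adj a b := Joined t a b
  symm := ⟨fun _ _ h => h.symm⟩
  loopless := ⟨fun a h => by unfold Joined at h; omega⟩

/-- Only an inequality, since `deg` also counts joins to blocks outside `U`. -/
theorem joinGraph_degree_le (t : ℤ → ℤ → Ty) (U : Set (ℤ × ℤ)) [Fintype U]
    [DecidableRel (joinGraph t U).Adj] (v : U) :
    (joinGraph t U).degree v ≤ deg t v.1.1 v.1.2 := by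
  classical
  obtain ⟨⟨x, y⟩, hv⟩ := v
  have hsub : ((joinGraph t U).neighborFinset ⟨(x, y), hv⟩).image Subtype.val ⊆
      ((if (t x y).hor && (t (x - 1) y).hor then {(x - 1, y)} else ∅) ∪
        (if (t x y).hor && (t (x + 1) y).hor then {(x + 1, y)} else ∅)) ∪
      ((if (t x y).ver && (t x (y - 1)).ver then {(x, y - 1)} else ∅) ∪
        (if (t x y).ver && (t x (y + 1)).ver then {(x, y + 1)} else ∅)) := by
    intro p hp
    obtain ⟨⟨⟨x', y'⟩, hp'⟩, hadj, rfl⟩ := Finset.mem_image.1 hp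
    rw [SimpleGraph.mem_neighborFinset] at hadj
    rcases hadj with ⟨h1, h2, h3, h4⟩ | ⟨h1, h2, h3, h4⟩ <;> dsimp only at h1 h2 h3 h4 <;>
      subst h1 <;> rcases h2 with rfl | rfl <;> simp [h3, h4]
  have h1 := Finset.card_le_card hsub
  rw [Finset.card_image_of_injective _ Subtype.val_injective] at h1
  refine h1.trans ((Finset.card_union_le _ _).trans
    (Nat.add_le_add ((Finset.card_union_le _ _).trans (Nat.add_le_add ?_ ?_))
      ((Finset.card_union_le _ _).trans (Nat.add_le_add ?_ ?_)))) <;>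
  · split_ifs with h <;> simp [h]

/-- Reachability from a fixed block is a closed predicate in the sense of `Closed`; it is stated for
all membership proofs so that it makes sense on the whole plane. -/
theorem IsValid.connected {lo hi : ℤ} {t : ℤ → ℤ → Ty} (h : IsValid lo hi t) (hlo : lo ≤ hi)
    {U : Set (ℤ × ℤ)} (hU : ∀ p : ℤ × ℤ, p ∈ U ↔ InSq lo hi p.1 p.2) :
    (joinGraph t U).Connected := by
  have : Nonempty U := ⟨⟨(lo, lo), (hU _).2 (by simp [InSq, hlo])⟩⟩
  refine ⟨fun u v => ?_⟩
  have key := h.conn (fun x y => ∀ hp : (x, y) ∈ U, (joinGraph t U).Reachable u ⟨(x, y), hp⟩)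
    ⟨fun x y h1 h2 => ?_, fun x y h1 h2 => ?_⟩ u.1.1 u.1.2 v.1.1 v.1.2
    ((h.supp _ _).2 ((hU _).1 u.2)) ((h.supp _ _).2 ((hU _).1 v.2))
    (fun _ => SimpleGraph.Reachable.refl _) v.2
  · exact key
  · have m1 : (x, y) ∈ U := (hU _).2 ((h.supp x y).1 (by intro h; simp [h, hor] at h1))
    have m2 : (x + 1, y) ∈ U := (hU _).2 ((h.supp _ _).1 (by intro h; simp [h, hor] at h2))
    have hadj : (joinGraph t U).Adj ⟨(x, y), m1⟩ ⟨(x + 1, y), m2⟩ :=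
      Or.inl ⟨rfl, Or.inl rfl, h1, h2⟩
    exact ⟨fun k _ => (k m1).trans hadj.reachable, fun k _ => (k m2).trans hadj.symm.reachable⟩
  · have m1 : (x, y) ∈ U := (hU _).2 ((h.supp x y).1 (by intro h; simp [h, ver] at h1))
    have m2 : (x, y + 1) ∈ U := (hU _).2 ((h.supp _ _).1 (by intro h; simp [h, ver] at h2))
    have hadj : (joinGraph t U).Adj ⟨(x, y), m1⟩ ⟨(x, y + 1), m2⟩ :=
      Or.inr ⟨rfl, Or.inl rfl, h1, h2⟩
    exact ⟨fun k _ => (k m1).trans hadj.reachable, fun k _ => (k m2).trans hadj.symm.reachable⟩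

theorem finite_setOf_inSq (lo hi : ℤ) : {p : ℤ × ℤ | InSq lo hi p.1 p.2}.Finite :=
  ((Finset.Icc lo hi) ×ˢ (Finset.Icc lo hi)).finite_toSet.subset fun _ hp =>
    Finset.mem_coe.2 (Finset.mem_product.2 ⟨Finset.mem_Icc.2 hp.1, Finset.mem_Icc.2 hp.2⟩)

/-- At most two blocks are joined to at most one other block. -/
theorem IsValid.ends {lo hi : ℤ} {t : ℤ → ℤ → Ty} (h : IsValid lo hi t) {x₁ y₁ x₂ y₂ x₃ y₃ : ℤ}
    (m₁ : InSq lo hi x₁ y₁) (m₂ : InSq lo hi x₂ y₂) (m₃ : InSq lo hi x₃ y₃)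
    (h₁ : deg t x₁ y₁ ≤ 1) (h₂ : deg t x₂ y₂ ≤ 1) (h₃ : deg t x₃ y₃ ≤ 1) :
    (x₁ = x₂ ∧ y₁ = y₂) ∨ (x₁ = x₃ ∧ y₁ = y₃) ∨ (x₂ = x₃ ∧ y₂ = y₃) := by
  classical
  set U := {p : ℤ × ℤ | InSq lo hi p.1 p.2} with hU
  have : Fintype U := (finite_setOf_inSq lo hi).fintype
  have hc := h.connected (by unfold InSq at m₁; omega) (U := U) (fun p => Iff.rfl)
  have hd := joinGraph_degree_le t U
  have := eq_of_degree_le_one hc (fun v => (hd v).trans (h.loc.deg_le _ _))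
    (a := ⟨(x₁, y₁), m₁⟩) (b := ⟨(x₂, y₂), m₂⟩) (c := ⟨(x₃, y₃), m₃⟩)
    ((hd _).trans h₁) ((hd _).trans h₂) ((hd _).trans h₃)
  simpa using this

end KingSnake

/-! ### Propagation of types along rows and columns, and the corners of the square -/

namespace KingSnake

open Ty

theorem deg_le_one_of_not_right_down_up {t : ℤ → ℤ → Ty} {x y : ℤ}
    (r : ¬((t x y).hor ∧ (t (x + 1) y).hor)) (d : ¬((t x y).ver ∧ (t x (y - 1)).ver))
    (u : ¬((t x y).ver ∧ (t x (y + 1)).ver)) : deg t x y ≤ 1 := by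
  rw [← Bool.and_eq_true, Bool.not_eq_true] at r d u
  simp [deg, r, d, u, Bool.toNat_le]

theorem deg_le_one_of_not_left_down_up {t : ℤ → ℤ → Ty} {x y : ℤ}
    (l : ¬((t x y).hor ∧ (t (x - 1) y).hor)) (d : ¬((t x y).ver ∧ (t x (y - 1)).ver))
    (u : ¬((t x y).ver ∧ (t x (y + 1)).ver)) : deg t x y ≤ 1 := by
  rw [← Bool.and_eq_true, Bool.not_eq_true] at l d u
  simp [deg, l, d, u, Bool.toNat_le]

theorem deg_le_one_of_not_left_right_up {t : ℤ → ℤ → Ty} {x y : ℤ}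
    (l : ¬((t x y).hor ∧ (t (x - 1) y).hor)) (r : ¬((t x y).hor ∧ (t (x + 1) y).hor))
    (u : ¬((t x y).ver ∧ (t x (y + 1)).ver)) : deg t x y ≤ 1 := by
  rw [← Bool.and_eq_true, Bool.not_eq_true] at l r u
  simp [deg, l, r, u, Bool.toNat_le]

theorem deg_le_one_of_not_left_right_down {t : ℤ → ℤ → Ty} {x y : ℤ}
    (l : ¬((t x y).hor ∧ (t (x - 1) y).hor)) (r : ¬((t x y).hor ∧ (t (x + 1) y).hor))
    (d : ¬((t x y).ver ∧ (t x (y - 1)).ver)) : deg t x y ≤ 1 := by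
  rw [← Bool.and_eq_true, Bool.not_eq_true] at l r d
  simp [deg, l, r, d, Bool.toNat_le]

namespace IsLocal

variable {t : ℤ → ℤ → Ty} (h : IsLocal t) {x y : ℤ}
include h

/-- Exactly one cell faces the next block, whose left column can therefore hold at most one cell;
the only nonempty block with none there is `R`. -/
theorem hor_right (h1 : (t x y).hor) (h2 : t (x + 1) y ≠ E) :
    (t (x + 1) y).hor ∨ t (x + 1) y = R := by
  have := h.h x y
  revert this h1 h2
  generalize t x y = a, t (x + 1) y = b
  revert a b; decide

/-- Two facing cells leave no room in the left column of the next block, so an `R` propagates to the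
boundary. -/
theorem R_right (h1 : t x y = R) (h2 : t (x + 1) y ≠ E) : t (x + 1) y = R := by
  have := h.h x y
  revert this h1 h2
  generalize t x y = a, t (x + 1) y = b
  revert a b; decide

theorem ver_up (h1 : (t x y).ver) (h2 : t x (y + 1) ≠ E) :
    (t x (y + 1)).ver ∨ t x (y + 1) = T := by
  have := h.v x y
  revert this h1 h2
  generalize t x y = a, t x (y + 1) = b
  revert a b; decide

theorem T_up (h1 : t x y = T) (h2 : t x (y + 1) ≠ E) : t x (y + 1) = T := by
  have := h.v x y
  revert this h1 h2
  generalize t x y = a, t x (y + 1) = b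
  revert a b; decide

theorem ver_down (h1 : (t x y).ver) (h2 : t x (y - 1) ≠ E) :
    (t x (y - 1)).ver ∨ t x (y - 1) = B := by
  have := h.v x (y - 1)
  rw [sub_add_cancel] at this
  revert this h1 h2
  generalize t x y = a, t x (y - 1) = b
  revert a b; decide

/-- A block joined to its left and right neighbours is not joined to any other. -/
theorem not_ver_of_hor (h1 : (t x y).hor) (h2 : (t (x - 1) y).hor) (h3 : (t (x + 1) y).hor)
    (h4 : (t x y).ver) : ¬(t x (y - 1)).ver ∧ ¬(t x (y + 1)).ver := by
  have := h.turn x y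
  rw [h2, h3] at this
  revert this h1 h4
  generalize t x y = c, (t x (y - 1)).ver = d, (t x (y + 1)).ver = u
  revert c d u; decide

theorem not_hor_of_ver (h1 : (t x y).ver) (h2 : (t x (y - 1)).ver) (h3 : (t x (y + 1)).ver)
    (h4 : (t x y).hor) : ¬(t (x - 1) y).hor ∧ ¬(t (x + 1) y).hor := by
  have := h.turn x y
  rw [h2, h3] at this
  revert this h1 h4
  generalize t x y = c, (t (x - 1) y).hor = d, (t (x + 1) y).hor = u
  revert c d u; decide

/-- A block that is `hor` and `ver` is diagonal, and a `Z` would attach both neighbours to its top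
left cell. The next three lemmas treat the other turns. -/
theorem eq_S_of_left_up (h1 : (t x y).hor) (h2 : (t x y).ver) (h3 : (t (x - 1) y).hor)
    (h4 : (t x (y + 1)).ver) : t x y = S := by
  have := h.turn x y
  rw [h3, h4] at this
  revert this h1 h2
  generalize t x y = c, (t (x + 1) y).hor = d, (t x (y - 1)).ver = u
  revert c d u; decide

theorem eq_S_of_right_down (h1 : (t x y).hor) (h2 : (t x y).ver) (h3 : (t (x + 1) y).hor)
    (h4 : (t x (y - 1)).ver) : t x y = S := by
  have := h.turn x y
  rw [h3, h4] at this
  revert this h1 h2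
  generalize t x y = c, (t (x - 1) y).hor = d, (t x (y + 1)).ver = u
  revert c d u; decide

theorem eq_Z_of_right_up (h1 : (t x y).hor) (h2 : (t x y).ver) (h3 : (t (x + 1) y).hor)
    (h4 : (t x (y + 1)).ver) : t x y = Z := by
  have := h.turn x y
  rw [h3, h4] at this
  revert this h1 h2
  generalize t x y = c, (t (x - 1) y).hor = d, (t x (y - 1)).ver = u
  revert c d u; decide

theorem eq_Z_of_left_down (h1 : (t x y).hor) (h2 : (t x y).ver) (h3 : (t (x - 1) y).hor)
    (h4 : (t x (y - 1)).ver) : t x y = Z := by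
  have := h.turn x y
  rw [h3, h4] at this
  revert this h1 h2
  generalize t x y = c, (t (x + 1) y).hor = d, (t x (y + 1)).ver = u
  revert c d u; decide

end IsLocal

namespace IsValid

variable {lo hi : ℤ} {t : ℤ → ℤ → Ty} (h : IsValid lo hi t)
include h

theorem eq_E {x y : ℤ} (hxy : ¬InSq lo hi x y) : t x y = E := by
  by_contra h'; exact hxy ((h.supp x y).1 h')

theorem not_closed {A : ℤ → ℤ → Prop} (hA : Closed t A) {x y x' y' : ℤ} (m : InSq lo hi x y)
    (m' : InSq lo hi x' y') (hx : A x y) (hx' : ¬A x' y') : False :=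
  hx' (h.conn A hA x y x' y' ((h.supp _ _).2 m) ((h.supp _ _).2 m') hx)

theorem not_hor_of_left {x y : ℤ} (hx : x < lo) : ¬(t x y).hor := by
  rw [h.eq_E (by unfold InSq; omega)]; decide
theorem not_hor_of_right {x y : ℤ} (hx : hi < x) : ¬(t x y).hor := by
  rw [h.eq_E (by unfold InSq; omega)]; decide
theorem not_ver_of_down {x y : ℤ} (hx : y < lo) : ¬(t x y).ver := by
  rw [h.eq_E (by unfold InSq; omega)]; decide
theorem not_ver_of_up {x y : ℤ} (hx : hi < y) : ¬(t x y).ver := by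
  rw [h.eq_E (by unfold InSq; omega)]; decide

theorem deg_bottom {x : ℤ} (hx : ¬(t x lo).hor) : deg t x lo ≤ 1 :=
  deg_le_one_of_not_left_right_down (fun k => hx k.1) (fun k => hx k.1)
    (fun k => h.not_ver_of_down (by omega) k.2)
theorem deg_top {x : ℤ} (hx : ¬(t x hi).hor) : deg t x hi ≤ 1 :=
  deg_le_one_of_not_left_right_up (fun k => hx k.1) (fun k => hx k.1)
    (fun k => h.not_ver_of_up (by omega) k.2)
theorem deg_left {y : ℤ} (hy : ¬(t lo y).ver) : deg t lo y ≤ 1 :=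
  deg_le_one_of_not_left_down_up (fun k => h.not_hor_of_left (by omega) k.2) (fun k => hy k.1)
    (fun k => hy k.1)
theorem deg_right {y : ℤ} (hy : ¬(t hi y).ver) : deg t hi y ≤ 1 :=
  deg_le_one_of_not_right_down_up (fun k => h.not_hor_of_right (by omega) k.2) (fun k => hy k.1)
    (fun k => hy k.1)

/-- The lower left corner is an end of the path or a turn. -/
theorem corner (hlo : lo + 2 ≤ hi) : t lo lo = B ∨ t lo lo = L ∨
    (t lo lo = Z ∧ (t (lo + 1) lo).hor ∧ (t lo (lo + 1)).ver) := by
  have hR : ∀ x, t x lo = R → lo ≤ x → x + 1 ≤ hi → t (x + 1) lo = R := fun x h1 h2 h3 =>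
    h.loc.R_right h1 ((h.supp _ _).2 (by unfold InSq; omega))
  have hT : ∀ y, t lo y = T → lo ≤ y → y + 1 ≤ hi → t lo (y + 1) = T := fun x h1 h2 h3 =>
    h.loc.T_up h1 ((h.supp _ _).2 (by unfold InSq; omega))
  -- The `R` would be followed by another one, which gives three ends on the bottom side. This is
  -- where a side of at least three blocks is needed.
  have hR1 : t (lo + 1) lo = R → ¬deg t lo lo ≤ 1 := by
    intro h1 h0
    have h2 := hR _ h1 (by omega) (by omega)
    have := h.ends (x₁ := lo) (y₁ := lo) (x₂ := lo + 1) (y₂ := lo) (x₃ := lo + 1 + 1) (y₃ := lo)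
      (by unfold InSq; omega) (by unfold InSq; omega) (by unfold InSq; omega) h0
      (h.deg_bottom (by simp [h1, hor])) (h.deg_bottom (by simp [h2, hor]))
    omega
  have hT1 : t lo (lo + 1) = T → ¬deg t lo lo ≤ 1 := by
    intro h1 h0
    have h2 := hT _ h1 (by omega) (by omega)
    have := h.ends (x₁ := lo) (y₁ := lo) (x₂ := lo) (y₂ := lo + 1) (x₃ := lo) (y₃ := lo + 1 + 1)
      (by unfold InSq; omega) (by unfold InSq; omega) (by unfold InSq; omega) h0
      (h.deg_left (by simp [h1, ver])) (h.deg_left (by simp [h2, ver]))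
    omega
  have nl := h.not_hor_of_left (x := lo - 1) (y := lo) (by omega)
  have nd := h.not_ver_of_down (x := lo) (y := lo - 1) (by omega)
  have n0 : t lo lo ≠ E := (h.supp _ _).2 (by unfold InSq; omega)
  have n1 : t (lo + 1) lo ≠ E := (h.supp _ _).2 (by unfold InSq; omega)
  have n2 : t lo (lo + 1) ≠ E := (h.supp _ _).2 (by unfold InSq; omega)
  have key : (t lo lo).hor → (t lo lo).ver → (t (lo + 1) lo).hor ∧ (t lo (lo + 1)).ver := by
    intro k1 k2
    constructor
    · refine (h.loc.hor_right k1 n1).resolve_right fun k => hR1 k ?_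
      exact deg_le_one_of_not_left_right_down (fun k => nl k.2)
        (fun k' => by simp [k, hor] at k') (fun k => nd k.2)
    · refine (h.loc.ver_up k2 n2).resolve_right fun k => hT1 k ?_
      exact deg_le_one_of_not_left_down_up (fun k => nl k.2) (fun k => nd k.2)
        (fun k' => by simp [k, ver] at k')
  cases h0 : t lo lo with
  | E => exact absurd h0 n0
  | L => simp
  | B => simp
  | R => exact (hR1 (hR _ h0 le_rfl (by omega)) (h.deg_bottom (by simp [h0, hor]))).elim
  | T => exact (hT1 (hT _ h0 le_rfl (by omega)) (h.deg_left (by simp [h0, ver]))).elim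
  | Z => rw [h0] at key; exact Or.inr (Or.inr ⟨rfl, key rfl rfl⟩)
  | S =>
    have k := key (by rw [h0]; rfl) (by rw [h0]; rfl)
    -- Both neighbours would be attached to the top right cell of the `S`.
    have := h.loc.turn lo lo
    simp [h0, turnOK, k] at this

/-- Obtained by a rotation from the lower left corner; each further corner follows from the
preceding one. -/
theorem corner_upper_left (hlo : lo + 2 ≤ hi) : t lo hi = L ∨ t lo hi = T ∨
    (t lo hi = S ∧ (t lo (hi - 1)).ver ∧ (t (lo + 1) hi).hor) := by
  have := h.rotate.corner hlo
  simp only [KingSnake.rotate, hor_rot, ver_rot, add_sub_cancel_left,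
    show lo + hi - (lo + 1) = hi - 1 by ring] at this
  revert this
  generalize t lo hi = a, (t lo (hi - 1)).ver = b, (t (lo + 1) hi).hor = c
  revert a b c; decide

theorem corner_upper_right (hlo : lo + 2 ≤ hi) : t hi hi = T ∨ t hi hi = R ∨
    (t hi hi = Z ∧ (t (hi - 1) hi).hor ∧ (t hi (hi - 1)).ver) := by
  have := h.rotate.corner_upper_left hlo
  simp only [KingSnake.rotate, hor_rot, ver_rot, add_sub_cancel_left,
    show lo + hi - (lo + 1) = hi - 1 by ring] at this
  revert this
  generalize t hi hi = a, (t (hi - 1) hi).hor = b, (t hi (hi - 1)).ver = c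
  revert a b c; decide

theorem corner_lower_right (hlo : lo + 2 ≤ hi) : t hi lo = R ∨ t hi lo = B ∨
    (t hi lo = S ∧ (t hi (lo + 1)).ver ∧ (t (hi - 1) lo).hor) := by
  have := h.rotate.corner_upper_right hlo
  simp only [KingSnake.rotate, hor_rot, ver_rot, add_sub_cancel_right,
    show lo + hi - (hi - 1) = lo + 1 by ring] at this
  revert this
  generalize t hi lo = a, (t hi (lo + 1)).ver = b, (t (hi - 1) lo).hor = c
  revert a b c; decide

end IsValid

end KingSnake

/-! ### The five types of the outermost frame -/

namespace KingSnake

open Ty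

instance : DecidableEq FrameType := fun a b => by
  cases a <;> cases b <;> first | exact isTrue rfl | exact isFalse (fun k => by cases k)

/-- The way in which the outermost frame is traversed when the path has an end in the lower left
corner and starts along the bottom side. -/
structure Frame (T : FrameType) (lo hi : ℤ) (t : ℤ → ℤ → Ty) : Prop where
  size : lo + 2 ≤ hi
  -- The block excepted from a side is the second end of the path: the corner `b`, `c`, `d` for the
  -- types V, IV, III, and the block above `a` for type II.
  bottom : ∀ x, lo ≤ x → x ≤ hi → (T = .V → x ≤ hi - 1) → (t x lo).hor
  right : ∀ y, lo ≤ y → y ≤ hi → (T = .IV → y ≤ hi - 1) → (t hi y).ver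
  top : ∀ x, lo ≤ x → x ≤ hi → (T = .III → lo + 1 ≤ x) → (t x hi).hor
  left : ∀ y, lo + 1 ≤ y → y ≤ hi → (T = .II → lo + 2 ≤ y) → (t lo y).ver
  a : t lo lo = B
  b : t hi lo = if T = .V then R else S
  c : t hi hi = if T = .IV then Ty.T else Z
  d : t lo hi = if T = .III then L else S
  entry : (t (lo + 1) (lo + 1)).hor
  second : t lo (lo + 1) = if T = .II then B else Z
  two : T = .II → lo + 3 ≤ hi ∧ t lo (lo + 2) = Z ∧ (t (lo + 1) (lo + 2)).hor
  three : T = .III → t (lo + 1) hi = S ∧ (t (lo + 1) (hi - 1)).ver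
  four : T = .IV → t hi (hi - 1) = Z ∧ (t (hi - 1) (hi - 1)).hor
  five : T = .V → t (hi - 1) lo = S ∧ (t (hi - 1) (lo + 1)).ver

namespace IsValid

variable {lo hi : ℤ} {t : ℤ → ℤ → Ty} (h : IsValid lo hi t)
include h

theorem inSq_of_hor {x y : ℤ} (k : (t x y).hor) : InSq lo hi x y :=
  (h.supp _ _).1 fun e => by simp [e, hor] at k

theorem inSq_of_ver {x y : ℤ} (k : (t x y).ver) : InSq lo hi x y :=
  (h.supp _ _).1 fun e => by simp [e, ver] at k

theorem R_of_le {x x' y : ℤ} (k : t x y = R) (hx : x ≤ x') (hx' : x' ≤ hi) : t x' y = R := by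
  have m := (h.supp x y).1 (by simp [k])
  induction x', hx using Int.leInduction with
  | base => exact k
  | succ z hz ih =>
    exact h.loc.R_right (ih (by omega)) ((h.supp _ _).2 (by unfold InSq at *; omega))

theorem T_of_le {x y y' : ℤ} (k : t x y = Ty.T) (hy : y ≤ y') (hy' : y' ≤ hi) :
    t x y' = Ty.T := by
  have m := (h.supp x y).1 (by simp [k])
  induction y', hy using Int.leInduction with
  | base => exact k
  | succ z hz ih =>
    exact h.loc.T_up (ih (by omega)) ((h.supp _ _).2 (by unfold InSq at *; omega))

theorem hor_or_R {x x' y : ℤ} (k : (t x y).hor) (hx : x ≤ x') (hx' : x' ≤ hi) :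
    (t x' y).hor ∨ t x' y = R := by
  have m := h.inSq_of_hor k
  induction x', hx using Int.leInduction with
  | base => exact Or.inl k
  | succ z hz ih =>
    have n : t (z + 1) y ≠ E := (h.supp _ _).2 (by unfold InSq at *; omega)
    rcases ih (by omega) with k | k
    · exact h.loc.hor_right k n
    · exact Or.inr (h.loc.R_right k n)

theorem ver_or_T {x y y' : ℤ} (k : (t x y).ver) (hy : y ≤ y') (hy' : y' ≤ hi) :
    (t x y').ver ∨ t x y' = Ty.T := by
  have m := h.inSq_of_ver k
  induction y', hy using Int.leInduction with
  | base => exact Or.inl k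
  | succ z hz ih =>
    have n : t x (z + 1) ≠ E := (h.supp _ _).2 (by unfold InSq at *; omega)
    rcases ih (by omega) with k | k
    · exact h.loc.ver_up k n
    · exact Or.inr (h.loc.T_up k n)

/-- The blocks of a row which are joined to horizontal neighbours are consecutive. -/
theorem hor_between {x x' x'' y : ℤ} (k : (t x y).hor) (k'' : (t x'' y).hor) (h1 : x ≤ x')
    (h2 : x' ≤ x'') : (t x' y).hor := by
  have m := h.inSq_of_hor k''
  refine (h.hor_or_R k h1 (by unfold InSq at m; omega)).resolve_right fun e => ?_
  have := h.R_of_le e h2 (by unfold InSq at m; omega)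
  simp [this, hor] at k''

theorem ver_between {x y y' y'' : ℤ} (k : (t x y).ver) (k'' : (t x y'').ver) (h1 : y ≤ y')
    (h2 : y' ≤ y'') : (t x y').ver := by
  have m := h.inSq_of_ver k''
  refine (h.ver_or_T k h1 (by unfold InSq at m; omega)).resolve_right fun e => ?_
  have := h.T_of_le e h2 (by unfold InSq at m; omega)
  simp [this, ver] at k''

/-- Not all corners are turns. -/
theorem exists_corner (hlo : lo + 2 ≤ hi) : (t lo lo = B ∨ t lo lo = L) ∨
    (t hi lo = R ∨ t hi lo = B) ∨ (t hi hi = Ty.T ∨ t hi hi = R) ∨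
    (t lo hi = L ∨ t lo hi = Ty.T) := by
  by_contra! hn
  obtain ⟨⟨a1, a2⟩, ⟨b1, b2⟩, ⟨c1, c2⟩, d1, d2⟩ := hn
  have ha := ((h.corner hlo).resolve_left a1).resolve_left a2
  have hb := ((h.corner_lower_right hlo).resolve_left b1).resolve_left b2
  have hc := ((h.corner_upper_right hlo).resolve_left c1).resolve_left c2
  have hd := ((h.corner_upper_left hlo).resolve_left d1).resolve_left d2
  have bot : ∀ x, lo ≤ x → x ≤ hi → (t x lo).hor := fun x h1 h2 =>
    h.hor_between (by rw [ha.1]; rfl) (by rw [hb.1]; rfl) h1 h2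
  have top : ∀ x, lo ≤ x → x ≤ hi → (t x hi).hor := fun x h1 h2 =>
    h.hor_between (by rw [hd.1]; rfl) (by rw [hc.1]; rfl) h1 h2
  have lef : ∀ y, lo ≤ y → y ≤ hi → (t lo y).ver := fun y h1 h2 =>
    h.ver_between (by rw [ha.1]; rfl) (by rw [hd.1]; rfl) h1 h2
  have rig : ∀ y, lo ≤ y → y ≤ hi → (t hi y).ver := fun y h1 h2 =>
    h.ver_between (by rw [hb.1]; rfl) (by rw [hc.1]; rfl) h1 h2
  -- With four turns the frame is a component of its own: a block joined to both neighbours along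
  -- its side cannot be joined to an inner block as well.
  refine h.not_closed (A := fun x y => x = lo ∨ x = hi ∨ y = lo ∨ y = hi) (x := lo) (y := lo)
    (x' := lo + 1) (y' := lo + 1) ⟨fun x y k1 k2 => ?_, fun x y k1 k2 => ?_⟩
    (by unfold InSq; omega) (by unfold InSq; omega) (by omega) (by omega)
  · have m1 := h.inSq_of_hor k1
    have m2 := h.inSq_of_hor k2
    unfold InSq at m1 m2
    by_cases hy : lo < y ∧ y < hi
    · have e1 : x ≠ lo := by
        rintro rfl
        exact (h.loc.not_hor_of_ver (lef y (by omega) (by omega)) (lef _ (by omega) (by omega))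
          (lef _ (by omega) (by omega)) k1).2 k2
      have e2 : x + 1 ≠ hi := by
        rintro rfl
        exact (h.loc.not_hor_of_ver (rig y (by omega) (by omega)) (rig _ (by omega) (by omega))
          (rig _ (by omega) (by omega)) k2).1 (by rwa [add_sub_cancel_right])
      omega
    · omega
  · have m1 := h.inSq_of_ver k1
    have m2 := h.inSq_of_ver k2
    unfold InSq at m1 m2
    by_cases hx : lo < x ∧ x < hi
    · have e1 : y ≠ lo := by
        rintro rfl
        exact (h.loc.not_ver_of_hor (bot x (by omega) (by omega)) (bot _ (by omega) (by omega))
          (bot _ (by omega) (by omega)) k1).2 k2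
      have e2 : y + 1 ≠ hi := by
        rintro rfl
        exact (h.loc.not_ver_of_hor (top x (by omega) (by omega)) (top _ (by omega) (by omega))
          (top _ (by omega) (by omega)) k2).1 (by rwa [add_sub_cancel_right])
      omega
    · omega

/-- If there is an end in the lower left corner from which the path starts along the bottom side,
then the outermost frame has one of the five types. -/
theorem exists_frame (hlo : lo + 2 ≤ hi) (ha : t lo lo = B) : ∃ T, Frame T lo hi t := by
  have dega : deg t lo lo ≤ 1 := h.deg_left (by simp [ha, ver])
  -- The corner already is one of the at most two ends, so all other ends coincide.
  have E1 : ∀ x y x' y', InSq lo hi x y → InSq lo hi x' y' → deg t x y ≤ 1 → deg t x' y' ≤ 1 →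
      (x = lo ∧ y = lo) ∨ (x' = lo ∧ y' = lo) ∨ (x = x' ∧ y = y') := by
    intro x y x' y' m m' d d'
    have := h.ends (x₁ := lo) (y₁ := lo) (by unfold InSq; omega) m m' dega d d'
    omega
  have nl : ∀ y, ¬(t (lo - 1) y).hor := fun y => h.not_hor_of_left (by omega)
  have nr : ∀ y, ¬(t (hi + 1) y).hor := fun y => h.not_hor_of_right (by omega)
  have nd : ∀ x, ¬(t x (lo - 1)).ver := fun x => h.not_ver_of_down (by omega)
  have nu : ∀ x, ¬(t x (hi + 1)).ver := fun x => h.not_ver_of_up (by omega)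
  have n0 : ∀ x y, InSq lo hi x y → t x y ≠ E := fun x y => (h.supp x y).2
  have ahor : (t lo lo).hor := by rw [ha]; rfl
  have aver : ¬(t lo lo).ver := by rw [ha]; decide
  -- An `R` before the last block of the bottom side makes its right neighbour an `R` too, and both
  -- would be ends besides the corner.
  have bot0 : ∀ x, lo ≤ x → x ≤ hi - 1 → (t x lo).hor := fun x h1 h2 =>
    (h.hor_or_R ahor h1 (by omega)).resolve_right fun e => by
      have e' := h.R_of_le (x' := x + 1) e (by omega) (by omega)
      have := E1 x lo (x + 1) lo (by unfold InSq; omega) (by unfold InSq; omega)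
        (h.deg_bottom (by simp [e, hor])) (h.deg_bottom (by simp [e', hor]))
      have : x ≠ lo := by rintro rfl; simp [ha] at e
      omega
  -- the consequences of a second end being known
  have side : ∀ u v, InSq lo hi u v → ¬(u = lo ∧ v = lo) → deg t u v ≤ 1 →
      (∀ y, lo ≤ y → y ≤ hi → ¬(u = hi ∧ v = y) → (t hi y).ver) ∧
      (∀ x, lo ≤ x → x ≤ hi → ¬(u = x ∧ v = hi) → (t x hi).hor) ∧
      (∀ y, lo + 1 ≤ y → y ≤ hi → ¬(u = lo ∧ v = y) → (t lo y).ver) := by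
    intro u v m hne hd
    refine ⟨fun y h1 h2 h3 => ?_, fun x h1 h2 h3 => ?_, fun y h1 h2 h3 => ?_⟩ <;> by_contra k
    · have := E1 u v hi y m (by unfold InSq; omega) hd (h.deg_right k); omega
    · have := E1 u v x hi m (by unfold InSq; omega) hd (h.deg_top k); omega
    · have := E1 u v lo y m (by unfold InSq; omega) hd (h.deg_left k); omega
  -- The corner is `B`, so the block above it has no join downwards; if it is not an end, then it is
  -- joined to the inner block on its right.
  have entry : (t lo (lo + 1)).ver →
      ¬deg t lo (lo + 1) ≤ 1 → (t lo (lo + 1)).hor ∧ (t (lo + 1) (lo + 1)).hor := by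
    intro k1 k2
    by_contra k3
    exact k2 (deg_le_one_of_not_left_right_down (fun k => nl _ k.2) k3
      (fun k => aver (by simpa using k.2)))
  have entryZ : (t lo (lo + 1)).ver → (t lo (lo + 2)).ver → (t lo (lo + 1)).hor →
      (t (lo + 1) (lo + 1)).hor → t lo (lo + 1) = Z := fun k1 k2 k3 k4 =>
    h.loc.eq_Z_of_right_up k3 k1 k4 (by rwa [add_assoc])
  rcases h.corner_lower_right hlo with hb | hb | ⟨hb, hb1, -⟩
  · -- the lower right corner is an end
    obtain ⟨rig, top, lef⟩ := side hi lo (by unfold InSq; omega) (by omega)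
      (h.deg_bottom (by simp [hb, hor]))
    have hc : t hi hi = Z := by
      rcases h.corner_upper_right hlo with hc | hc | hc
      · have := rig hi (by omega) (by omega) (by omega)
        simp [hc, ver] at this
      · have := top hi (by omega) (by omega) (by omega)
        simp [hc, hor] at this
      · exact hc.1
    have hd : t lo hi = S := by
      rcases h.corner_upper_left hlo with hd | hd | hd
      · have := top lo (by omega) (by omega) (by omega)
        simp [hd, hor] at this
      · have := lef hi (by omega) (by omega) (by omega)
        simp [hd, ver] at this
      · exact hd.1
    -- The block to the left of this corner cannot be joined to the `R`. Both ends being used up, it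
    -- has to turn inwards.
    have f : (t (hi - 1) lo).ver ∧ (t (hi - 1) (lo + 1)).ver := by
      by_contra k
      have := E1 (hi - 1) lo hi lo (by unfold InSq; omega) (by unfold InSq; omega)
        (deg_le_one_of_not_right_down_up
          (fun k => by rw [sub_add_cancel, hb] at k; exact absurd k.2 (by decide))
          (fun k => nd _ k.2) k) (h.deg_bottom (by simp [hb, hor]))
      omega
    have g := entry (lef _ (by omega) (by omega) (by omega)) fun k => by
      have := E1 lo (lo + 1) hi lo (by unfold InSq; omega) (by unfold InSq; omega) k
        (h.deg_bottom (by simp [hb, hor]))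
      omega
    exact ⟨.V, hlo, fun x h1 _ h3 => bot0 x h1 (h3 rfl), fun y h1 h2 _ => by
        rcases eq_or_ne y lo with rfl | n
        · rw [hb]; rfl
        · exact rig y h1 h2 (by omega),
      fun x h1 h2 _ => top x h1 h2 (by omega), fun y h1 h2 _ => lef y h1 h2 (by omega), ha,
      by simpa using hb, by simpa using hc, by simpa using hd, g.2,
      by simpa using entryZ (lef _ (by omega) (by omega) (by omega))
            (lef _ (by omega) (by omega) (by omega)) g.1 g.2,
      by simp, by simp, by simp, fun _ => ⟨h.loc.eq_S_of_left_up (bot0 _ (by omega) (by omega)) f.1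
        (bot0 _ (by omega) (by omega)) f.2, f.2⟩⟩
  · -- the bottom side would be a whole component
    have bot : ∀ x, lo ≤ x → x ≤ hi → (t x lo).hor := fun x h1 h2 =>
      h.hor_between ahor (by rw [hb]; rfl) h1 h2
    exact (h.not_closed (A := fun _ y => y = lo) (x := lo) (y := lo) (x' := lo) (y' := lo + 1)
      ⟨fun x y _ _ => Iff.rfl, fun x y k1 k2 => by
        have m1 := h.inSq_of_ver k1
        have m2 := h.inSq_of_ver k2
        unfold InSq at m1 m2
        have e : y ≠ lo := by
          rintro rfl
          rcases eq_or_ne x y with rfl | n1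
          · exact aver k1
          rcases eq_or_ne x hi with rfl | n2
          · rw [hb] at k1; exact absurd k1 (by decide)
          exact (h.loc.not_ver_of_hor (bot x (by omega) (by omega)) (bot _ (by omega) (by omega))
            (bot _ (by omega) (by omega)) k1).2 k2
        omega⟩
      (by unfold InSq; omega) (by unfold InSq; omega) rfl (by omega)).elim
  have bot : ∀ x, lo ≤ x → x ≤ hi → (t x lo).hor := fun x h1 h2 =>
    h.hor_between ahor (by rw [hb]; rfl) h1 h2
  have botn : ∀ x, lo ≤ x → x < hi → ¬((t x lo).ver ∧ (t x (lo + 1)).ver) := by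
    rintro x h1 h2 ⟨k1, k2⟩
    rcases eq_or_ne x lo with rfl | n1
    · exact aver k1
    exact (h.loc.not_ver_of_hor (bot x (by omega) (by omega)) (bot _ (by omega) (by omega))
      (bot _ (by omega) (by omega)) k1).2 k2
  rcases h.corner_upper_right hlo with hc | hc | ⟨hc, -, hc1⟩
  · -- the upper right corner is an end
    obtain ⟨rig, top, lef⟩ := side hi hi (by unfold InSq; omega) (by omega)
      (h.deg_right (by simp [hc, ver]))
    have hd : t lo hi = S := by
      rcases h.corner_upper_left hlo with hd | hd | hd
      · have := top lo (by omega) (by omega) (by omega)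
        simp [hd, hor] at this
      · have := lef hi (by omega) (by omega) (by omega)
        simp [hd, ver] at this
      · exact hd.1
    have f : (t hi (hi - 1)).hor ∧ (t (hi - 1) (hi - 1)).hor := by
      by_contra k
      have := E1 hi (hi - 1) hi hi (by unfold InSq; omega) (by unfold InSq; omega)
        (deg_le_one_of_not_left_right_up (fun k' => k ⟨k'.1, k'.2⟩) (fun k => nr _ k.2)
          (fun k => by rw [sub_add_cancel, hc] at k; exact absurd k.2 (by decide)))
        (h.deg_right (by simp [hc, ver]))
      omega
    have g := entry (lef _ (by omega) (by omega) (by omega)) fun k => by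
      have := E1 lo (lo + 1) hi hi (by unfold InSq; omega) (by unfold InSq; omega) k
        (h.deg_right (by simp [hc, ver]))
      omega
    exact ⟨.IV, hlo, fun x h1 h2 _ => bot x h1 h2, fun y h1 h2 h3 => rig y h1 h2
      (by have := h3 rfl; omega),
      fun x h1 h2 _ => by
        rcases eq_or_ne x hi with rfl | n
        · rw [hc]; rfl
        · exact top x h1 h2 (by omega),
      fun y h1 h2 _ => lef y h1 h2 (by omega), ha,
      by simpa using hb, by simpa using hc, by simpa using hd, g.2,
      by simpa using entryZ (lef _ (by omega) (by omega) (by omega))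
            (lef _ (by omega) (by omega) (by omega)) g.1 g.2,
      by simp, by simp, fun _ => ⟨h.loc.eq_Z_of_left_down f.1
        (rig _ (by omega) (by omega) (by omega)) f.2 (rig _ (by omega) (by omega) (by omega)), f.2⟩,
      by simp⟩
  · -- the bottom and right sides would form a whole component
    have rig : ∀ y, lo ≤ y → y ≤ hi → (t hi y).ver := fun y h1 h2 =>
      h.ver_between (by rw [hb]; rfl) (by rw [hc]; rfl) h1 h2
    refine (h.not_closed (A := fun x y => y = lo ∨ x = hi) (x := lo) (y := lo) (x' := lo)
      (y' := lo + 1) ⟨fun x y k1 k2 => ?_, fun x y k1 k2 => ?_⟩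
      (by unfold InSq; omega) (by unfold InSq; omega) (by omega) (by omega)).elim
    · have m1 := h.inSq_of_hor k1
      have m2 := h.inSq_of_hor k2
      unfold InSq at m1 m2
      have e : x + 1 = hi → y = lo := by
        rintro rfl
        by_contra n
        rcases eq_or_ne y (x + 1) with rfl | n1
        · rw [hc] at k2; exact absurd k2 (by decide)
        exact (h.loc.not_hor_of_ver (rig y (by omega) (by omega)) (rig _ (by omega) (by omega))
          (rig _ (by omega) (by omega)) k2).1 (by rwa [add_sub_cancel_right])
      omega
    · have m1 := h.inSq_of_ver k1
      have m2 := h.inSq_of_ver k2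
      unfold InSq at m1 m2
      have e : y = lo → x = hi := by
        rintro rfl
        by_contra n
        exact botn x (by omega) (by omega) ⟨k1, k2⟩
      omega
  have rig : ∀ y, lo ≤ y → y ≤ hi → (t hi y).ver := fun y h1 h2 =>
    h.ver_between (by rw [hb]; rfl) (by rw [hc]; rfl) h1 h2
  have rign : ∀ y, lo < y → y < hi → ¬((t (hi - 1) y).hor ∧ (t hi y).hor) := by
    rintro y h1 h2 ⟨k1, k2⟩
    exact (h.loc.not_hor_of_ver (rig y (by omega) (by omega)) (rig _ (by omega) (by omega))
      (rig _ (by omega) (by omega)) k2).1 k1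
  rcases h.corner_upper_left hlo with hd | hd | ⟨hd, hd1, hd2⟩
  · -- the upper left corner is an end
    obtain ⟨-, top, lef⟩ := side lo hi (by unfold InSq; omega) (by omega)
      (h.deg_top (by simp [hd, hor]))
    have lef' : ∀ y, lo + 1 ≤ y → y ≤ hi → (t lo y).ver := fun y h1 h2 => by
      rcases eq_or_ne y hi with rfl | n
      · rw [hd]; rfl
      · exact lef y h1 h2 (by omega)
    have f : (t (lo + 1) hi).ver ∧ (t (lo + 1) (hi - 1)).ver := by
      by_contra k
      have := E1 (lo + 1) hi lo hi (by unfold InSq; omega) (by unfold InSq; omega)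
        (deg_le_one_of_not_left_down_up
          (fun k => by rw [add_sub_cancel_right, hd] at k; exact absurd k.2 (by decide))
          k (fun k => nu _ k.2)) (h.deg_top (by simp [hd, hor]))
      omega
    have g := entry (lef' _ (by omega) (by omega)) fun k => by
      have := E1 lo (lo + 1) lo hi (by unfold InSq; omega) (by unfold InSq; omega) k
        (h.deg_top (by simp [hd, hor]))
      omega
    exact ⟨.III, hlo, fun x h1 h2 _ => bot x h1 h2, fun y h1 h2 _ => rig y h1 h2,
      fun x h1 h2 h3 => top x h1 h2 (by have := h3 rfl; omega),
      fun y h1 h2 _ => lef' y h1 h2, ha,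
      by simpa using hb, by simpa using hc, by simpa using hd, g.2,
      by simpa using entryZ (lef' _ (by omega) (by omega))
            (lef' _ (by omega) (by omega)) g.1 g.2,
      by simp, fun _ => ⟨h.loc.eq_S_of_right_down (top _ (by omega) (by omega) (by omega)) f.1
        (top _ (by omega) (by omega) (by omega)) f.2, f.2⟩, by simp, by simp⟩
  all_goals
    have top : ∀ x, lo ≤ x → x ≤ hi → (t x hi).hor := fun x h1 h2 =>
      h.hor_between (by rw [hd]; rfl) (by rw [hc]; rfl) h1 h2
    have topn : ∀ x, lo < x → x < hi → ¬((t x (hi - 1)).ver ∧ (t x hi).ver) := by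
      rintro x h1 h2 ⟨k1, k2⟩
      exact (h.loc.not_ver_of_hor (top x (by omega) (by omega)) (top _ (by omega) (by omega))
        (top _ (by omega) (by omega)) k2).1 k1
  · -- the bottom, right, and top sides would form a whole component
    refine (h.not_closed (A := fun x y => y = lo ∨ x = hi ∨ y = hi) (x := lo) (y := lo) (x' := lo)
      (y' := lo + 1) ⟨fun x y k1 k2 => ?_, fun x y k1 k2 => ?_⟩
      (by unfold InSq; omega) (by unfold InSq; omega) (by omega) (by omega)).elim
    · have m1 := h.inSq_of_hor k1
      have m2 := h.inSq_of_hor k2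
      unfold InSq at m1 m2
      have e : x + 1 = hi → ¬(lo < y ∧ y < hi) := by
        rintro rfl ⟨n1, n2⟩
        exact rign y n1 n2 ⟨by rwa [add_sub_cancel_right], k2⟩
      omega
    · have m1 := h.inSq_of_ver k1
      have m2 := h.inSq_of_ver k2
      unfold InSq at m1 m2
      have e : y = lo → x = hi := by
        rintro rfl
        by_contra n
        exact botn x (by omega) (by omega) ⟨k1, k2⟩
      have e' : y + 1 = hi → x = hi := by
        rintro rfl
        by_contra n
        rcases eq_or_ne x lo with rfl | n1
        · rw [hd] at k2; exact absurd k2 (by decide)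
        exact topn x (by omega) (by omega) ⟨by rwa [add_sub_cancel_right], k2⟩
      omega
  · have lef : ∀ y, lo + 2 ≤ y → y ≤ hi → (t lo y).ver := by
      intro y h1 h2
      by_contra k
      have k' : ¬(t lo (lo + 1)).ver := fun k' =>
        k (h.ver_between k' (by rw [hd]; rfl) (by omega) h2)
      have := E1 lo y lo (lo + 1) (by unfold InSq; omega) (by unfold InSq; omega)
        (h.deg_left k) (h.deg_left k')
      omega
    -- All other corners are now turns. What remains is whether the left side extends down to the
    -- block above the starting corner; if not, that block is the second end and the type is II.
    by_cases k : (t lo (lo + 1)).ver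
    · have lef' : ∀ y, lo + 1 ≤ y → y ≤ hi → (t lo y).ver := fun y h1 h2 => by
        rcases eq_or_ne y (lo + 1) with rfl | n
        · exact k
        · exact lef y (by omega) h2
      have g : (t lo (lo + 1)).hor ∧ (t (lo + 1) (lo + 1)).hor := by
        by_contra g
        refine h.not_closed (A := fun x y => x = lo ∨ x = hi ∨ y = lo ∨ y = hi) (x := lo)
          (y := lo) (x' := lo + 1) (y' := lo + 1) ⟨fun x y k1 k2 => ?_, fun x y k1 k2 => ?_⟩
          (by unfold InSq; omega) (by unfold InSq; omega) (by omega) (by omega)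
        · have m1 := h.inSq_of_hor k1
          have m2 := h.inSq_of_hor k2
          unfold InSq at m1 m2
          have e : x + 1 = hi → ¬(lo < y ∧ y < hi) := by
            rintro rfl ⟨n1, n2⟩
            exact rign y n1 n2 ⟨by rwa [add_sub_cancel_right], k2⟩
          have e' : x = lo → ¬(lo < y ∧ y < hi) := by
            rintro rfl ⟨n1, n2⟩
            rcases eq_or_ne y (x + 1) with rfl | n
            · exact g ⟨k1, k2⟩
            exact (h.loc.not_hor_of_ver (lef' y (by omega) (by omega))
              (lef' _ (by omega) (by omega)) (lef' _ (by omega) (by omega)) k1).2 k2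
          omega
        · have m1 := h.inSq_of_ver k1
          have m2 := h.inSq_of_ver k2
          unfold InSq at m1 m2
          have e : y = lo → x = hi := by
            rintro rfl
            by_contra n
            exact botn x (by omega) (by omega) ⟨k1, k2⟩
          have e' : y + 1 = hi → x = hi ∨ x = lo := by
            rintro rfl
            by_contra! n
            exact topn x (by omega) (by omega) ⟨by rwa [add_sub_cancel_right], k2⟩
          omega
      exact ⟨.I, hlo, fun x h1 h2 _ => bot x h1 h2, fun y h1 h2 _ => rig y h1 h2,
        fun x h1 h2 _ => top x h1 h2, fun y h1 h2 _ => lef' y h1 h2, ha,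
        by simpa using hb, by simpa using hc, by simpa using hd, g.2,
        by simpa using entryZ k (lef _ (by omega) (by omega)) g.1 g.2,
        by simp, by simp, by simp, by simp⟩
    · have hB : t lo (lo + 1) = B := by
        have := h.loc.ver_down (lef (lo + 2) (by omega) (by omega))
          (n0 _ _ (by unfold InSq; omega))
        rw [show lo + 2 - 1 = lo + 1 by ring] at this
        exact this.resolve_left k
      have dB := h.deg_left k
      have g : (t (lo + 1) (lo + 1)).hor := by
        by_contra g
        refine h.not_closed (A := fun x y => x = lo ∧ y = lo + 1) (x := lo)
          (y := lo + 1) (x' := lo) (y' := lo) ⟨fun x y k1 k2 => ?_, fun x y k1 k2 => ?_⟩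
          (by unfold InSq; omega) (by unfold InSq; omega) (by omega) (by omega)
        · have m1 := h.inSq_of_hor k1
          unfold InSq at m1
          have e : ¬(x = lo ∧ y = lo + 1) := by rintro ⟨rfl, rfl⟩; exact g k2
          omega
        · have e : ¬(x = lo ∧ y = lo + 1) := by rintro ⟨rfl, rfl⟩; exact k k1
          have e' : ¬(x = lo ∧ y + 1 = lo + 1) := by rintro ⟨rfl, e'⟩; rw [e'] at k2; exact k k2
          omega
      have dn : ¬((t lo (lo + 2)).ver ∧ (t lo (lo + 2 - 1)).ver) := fun k' => k (by
        rw [show lo + 2 - 1 = lo + 1 by ring] at k'; exact k'.2)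
      -- In a square of side three, the upper left corner has no join downwards and would be a third
      -- end.
      have hs : lo + 3 ≤ hi := by
        by_contra hs
        obtain rfl : hi = lo + 2 := by omega
        have := E1 lo (lo + 1) lo (lo + 2) (by unfold InSq; omega) (by unfold InSq; omega) dB
          (deg_le_one_of_not_left_down_up (fun k => nl _ k.2) dn (fun k => nu _ k.2))
        omega
      have f : (t lo (lo + 2)).hor ∧ (t (lo + 1) (lo + 2)).hor := by
        by_contra k
        have := E1 lo (lo + 1) lo (lo + 2) (by unfold InSq; omega) (by unfold InSq; omega) dB
          (deg_le_one_of_not_left_right_down (fun k => nl _ k.2) k dn)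
        omega
      exact ⟨.II, hlo, fun x h1 h2 _ => bot x h1 h2, fun y h1 h2 _ => rig y h1 h2,
        fun x h1 h2 _ => top x h1 h2, fun y h1 h2 h3 => lef y (h3 rfl) h2, ha,
        by simpa using hb, by simpa using hc, by simpa using hd, g, by simpa using hB,
        fun _ => ⟨hs, h.loc.eq_Z_of_right_up f.1 (lef _ (by omega) (by omega)) f.2
          (lef _ (by omega) (by omega)), f.2⟩, by simp, by simp, by simp⟩

end IsValid

end KingSnake

/-! ### Removing the outermost frame -/

namespace KingSnake

open Ty

/-- The part of `t` without the outermost frame of `[lo, hi]²`. -/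
def inner (lo hi : ℤ) (t : ℤ → ℤ → Ty) : ℤ → ℤ → Ty := fun x y =>
  if InSq (lo + 1) (hi - 1) x y then t x y else E

theorem inner_of_mem {lo hi : ℤ} {t : ℤ → ℤ → Ty} {x y : ℤ} (h : InSq (lo + 1) (hi - 1) x y) :
    inner lo hi t x y = t x y := if_pos h

theorem inner_rotate (lo hi : ℤ) (t : ℤ → ℤ → Ty) :
    inner lo hi (rotate (lo + hi) t) = rotate (lo + hi) (inner lo hi t) := by
  funext x y
  have : InSq (lo + 1) (hi - 1) x y ↔ InSq (lo + 1) (hi - 1) y (lo + hi - x) := by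
    unfold InSq; omega
  by_cases h : InSq (lo + 1) (hi - 1) x y
  · simp only [inner, rotate, if_pos h, if_pos (this.1 h)]
  · simp only [inner, rotate, if_neg h, if_neg (mt this.2 h)]; rfl

theorem inner_reflect (lo hi : ℤ) (t : ℤ → ℤ → Ty) :
    inner lo hi (reflect t) = reflect (inner lo hi t) := by
  funext x y
  have : InSq (lo + 1) (hi - 1) x y ↔ InSq (lo + 1) (hi - 1) y x := by
    unfold InSq; omega
  by_cases h : InSq (lo + 1) (hi - 1) x y
  · simp only [inner, reflect, if_pos h, if_pos (this.1 h)]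
  · simp only [inner, reflect, if_neg h, if_neg (mt this.2 h)]; rfl

/-- Emptying blocks cannot violate a local condition: `E` is compatible with every type, and
`turnOK` is monotone in the neighbours. -/
theorem IsLocal.inner {t : ℤ → ℤ → Ty} (h : IsLocal t) (lo hi : ℤ) : IsLocal (inner lo hi t) where
  h x y := by
    have := h.h x y
    unfold KingSnake.inner
    split_ifs
    · exact this
    all_goals generalize t x y = a, t (x + 1) y = b; revert a b; decide
  v x y := by
    have := h.v x y
    unfold KingSnake.inner
    split_ifs
    · exact this
    all_goals generalize t x y = a, t x (y + 1) = b; revert a b; decide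
  d x y := by
    have := h.d x y
    unfold KingSnake.inner
    split_ifs
    · exact this
    all_goals generalize t x y = a, t (x + 1) (y + 1) = b; revert a b; decide
  e x y := by
    have := h.e x y
    unfold KingSnake.inner
    split_ifs
    · exact this
    all_goals generalize t x (y + 1) = a, t (x + 1) y = b; revert a b; decide
  turn x y := by
    have := h.turn x y
    have mono : ∀ (c : Ty) (l r d u l' r' d' u' : Bool), turnOK c l r d u → (l' → l) → (r' → r) →
        (d' → d) →
      (u' → u) → turnOK c l' r' d' u' := by decide
    have hh : ∀ a b, (KingSnake.inner lo hi t a b).hor → (t a b).hor := by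
      intro a b; unfold KingSnake.inner; split_ifs
      · exact id
      · intro h; simp [hor] at h
    have hv : ∀ a b, (KingSnake.inner lo hi t a b).ver → (t a b).ver := by
      intro a b; unfold KingSnake.inner; split_ifs
      · exact id
      · intro h; simp [ver] at h
    by_cases hm : InSq (lo + 1) (hi - 1) x y
    · rw [inner_of_mem hm]
      exact mono _ _ _ _ _ _ _ _ _ this (hh _ _) (hh _ _) (hv _ _) (hv _ _)
    · rw [show KingSnake.inner lo hi t x y = E from if_neg hm]; rfl

theorem IsValid.inner_supp {lo hi : ℤ} {t : ℤ → ℤ → Ty} (h : IsValid lo hi t) (x y : ℤ) :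
    inner lo hi t x y ≠ E ↔ InSq (lo + 1) (hi - 1) x y := by
  have := h.supp x y
  unfold inner
  split_ifs with hm
  · simp only [hm, iff_true]; exact this.2 (by unfold InSq at *; omega)
  · simp [hm]

/-- If the outermost frame consists of two parts which are not joined to each other, each of them
being joined to at most one inner block, then the inner blocks form a path. -/
theorem IsValid.inner_of_cut {lo hi : ℤ} {t : ℤ → ℤ → Ty} (h : IsValid lo hi t)
    {P : ℤ → ℤ → Prop} {u₁ v₁ u₂ v₂ : ℤ}
    (hh : ∀ x y, InSq lo hi x y → InSq lo hi (x + 1) y → (t x y).hor → (t (x + 1) y).hor →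
      (InSq (lo + 1) (hi - 1) x y → InSq (lo + 1) (hi - 1) (x + 1) y ∨
        (P (x + 1) y ∧ x = u₁ ∧ y = v₁) ∨ (¬P (x + 1) y ∧ x = u₂ ∧ y = v₂)) ∧
      (InSq (lo + 1) (hi - 1) (x + 1) y → InSq (lo + 1) (hi - 1) x y ∨
        (P x y ∧ x + 1 = u₁ ∧ y = v₁) ∨ (¬P x y ∧ x + 1 = u₂ ∧ y = v₂)) ∧
      (¬InSq (lo + 1) (hi - 1) x y → ¬InSq (lo + 1) (hi - 1) (x + 1) y → (P x y ↔ P (x + 1) y)))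
    (hv : ∀ x y, InSq lo hi x y → InSq lo hi x (y + 1) → (t x y).ver → (t x (y + 1)).ver →
      (InSq (lo + 1) (hi - 1) x y → InSq (lo + 1) (hi - 1) x (y + 1) ∨
        (P x (y + 1) ∧ x = u₁ ∧ y = v₁) ∨ (¬P x (y + 1) ∧ x = u₂ ∧ y = v₂)) ∧
      (InSq (lo + 1) (hi - 1) x (y + 1) → InSq (lo + 1) (hi - 1) x y ∨
        (P x y ∧ x = u₁ ∧ y + 1 = v₁) ∨ (¬P x y ∧ x = u₂ ∧ y + 1 = v₂)) ∧
      (¬InSq (lo + 1) (hi - 1) x y → ¬InSq (lo + 1) (hi - 1) x (y + 1) →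
        (P x y ↔ P x (y + 1)))) :
    IsValid (lo + 1) (hi - 1) (inner lo hi t) where
  supp := h.inner_supp
  loc := h.loc.inner lo hi
  conn A hA x y x' y' m m' hx := by
    classical
    rw [h.inner_supp] at m m'
    -- A closed predicate on the inner blocks is extended to each part of the frame by its value at
    -- the inner block to which that part is attached.
    let A' : ℤ → ℤ → Prop := fun x y =>
      if InSq (lo + 1) (hi - 1) x y then A x y else if P x y then A u₁ v₁ else A u₂ v₂
    have e1 : ∀ {x y}, InSq (lo + 1) (hi - 1) x y → (A' x y ↔ A x y) := fun h => by
      simp only [A', if_pos h]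
    have e2 : ∀ {x y}, ¬InSq (lo + 1) (hi - 1) x y → P x y → (A' x y ↔ A u₁ v₁) := fun h h' => by
      simp only [A', if_neg h, if_pos h']
    have e3 : ∀ {x y}, ¬InSq (lo + 1) (hi - 1) x y → ¬P x y → (A' x y ↔ A u₂ v₂) := fun h h' => by
      simp only [A', if_neg h, if_neg h']
    have sub : ∀ {x y}, InSq (lo + 1) (hi - 1) x y → t x y ≠ E := fun k =>
      (h.supp _ _).2 (by unfold InSq at *; omega)
    rw [← e1 m']
    refine h.conn A' ⟨fun x y k1 k2 => ?_, fun x y k1 k2 => ?_⟩ x y x' y' (sub m) (sub m')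
      ((e1 m).2 hx)
    · obtain ⟨c1, c2, c3⟩ := hh x y (h.inSq_of_hor k1) (h.inSq_of_hor k2) k1 k2
      by_cases i1 : InSq (lo + 1) (hi - 1) x y <;> by_cases i2 : InSq (lo + 1) (hi - 1) (x + 1) y
      · rw [e1 i1, e1 i2]
        exact hA.1 x y (by rwa [inner_of_mem i1]) (by rwa [inner_of_mem i2])
      · rcases (c1 i1).resolve_left i2 with ⟨p, rfl, rfl⟩ | ⟨p, rfl, rfl⟩
        · rw [e1 i1, e2 i2 p]
        · rw [e1 i1, e3 i2 p]
      · rcases (c2 i2).resolve_left i1 with ⟨p, rfl, rfl⟩ | ⟨p, rfl, rfl⟩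
        · rw [e1 i2, e2 i1 p]
        · rw [e1 i2, e3 i1 p]
      · by_cases p : P x y
        · rw [e2 i1 p, e2 i2 ((c3 i1 i2).1 p)]
        · rw [e3 i1 p, e3 i2 (mt (c3 i1 i2).2 p)]
    · obtain ⟨c1, c2, c3⟩ := hv x y (h.inSq_of_ver k1) (h.inSq_of_ver k2) k1 k2
      by_cases i1 : InSq (lo + 1) (hi - 1) x y <;> by_cases i2 : InSq (lo + 1) (hi - 1) x (y + 1)
      · rw [e1 i1, e1 i2]
        exact hA.2 x y (by rwa [inner_of_mem i1]) (by rwa [inner_of_mem i2])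
      · rcases (c1 i1).resolve_left i2 with ⟨p, rfl, rfl⟩ | ⟨p, rfl, rfl⟩
        · rw [e1 i1, e2 i2 p]
        · rw [e1 i1, e3 i2 p]
      · rcases (c2 i2).resolve_left i1 with ⟨p, rfl, rfl⟩ | ⟨p, rfl, rfl⟩
        · rw [e1 i2, e2 i1 p]
        · rw [e1 i2, e3 i1 p]
      · by_cases p : P x y
        · rw [e2 i1 p, e2 i2 ((c3 i1 i2).1 p)]
        · rw [e3 i1 p, e3 i2 (mt (c3 i1 i2).2 p)]

namespace Frame

variable {T : FrameType} {lo hi : ℤ} {t : ℤ → ℤ → Ty} (f : Frame T lo hi t) (h : IsLocal t)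
include f h

/-- A block joined to both neighbours along the side cannot be joined inwards. The only exception
occurs beside the second end, where the side breaks off; the same holds for the other sides. -/
theorem join_bottom {x : ℤ} (h1 : lo ≤ x) (h2 : x < hi) (k1 : (t x lo).ver)
    (k2 : (t x (lo + 1)).ver) : T = .V ∧ x = hi - 1 := by
  by_contra k
  have n : x ≠ lo := by rintro rfl; rw [f.a] at k1; exact absurd k1 (by decide)
  exact (h.not_ver_of_hor (f.bottom x h1 h2.le (by omega))
    (f.bottom _ (by omega) (by omega) (by omega))
    (f.bottom _ (by omega) (by omega) fun e => by
      have : x ≠ hi - 1 := fun e' => k ⟨e, e'⟩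
      omega) k1).2 k2

theorem join_right {y : ℤ} (h1 : lo < y) (h2 : y < hi) (k1 : (t (hi - 1) y).hor)
    (k2 : (t hi y).hor) : T = .IV ∧ y = hi - 1 := by
  by_contra k
  exact (h.not_hor_of_ver (f.right y (by omega) (by omega) (by omega))
    (f.right _ (by omega) (by omega) (by omega))
    (f.right _ (by omega) (by omega) fun e => by
      have : y ≠ hi - 1 := fun e' => k ⟨e, e'⟩
      omega) k2).1 k1

theorem join_top {x : ℤ} (h1 : lo < x) (h2 : x < hi) (k1 : (t x (hi - 1)).ver)
    (k2 : (t x hi).ver) : T = .III ∧ x = lo + 1 := by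
  by_contra k
  exact (h.not_ver_of_hor (f.top x (by omega) (by omega) (by omega))
    (f.top _ (by omega) (by omega) fun e => by
      have : x ≠ lo + 1 := fun e' => k ⟨e, e'⟩
      omega)
    (f.top _ (by omega) (by omega) (by omega)) k2).1 k1

theorem join_left {y : ℤ} (h1 : lo < y) (h2 : y < hi) (k1 : (t lo y).hor)
    (k2 : (t (lo + 1) y).hor) : y = lo + 1 ∨ (T = .II ∧ y = lo + 2) := by
  by_contra! k
  exact (h.not_hor_of_ver (f.left y (by omega) (by omega) (by omega))
    (f.left _ (by omega) (by omega) fun e => by have := k.2 e; omega)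
    (f.left _ (by omega) (by omega) (by omega)) k1).2 k2

end Frame

/-- The part `P` of the frame hangs on the inner block `(lo + 1, lo + 1)`. The rest, which contains
the starting corner, hangs on the inner block at the second attachment. For type I the whole frame
belongs to `P`, and the values of `u₂`, `v₂` do not matter. -/
theorem IsValid.inner_of_frame {T : FrameType} {lo hi : ℤ} {t : ℤ → ℤ → Ty} (h : IsValid lo hi t)
    (f : Frame T lo hi t) : IsValid (lo + 1) (hi - 1) (inner lo hi t) := by
  have hs := f.size
  refine h.inner_of_cut (P := fun x y => match T with
      | .I => True
      | .II => x = lo ∧ y = lo + 1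
      | .III => x = lo ∧ lo + 1 ≤ y
      | .IV => (x = lo ∧ lo + 1 ≤ y) ∨ y = hi
      | .V => x = hi ∨ y = hi ∨ (x = lo ∧ lo + 1 ≤ y)) (u₁ := lo + 1) (v₁ := lo + 1)
    (u₂ := match T with
      | .I | .II | .III => lo + 1
      | .IV | .V => hi - 1)
    (v₂ := match T with
      | .I | .V => lo + 1
      | .II => lo + 2
      | .III | .IV => hi - 1)
    (fun x y m1 m2 k1 k2 => ?_) (fun x y m1 m2 k1 k2 => ?_)
  · have c1 : x = lo → lo < y → y < hi → y = lo + 1 ∨ (T = .II ∧ y = lo + 2) := by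
      rintro rfl h1 h2; exact f.join_left h.loc h1 h2 k1 k2
    have c2 : x + 1 = hi → lo < y → y < hi → T = .IV ∧ y = hi - 1 := by
      rintro rfl h1 h2; exact f.join_right h.loc h1 h2 (by rwa [add_sub_cancel_right]) k2
    have c3 : x = lo → y = hi → T ≠ .III := by
      rintro rfl rfl e; rw [f.d, if_pos e] at k1; exact absurd k1 (by decide)
    have c4 : x + 1 = hi → y = lo → T ≠ .V := by
      rintro rfl rfl e; rw [f.b, if_pos e] at k2; exact absurd k2 (by decide)
    unfold InSq at *
    cases T <;> simp only
        [reduceCtorEq, false_and, true_and, and_true, or_false, ne_eq, not_true_eq_false,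
      not_false_eq_true, implies_true, imp_false] at c1 c2 c3 c4 ⊢ <;> omega
  · have c1 : y = lo → x < hi → T = .V ∧ x = hi - 1 := by
      rintro rfl h1; exact f.join_bottom h.loc m1.1.1 h1 k1 k2
    have c2 : y + 1 = hi → lo < x → x < hi → T = .III ∧ x = lo + 1 := by
      rintro rfl h1 h2; exact f.join_top h.loc h1 h2 (by rwa [add_sub_cancel_right]) k2
    have c3 : x = lo → y ≠ lo := by
      rintro rfl rfl; rw [f.a] at k1; exact absurd k1 (by decide)
    have c4 : x = lo → y = lo + 1 → T ≠ .II := by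
      rintro rfl rfl e; rw [f.second, if_pos e] at k1; exact absurd k1 (by decide)
    have c5 : x = hi → y + 1 = hi → T ≠ .IV := by
      rintro rfl rfl e; rw [f.c, if_pos e] at k2; exact absurd k2 (by decide)
    unfold InSq at *
    cases T <;> simp only
        [reduceCtorEq, false_and, true_and, and_true, or_false, ne_eq, not_true_eq_false,
      not_false_eq_true, implies_true, imp_false] at c1 c2 c3 c4 c5 ⊢ <;> omega

end KingSnake

/-! ### Normalisation by symmetries, and the type of the next frame -/

namespace KingSnake

open Ty

theorem isValid_rotate_iff {lo hi : ℤ} {t : ℤ → ℤ → Ty} :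
    IsValid lo hi (rotate (lo + hi) t) ↔ IsValid lo hi t :=
  ⟨fun h => by
    have := h.rotate.rotate.rotate
    rwa [rotate_rotate_rotate_rotate] at this, fun h => h.rotate⟩

theorem isValid_reflect_iff {lo hi : ℤ} {t : ℤ → ℤ → Ty} :
    IsValid lo hi (reflect t) ↔ IsValid lo hi t :=
  ⟨fun h => by
    have := h.reflect
    rwa [reflect_reflect] at this, fun h => h.reflect⟩

/-- The symmetries of a square. -/
def sym (s : ℤ) (g : Fin 4 × Fin 2) (t : ℤ → ℤ → Ty) : ℤ → ℤ → Ty :=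
  (rotate s)^[g.1] (reflect^[g.2] t)

theorem isValid_sym_iff {lo hi : ℤ} {t : ℤ → ℤ → Ty} (g : Fin 4 × Fin 2) :
    IsValid lo hi (sym (lo + hi) g t) ↔ IsValid lo hi t := by
  have h1 : ∀ (i : ℕ) (t : ℤ → ℤ → Ty), IsValid lo hi ((rotate (lo + hi))^[i] t) ↔
      IsValid lo hi t := by
    intro i
    induction i with
    | zero => simp
    | succ i ih => intro t; rw [Function.iterate_succ_apply, ih, isValid_rotate_iff]
  have h2 : ∀ (i : ℕ) (t : ℤ → ℤ → Ty), IsValid lo hi (reflect^[i] t) ↔ IsValid lo hi t := by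
    intro i
    induction i with
    | zero => simp
    | succ i ih => intro t; rw [Function.iterate_succ_apply, ih, isValid_reflect_iff]
  rw [sym, h1, h2]

theorem inner_sym (lo hi : ℤ) (t : ℤ → ℤ → Ty) (g : Fin 4 × Fin 2) :
    inner lo hi (sym (lo + hi) g t) = sym (lo + hi) g (inner lo hi t) := by
  have h1 : ∀ (i : ℕ) (t : ℤ → ℤ → Ty), inner lo hi ((rotate (lo + hi))^[i] t) =
      (rotate (lo + hi))^[i] (inner lo hi t) := by
    intro i
    induction i with
    | zero => simp
    | succ i ih => intro t; rw [Function.iterate_succ_apply, ih, inner_rotate]; rfl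
  have h2 : ∀ (i : ℕ) (t : ℤ → ℤ → Ty), inner lo hi (reflect^[i] t) =
      reflect^[i] (inner lo hi t) := by
    intro i
    induction i with
    | zero => simp
    | succ i ih => intro t; rw [Function.iterate_succ_apply, ih, inner_reflect]; rfl
  rw [sym, h1, h2]; rfl

/-- Whether the symmetry `g` takes `t` to a path with an end in the lower left corner that starts
along the bottom side. -/
theorem sym_corner (lo hi : ℤ) (t : ℤ → ℤ → Ty) (g : Fin 4 × Fin 2) :
    sym (lo + hi) g t lo lo = B ↔
      match g with
      | (0, 0) => t lo lo = B
      | (0, 1) => t lo lo = L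
      | (1, 0) => t lo hi = L
      | (1, 1) => t hi lo = B
      | (2, 0) => t hi hi = Ty.T
      | (2, 1) => t hi hi = R
      | (3, 0) => t hi lo = R
      | (3, 1) => t lo hi = Ty.T := by
  have e1 : ∀ a : Ty, a.swap = B ↔ a = L := by decide
  have e2 : ∀ a : Ty, a.swap = L ↔ a = B := by decide
  have e3 : ∀ a : Ty, a.swap = Ty.T ↔ a = R := by decide
  have e4 : ∀ a : Ty, a.swap = R ↔ a = Ty.T := by decide
  have e5 : ∀ a : Ty, a.rot = B ↔ a = L := by decide
  have e6 : ∀ a : Ty, a.rot = L ↔ a = Ty.T := by decide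
  have e7 : ∀ a : Ty, a.rot = Ty.T ↔ a = R := by decide
  obtain ⟨i, j⟩ := g
  fin_cases i <;> fin_cases j <;>
    simp [sym, rotate, reflect, Function.iterate_succ_apply, e1, e2, e3, e4, e5, e6, e7]

namespace IsValid

variable {lo hi : ℤ} {t : ℤ → ℤ → Ty} (h : IsValid lo hi t)
include h

theorem exists_sym (hlo : lo + 2 ≤ hi) : ∃ g, sym (lo + hi) g t lo lo = B := by
  rcases h.exists_corner hlo with (k | k) | (k | k) | (k | k) | (k | k)
  · exact ⟨(0, 0), (sym_corner ..).2 k⟩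
  · exact ⟨(0, 1), (sym_corner ..).2 k⟩
  · exact ⟨(3, 0), (sym_corner ..).2 k⟩
  · exact ⟨(1, 1), (sym_corner ..).2 k⟩
  · exact ⟨(2, 0), (sym_corner ..).2 k⟩
  · exact ⟨(2, 1), (sym_corner ..).2 k⟩
  · exact ⟨(1, 0), (sym_corner ..).2 k⟩
  · exact ⟨(3, 1), (sym_corner ..).2 k⟩

/-- Without its outermost frame, the path remains a path. -/
theorem inner (hlo : lo + 2 ≤ hi) : IsValid (lo + 1) (hi - 1) (inner lo hi t) := by
  obtain ⟨g, hg⟩ := h.exists_sym hlo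
  have h' := (isValid_sym_iff g).2 h
  obtain ⟨T, f⟩ := h'.exists_frame hlo hg
  have := h'.inner_of_frame f
  rw [inner_sym, show lo + hi = (lo + 1) + (hi - 1) by ring] at this
  exact (isValid_sym_iff g).1 this

end IsValid

namespace Frame

variable {T : FrameType} {lo hi : ℤ} {t : ℤ → ℤ → Ty} (f : Frame T lo hi t) (h : IsValid lo hi t)
include f h

/-- By `entry` this block is joined to the frame on its left. That excludes `L`, which is not `hor`,
and also the turn `Z`, which cannot be joined both to the left and upwards. -/
theorem inner_corner (hlo : lo + 4 ≤ hi) : t (lo + 1) (lo + 1) = B := by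
  have hi' := h.inner (by omega)
  have m : ∀ x y, InSq (lo + 1) (hi - 1) x y → KingSnake.inner lo hi t x y = t x y :=
    fun x y => inner_of_mem
  have e := f.entry
  rcases hi'.corner (by omega) with k | k | ⟨k, -, k2⟩
  · rwa [m _ _ (by unfold InSq; omega)] at k
  · rw [m _ _ (by unfold InSq; omega)] at k
    rw [k] at e; exact absurd e (by decide)
  · rw [m _ _ (by unfold InSq; omega)] at k k2
    have e' : (t lo (lo + 1)).hor := by rw [f.second]; split_ifs <;> rfl
    have := h.loc.eq_S_of_left_up e (by rw [k]; rfl) (by rwa [add_sub_cancel_right]) k2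
    simp [k] at this

/-- The second attachment of a frame of type `T` lies exactly where an inner frame of type `T` has
its second end. Under any other inner type this block is a turn, and the attachment would be an
impossible third join. -/
theorem inner_frame (hlo : lo + 4 ≤ hi) (hT : T ≠ .I) :
    Frame T (lo + 1) (hi - 1) (KingSnake.inner lo hi t) := by
  have hi' := h.inner (by omega)
  have m : ∀ x y, InSq (lo + 1) (hi - 1) x y → KingSnake.inner lo hi t x y = t x y :=
    fun x y => inner_of_mem
  obtain ⟨T', f'⟩ := hi'.exists_frame (by omega)
    (by rw [m _ _ (by unfold InSq; omega)]; exact f.inner_corner h hlo)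
  suffices T' = T by rwa [this] at f'
  by_contra hne
  cases T with
  | I => exact hT rfl
  | II =>
    obtain ⟨e1, e2, e3⟩ := f.two rfl
    have k := f'.second
    rw [if_neg hne, m _ _ (by unfold InSq; omega)] at k
    have k2 := f'.left (lo + 3) (by omega) (by omega) (by omega)
    rw [m _ _ (by unfold InSq; omega)] at k2
    have := h.loc.eq_S_of_left_up (x := lo + 1) (y := lo + 1 + 1) (by rw [k]; rfl) (by rw [k]; rfl)
      (by rw [add_sub_cancel_right, show lo + 1 + 1 = lo + 2 by ring, e2]; rfl)
      (by rwa [show lo + 1 + 1 + 1 = lo + 3 by ring])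
    simp [k] at this
  | III =>
    obtain ⟨e1, e2⟩ := f.three rfl
    have k := f'.d
    rw [if_neg hne, m _ _ (by unfold InSq; omega)] at k
    have k2 := f'.top (lo + 1 + 1) (by omega) (by omega) (by omega)
    rw [m _ _ (by unfold InSq; omega)] at k2
    have := h.loc.eq_Z_of_right_up (x := lo + 1) (y := hi - 1) (by rw [k]; rfl) (by rw [k]; rfl)
      k2 (by rw [sub_add_cancel, e1]; rfl)
    simp [k] at this
  | IV =>
    obtain ⟨e1, e2⟩ := f.four rfl
    have k := f'.c
    rw [if_neg hne, m _ _ (by unfold InSq; omega)] at k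
    have k2 := f'.right (hi - 1 - 1) (by omega) (by omega) (by omega)
    rw [m _ _ (by unfold InSq; omega)] at k2
    have := h.loc.eq_S_of_right_down (x := hi - 1) (y := hi - 1) (by rw [k]; rfl) (by rw [k]; rfl)
      (by rw [sub_add_cancel, e1]; rfl) k2
    simp [k] at this
  | V =>
    obtain ⟨e1, e2⟩ := f.five rfl
    have k := f'.b
    rw [if_neg hne, m _ _ (by unfold InSq; omega)] at k
    have k2 := f'.bottom (hi - 1 - 1) (by omega) (by omega) (by omega)
    rw [m _ _ (by unfold InSq; omega)] at k2
    have := h.loc.eq_Z_of_left_down (x := hi - 1) (y := lo + 1) (by rw [k]; rfl) (by rw [k]; rfl)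
      k2 (by rw [add_sub_cancel_right, e1]; rfl)
    simp [k] at this

end Frame

end KingSnake

/-! ### Regularity of the whole spiral -/

namespace KingSnake

open Ty

theorem Frame.congr {T : FrameType} {lo hi : ℤ} {t t' : ℤ → ℤ → Ty} (f : Frame T lo hi t)
    (ht : ∀ x y, InSq lo hi x y → t x y = t' x y) : Frame T lo hi t' := by
  have hs := f.size
  have e : ∀ x y, lo ≤ x → x ≤ hi → lo ≤ y → y ≤ hi → t' x y = t x y := fun x y h1 h2 h3 h4 =>
    (ht x y ⟨⟨h1, h2⟩, h3, h4⟩).symm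
  refine ⟨hs, fun x h1 h2 h3 => ?_, fun x h1 h2 h3 => ?_, fun x h1 h2 h3 => ?_,
    fun x h1 h2 h3 => ?_, ?_, ?_, ?_, ?_, ?_, ?_, fun h => ?_, fun h => ?_, fun h => ?_, fun h => ?_⟩
  · rw [e _ _ (by omega) (by omega) (by omega) (by omega)]; exact f.bottom x h1 h2 h3
  · rw [e _ _ (by omega) (by omega) (by omega) (by omega)]; exact f.right x h1 h2 h3
  · rw [e _ _ (by omega) (by omega) (by omega) (by omega)]; exact f.top x h1 h2 h3
  · rw [e _ _ (by omega) (by omega) (by omega) (by omega)]; exact f.left x h1 h2 h3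
  · rw [e _ _ (by omega) (by omega) (by omega) (by omega)]; exact f.a
  · rw [e _ _ (by omega) (by omega) (by omega) (by omega)]; exact f.b
  · rw [e _ _ (by omega) (by omega) (by omega) (by omega)]; exact f.c
  · rw [e _ _ (by omega) (by omega) (by omega) (by omega)]; exact f.d
  · rw [e _ _ (by omega) (by omega) (by omega) (by omega)]; exact f.entry
  · rw [e _ _ (by omega) (by omega) (by omega) (by omega)]; exact f.second
  · have := f.two h
    rw [e _ _ (by omega) (by omega) (by omega) (by omega),
      e _ _ (by omega) (by omega) (by omega) (by omega)]
    exact this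
  · have := f.three h
    rw [e _ _ (by omega) (by omega) (by omega) (by omega),
      e _ _ (by omega) (by omega) (by omega) (by omega)]
    exact this
  · have := f.four h
    rw [e _ _ (by omega) (by omega) (by omega) (by omega),
      e _ _ (by omega) (by omega) (by omega) (by omega)]
    exact this
  · have := f.five h
    rw [e _ _ (by omega) (by omega) (by omega) (by omega),
      e _ _ (by omega) (by omega) (by omega) (by omega)]
    exact this

theorem Frame.of_inner {T : FrameType} {lo hi : ℤ} {t : ℤ → ℤ → Ty} {j : ℕ}
    (f : Frame T (lo + 1 + j) (hi - 1 - j) (inner lo hi t)) :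
    Frame T (lo + (j + 1 : ℕ)) (hi - (j + 1 : ℕ)) t := by
  have := f.congr (t' := t) fun x y m => inner_of_mem (by unfold InSq at *; omega)
  push_cast
  rwa [show lo + ((j : ℤ) + 1) = lo + 1 + j by ring, show hi - ((j : ℤ) + 1) = hi - 1 - j by ring]

/-- If the outermost frame is not of type I, then all frames are of the same type. -/
theorem Frame.all {T : FrameType} {lo hi : ℤ} {t : ℤ → ℤ → Ty} (f : Frame T lo hi t)
    (h : IsValid lo hi t) (hT : T ≠ .I) (j : ℕ) (hj : lo + j + 2 ≤ hi - j) :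
    Frame T (lo + j) (hi - j) t := by
  induction j generalizing lo hi t with
  | zero => simpa using f
  | succ j ih =>
    push_cast at hj
    exact (ih (f.inner_frame h (by omega) hT) (h.inner (by omega)) (by omega)).of_inner

/-- A frame of type I only passes on the start in the lower left corner, whereas any other type
persists through all further frames. The induction is on the side of the square. -/
theorem IsValid.spiral {lo hi : ℤ} {t : ℤ → ℤ → Ty} (h : IsValid lo hi t) (hlo : lo + 2 ≤ hi)
    (ha : t lo lo = B) :
    (∀ j : ℕ, lo + j + 2 ≤ hi - j → Frame .I (lo + j) (hi - j) t) ∨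
    ∃ (T : FrameType) (s : ℕ), lo + s + 2 ≤ hi - s ∧ T ≠ .I ∧
      (∀ j < s, Frame .I (lo + j) (hi - j) t) ∧
      ∀ j : ℕ, lo + j + 2 ≤ hi - j → s ≤ j → Frame T (lo + j) (hi - j) t := by
  obtain ⟨n, hn⟩ : ∃ n : ℕ, hi - lo ≤ n := ⟨(hi - lo).toNat, by omega⟩
  induction n generalizing lo hi t with
  | zero => omega
  | succ n ih =>
    obtain ⟨T, f⟩ := h.exists_frame hlo ha
    by_cases hT : T = .I
    · subst hT
      have f0 : Frame .I (lo + (0 : ℕ)) (hi - (0 : ℕ)) t := by simpa using f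
      by_cases h4 : lo + 4 ≤ hi
      · rcases ih (h.inner hlo) (by omega)
          ((inner_of_mem (by unfold InSq; omega)).trans (f.inner_corner h h4))
          (by push_cast at hn; omega) with k | ⟨T, s, k1, k2, k3, k4⟩
        · refine Or.inl fun j hj => ?_
          cases j with
          | zero => exact f0
          | succ j => exact (k j (by push_cast at hj; omega)).of_inner
        · refine Or.inr ⟨T, s + 1, by push_cast; omega, k2, fun j hj => ?_, fun j hj hs => ?_⟩
          · cases j with
            | zero => exact f0
            | succ j => exact (k3 j (by omega)).of_inner
          · cases j with
            | zero => omega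
            | succ j => exact (k4 j (by push_cast at hj; omega) (by omega)).of_inner
      · refine Or.inl fun j hj => ?_
        obtain rfl : j = 0 := by omega
        exact f0
    · exact Or.inr ⟨T, 0, by simpa using hlo, hT, by simp, fun j hj _ => f.all h hT j hj⟩

section Segments

variable {k : ℕ} {t : ℤ → ℤ → Ty} {R : SimpleGraph (board k k)}
  (hR : ∀ a b : board k k, Joined t a.1 b.1 → R.Adj a b)
include hR

theorem hasSegment_hor {x₀ x₁ y : ℤ} (hy : 0 ≤ y ∧ y < k)
    (h : ∀ x, min x₀ x₁ ≤ x → x ≤ max x₀ x₁ → 0 ≤ x ∧ x < k ∧ (t x y).hor) :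
    HasSegment R (x₀, y) (x₁, y) := by
  rintro ⟨c₁, c₂⟩ hc ⟨d₁, d₂⟩ hd hcd
  simp only [Set.uIcc, Set.mem_Icc, Prod.le_def, Prod.fst_inf, Prod.fst_sup, Prod.snd_inf,
    Prod.snd_sup, inf_idem, sup_idem] at hc hd
  obtain rfl : c₂ = y := by omega
  obtain rfl : d₂ = c₂ := by omega
  have k1 := h c₁ hc.1.1 hc.2.1
  have k2 := h d₁ hd.1.1 hd.2.1
  refine ⟨⟨⟨k1.1, k1.2.1⟩, hy⟩, ⟨⟨k2.1, k2.2.1⟩, hy⟩, hR _ _ (Or.inl ⟨rfl, ?_, k1.2.2, k2.2.2⟩)⟩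
  simp only [GridAdj, sub_self, abs_zero, add_zero] at hcd
  rcases abs_eq (by norm_num : (0 : ℤ) ≤ 1) |>.1 hcd with e | e <;> dsimp only <;> omega

theorem hasSegment_ver {x y₀ y₁ : ℤ} (hx : 0 ≤ x ∧ x < k)
    (h : ∀ y, min y₀ y₁ ≤ y → y ≤ max y₀ y₁ → 0 ≤ y ∧ y < k ∧ (t x y).ver) :
    HasSegment R (x, y₀) (x, y₁) := by
  rintro ⟨c₁, c₂⟩ hc ⟨d₁, d₂⟩ hd hcd
  simp only [Set.uIcc, Set.mem_Icc, Prod.le_def, Prod.fst_inf, Prod.fst_sup, Prod.snd_inf,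
    Prod.snd_sup, inf_idem, sup_idem] at hc hd
  obtain rfl : c₁ = x := by omega
  obtain rfl : d₁ = c₁ := by omega
  have k1 := h c₂ hc.1.2 hc.2.2
  have k2 := h d₂ hd.1.2 hd.2.2
  refine ⟨⟨hx, k1.1, k1.2.1⟩, ⟨hx, k2.1, k2.2.1⟩, hR _ _ (Or.inr ⟨rfl, ?_, k1.2.2, k2.2.2⟩)⟩
  simp only [GridAdj, sub_self, abs_zero, zero_add] at hcd
  rcases abs_eq (by norm_num : (0 : ℤ) ≤ 1) |>.1 hcd with e | e <;> dsimp only <;> omega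

theorem Frame.frameHasType {T : FrameType} {i : ℕ} (f : Frame T i (k - 1 - i) t) :
    FrameHasType R i T := by
  have hs := f.size
  have bot := f.bottom
  have rig := f.right
  have top := f.top
  have lef := f.left
  have e0 := f.entry
  have e1 := f.second
  have e2 := f.two
  have e3 := f.three
  have e4 := f.four
  have e5 := f.five
  have H : ∀ {x₀ x₁ y : ℤ}, 0 ≤ y → y < k → 0 ≤ x₀ → x₀ < k → 0 ≤ x₁ → x₁ < k →
      (∀ x, min x₀ x₁ ≤ x → x ≤ max x₀ x₁ → (t x y).hor) → HasSegment R (x₀, y) (x₁, y) :=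
    fun h1 h2 h3 h4 h5 h6 h7 => hasSegment_hor hR ⟨h1, h2⟩ fun x m1 m2 =>
      ⟨by omega, by omega, h7 x m1 m2⟩
  have V : ∀ {x y₀ y₁ : ℤ}, 0 ≤ x → x < k → 0 ≤ y₀ → y₀ < k → 0 ≤ y₁ → y₁ < k →
      (∀ y, min y₀ y₁ ≤ y → y ≤ max y₀ y₁ → (t x y).ver) → HasSegment R (x, y₀) (x, y₁) :=
    fun h1 h2 h3 h4 h5 h6 h7 => hasSegment_ver hR ⟨h1, h2⟩ fun x m1 m2 =>
      ⟨by omega, by omega, h7 x m1 m2⟩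
  have H2 : ∀ x₀ x₁ y : ℤ, (t x₀ y).hor → (t x₁ y).hor → (x₁ = x₀ + 1 ∨ x₀ = x₁ + 1) →
      ∀ x, min x₀ x₁ ≤ x → x ≤ max x₀ x₁ → (t x y).hor := by
    intro x₀ x₁ y h1 h2 h3 x h4 h5
    obtain rfl | rfl : x = x₀ ∨ x = x₁ := by omega
    exacts [h1, h2]
  have V2 : ∀ x y₀ y₁ : ℤ, (t x y₀).ver → (t x y₁).ver → (y₁ = y₀ + 1 ∨ y₀ = y₁ + 1) →
      ∀ y, min y₀ y₁ ≤ y → y ≤ max y₀ y₁ → (t x y).ver := by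
    intro x y₀ y₁ h1 h2 h3 y h4 h5
    obtain rfl | rfl : y = y₀ ∨ y = y₁ := by omega
    exacts [h1, h2]
  cases T <;> simp only [reduceCtorEq, false_imp_iff, forall_const, if_false, if_true] at bot rig top lef e1 e2 e3 e4 e5 <;>
    simp only [FrameHasType, HasChain, List.isChain_cons_cons, List.isChain_singleton, and_true]
  · exact ⟨H (by omega) (by omega) (by omega) (by omega) (by omega) (by omega)
        fun x _ _ => bot x (by omega) (by omega),
      V (by omega) (by omega) (by omega) (by omega) (by omega) (by omega)
        fun y _ _ => rig y (by omega) (by omega),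
      H (by omega) (by omega) (by omega) (by omega) (by omega) (by omega)
        fun x _ _ => top x (by omega) (by omega),
      V (by omega) (by omega) (by omega) (by omega) (by omega) (by omega)
        fun y _ _ => lef y (by omega) (by omega),
      H (by omega) (by omega) (by omega) (by omega) (by omega) (by omega)
        (H2 _ _ _ (by rw [e1]; rfl) e0 (by omega))⟩
  · exact ⟨by omega, ⟨H (by omega) (by omega) (by omega) (by omega) (by omega) (by omega)
        fun x _ _ => bot x (by omega) (by omega),
      V (by omega) (by omega) (by omega) (by omega) (by omega) (by omega)
        fun y _ _ => rig y (by omega) (by omega),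
      H (by omega) (by omega) (by omega) (by omega) (by omega) (by omega)
        fun x _ _ => top x (by omega) (by omega),
      V (by omega) (by omega) (by omega) (by omega) (by omega) (by omega)
        fun y _ _ => lef y (by omega) (by omega) (by omega),
      H (by omega) (by omega) (by omega) (by omega) (by omega) (by omega)
        (H2 _ _ _ (by rw [e2.2.1]; rfl) e2.2.2 (by omega))⟩,
      H (by omega) (by omega) (by omega) (by omega) (by omega) (by omega)
        (H2 _ _ _ (by rw [e1]; rfl) e0 (by omega))⟩
  · exact ⟨⟨H (by omega) (by omega) (by omega) (by omega) (by omega) (by omega)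
        fun x _ _ => bot x (by omega) (by omega),
      V (by omega) (by omega) (by omega) (by omega) (by omega) (by omega)
        fun y _ _ => rig y (by omega) (by omega),
      H (by omega) (by omega) (by omega) (by omega) (by omega) (by omega)
        fun x _ _ => top x (by omega) (by omega) (by omega),
      V (by omega) (by omega) (by omega) (by omega) (by omega) (by omega)
        (V2 _ _ _ (by rw [e3.1]; rfl) e3.2 (by omega))⟩,
      V (by omega) (by omega) (by omega) (by omega) (by omega) (by omega)
        fun y _ _ => lef y (by omega) (by omega),
      H (by omega) (by omega) (by omega) (by omega) (by omega) (by omega)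
        (H2 _ _ _ (by rw [e1]; rfl) e0 (by omega))⟩
  · exact ⟨⟨H (by omega) (by omega) (by omega) (by omega) (by omega) (by omega)
        fun x _ _ => bot x (by omega) (by omega),
      V (by omega) (by omega) (by omega) (by omega) (by omega) (by omega)
        fun y _ _ => rig y (by omega) (by omega) (by omega),
      H (by omega) (by omega) (by omega) (by omega) (by omega) (by omega)
        (H2 _ _ _ (by rw [e4.1]; rfl) e4.2 (by omega))⟩,
      H (by omega) (by omega) (by omega) (by omega) (by omega) (by omega)
        fun x _ _ => top x (by omega) (by omega),
      V (by omega) (by omega) (by omega) (by omega) (by omega) (by omega)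
        fun y _ _ => lef y (by omega) (by omega),
      H (by omega) (by omega) (by omega) (by omega) (by omega) (by omega)
        (H2 _ _ _ (by rw [e1]; rfl) e0 (by omega))⟩
  · exact ⟨⟨H (by omega) (by omega) (by omega) (by omega) (by omega) (by omega)
        fun x _ _ => bot x (by omega) (by omega) (by omega),
      V (by omega) (by omega) (by omega) (by omega) (by omega) (by omega)
        (V2 _ _ _ (by rw [e5.1]; rfl) e5.2 (by omega))⟩,
      V (by omega) (by omega) (by omega) (by omega) (by omega) (by omega)
        fun y _ _ => rig y (by omega) (by omega),
      H (by omega) (by omega) (by omega) (by omega) (by omega) (by omega)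
        fun x _ _ => top x (by omega) (by omega),
      V (by omega) (by omega) (by omega) (by omega) (by omega) (by omega)
        fun y _ _ => lef y (by omega) (by omega),
      H (by omega) (by omega) (by omega) (by omega) (by omega) (by omega)
        (H2 _ _ _ (by rw [e1]; rfl) e0 (by omega))⟩

end Segments

/-- A path that starts along the bottom side from the lower left corner is regular. -/
theorem IsValid.isRegular {k : ℕ} {t : ℤ → ℤ → Ty} {R : SimpleGraph (board k k)} (hk : 3 ≤ k)
    (h : IsValid 0 (k - 1) t) (ha : t 0 0 = B)
    (hR : ∀ a b : board k k, Joined t a.1 b.1 → R.Adj a b) : IsRegular R := by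
  rcases h.spiral (by omega) ha with c | ⟨T, s, c1, c2, c3, c4⟩
  · refine Or.inl fun i hi => Frame.frameHasType hR ?_
    simpa using c i (by omega)
  · refine Or.inr ⟨T, s, by omega, c2, fun i hi => Frame.frameHasType hR ?_,
      fun i hi hs => Frame.frameHasType hR ?_⟩
    · simpa using c3 i hi
    · simpa using c4 i (by omega) hs

end KingSnake

/-! ### Straight blocks on the sides lie flat against the boundary -/

namespace KingSnake

open Ty

namespace IsLocal

variable {t : ℤ → ℤ → Ty} (h : IsLocal t) {x y : ℤ}
include h

/-- If the block is `T`, then `T` propagates upwards. If it is diagonal, then it faces the block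
above with one cell without being joined to it, which leaves only `T` there. -/
theorem eq_T_of_straight (h1 : (t x y).hor) (h2 : (t (x - 1) y).hor) (h3 : (t (x + 1) y).hor)
    (h4 : t x y ≠ B) (h5 : t x (y + 1) ≠ E) : t x (y + 1) = Ty.T := by
  by_cases hv : (t x y).ver
  · exact (h.ver_up hv h5).resolve_left (h.not_ver_of_hor h1 h2 h3 hv).2
  · have : t x y = Ty.T := by
      revert h1 h4 hv
      generalize t x y = a
      revert a; decide
    exact h.T_up this h5

end IsLocal

namespace IsValid

variable {lo hi : ℤ} {t : ℤ → ℤ → Ty}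

/-- A `T` cannot stand in a lower corner, so the two columns survive the removal of every frame,
down to a `2 × 2` square whose two rows are not joined. -/
theorem not_two_columns (h : IsValid lo hi t) {x : ℤ} (h1 : lo ≤ x) (h2 : x + 1 ≤ hi)
    (hx : ∀ y, lo ≤ y → y ≤ hi → t x y = Ty.T ∧ t (x + 1) y = Ty.T) : False := by
  obtain ⟨n, hn⟩ : ∃ n : ℕ, hi - lo ≤ n := ⟨(hi - lo).toNat, by omega⟩
  induction n generalizing lo hi t with
  | zero => omega
  | succ n ih =>
    by_cases hs : lo + 2 ≤ hi
    · have e1 : x ≠ lo := by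
        rintro rfl
        have := h.corner hs
        simp [(hx x le_rfl (by omega)).1] at this
      have e2 : x + 1 ≠ hi := by
        rintro rfl
        have := h.corner_lower_right hs
        simp [(hx lo le_rfl (by omega)).2] at this
      refine ih (h.inner hs) (by omega) (by omega) (fun y k1 k2 => ?_)
        (by push_cast at hn; omega)
      rw [inner_of_mem (by unfold InSq; omega), inner_of_mem (by unfold InSq; omega)]
      exact hx y (by omega) (by omega)
    · obtain rfl : hi = lo + 1 := by omega
      obtain rfl : x = lo := by omega
      refine h.not_closed (A := fun _ y => y = x) (x := x) (y := x) (x' := x) (y' := x + 1)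
        ⟨fun _ _ _ _ => Iff.rfl, fun u v k1 k2 => ?_⟩ (by unfold InSq; omega)
        (by unfold InSq; omega) rfl (by omega)
      have m := h.inSq_of_ver k1
      unfold InSq at m
      have := hx v m.2.1 m.2.2
      obtain rfl | rfl : u = x ∨ u = x + 1 := by omega
      · rw [this.1] at k1; exact absurd k1 (by decide)
      · rw [this.2] at k1; exact absurd k1 (by decide)

/-- Three quarter turns bring this end to the lower left corner, where the block in question becomes
the one described by `Frame.second`. -/
theorem next_of_lower_right (h : IsValid lo hi t) (hlo : lo + 2 ≤ hi) (hb : t hi lo = R) :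
    t (hi - 1) lo = S ∨ t (hi - 1) lo = R := by
  have h' := h.rotate.rotate.rotate
  obtain ⟨T, f⟩ := h'.exists_frame hlo (by
    simp only [KingSnake.rotate, add_sub_cancel_left, add_sub_cancel_right, hb]; rfl)
  have := f.second
  simp only [KingSnake.rotate, add_sub_cancel_left, add_sub_cancel_right,
    show lo + hi - (lo + 1) = hi - 1 by ring] at this
  revert this
  generalize t (hi - 1) lo = a
  split_ifs <;> revert a <;> decide

/-- A straight block with its top right cell occupied, hence not `B`, has a column of `T` above it.
The diagonal condition at that cell forces the block to the right of the start of this column to be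
straight and not `B` as well, so a second column of `T` arises beside the first, contrary to
`not_two_columns`. -/
theorem not_upper_right_of_straight (h : IsValid lo hi t) (hlo : lo + 4 ≤ hi) {x : ℤ}
    (x1 : lo < x) (x2 : x < hi) (h1 : (t x lo).hor) (h2 : (t (x - 1) lo).hor)
    (h3 : (t (x + 1) lo).hor) : (t x lo).tr = false := by
  by_contra htr
  rw [Bool.not_eq_false] at htr
  have n0 : ∀ {x y}, InSq lo hi x y → t x y ≠ E := fun k => (h.supp _ _).2 k
  have hT0 := h.loc.eq_T_of_straight h1 h2 h3
      (by intro e; rw [e] at htr; exact absurd htr (by decide))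
    (n0 (by unfold InSq; omega))
  have hT : ∀ y, lo + 1 ≤ y → y ≤ hi → t x y = Ty.T := fun y => h.T_of_le hT0
  have hQ := h.inner (by omega)
  have m : ∀ {x y}, InSq (lo + 1) (hi - 1) x y → KingSnake.inner lo hi t x y = t x y :=
    inner_of_mem
  have e1 : x ≠ lo + 1 := by
    rintro rfl
    have := hQ.corner (by omega)
    rw [m (by unfold InSq; omega)] at this
    simp [hT0] at this
  have cb := hQ.corner_lower_right (by omega)
  rw [m (by unfold InSq; omega)] at cb
  have e2 : x ≠ hi - 1 := by
    rintro rfl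
    simp [hT0] at cb
  have hbl : (t (x + 1) (lo + 1)).bl = false := by
    have := h.loc.d x lo
    rw [dOK, htr] at this
    simpa using this
  have nd : ∀ x, ¬(KingSnake.inner lo hi t x (lo + 1 - 1)).ver := fun x =>
    hQ.not_ver_of_down (by omega)
  -- the first `R` to the right of a block not joined upwards would give too many ends
  have key : ∀ z, x ≤ z → z + 1 ≤ hi - 1 → t (z + 1) (lo + 1) = R → (t z (lo + 1)).hor →
      t z (lo + 1) ≠ S → ¬((t z (lo + 1)).ver ∧ (t z (lo + 1 + 1)).ver) → False := by
    intro z z1 z2 k1 k2 k3 k4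
    by_cases hz : z + 1 = hi - 1
    · have := hQ.next_of_lower_right (by omega)
        (by rw [m (by unfold InSq; omega), ← hz]; exact k1)
      rw [m (by unfold InSq; omega), show hi - 1 - 1 = z by omega] at this
      rcases this with k | k
      · exact k3 k
      · rw [k] at k2; exact absurd k2 (by decide)
    · have k5 := h.loc.R_right k1 (n0 (by unfold InSq; omega))
      have := hQ.ends (x₁ := z) (y₁ := lo + 1) (x₂ := z + 1) (y₂ := lo + 1) (x₃ := z + 1 + 1)
        (y₃ := lo + 1) (by unfold InSq; omega) (by unfold InSq; omega) (by unfold InSq; omega)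
        (deg_le_one_of_not_right_down_up
          (fun k => by
            rw [m (x := z + 1) (by unfold InSq; omega), k1] at k; exact absurd k.2 (by decide))
          (fun k => nd _ k.2)
          (fun k => k4 (by
            rwa [m (by unfold InSq; omega), m (by unfold InSq; omega)] at k)))
        (hQ.deg_bottom (by rw [m (by unfold InSq; omega), k1]; decide))
        (hQ.deg_bottom (by rw [m (by unfold InSq; omega), k5]; decide))
      omega
  have hor1 : (t (x + 1) (lo + 1)).hor :=
    (h.loc.hor_right (by rw [hT0]; rfl) (n0 (by unfold InSq; omega))).resolve_right fun k =>
      key x le_rfl (by omega) k (by rw [hT0]; rfl) (by rw [hT0]; decide) (by rw [hT0]; simp [ver])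
  have hTZ : t (x + 1) (lo + 1) = Ty.T ∨ t (x + 1) (lo + 1) = Z := by
    revert hor1 hbl
    generalize t (x + 1) (lo + 1) = a
    revert a; decide
  have e3 : x + 1 ≠ hi - 1 := by
    intro e
    rw [e] at hTZ
    rcases hTZ with k | k <;> simp [k] at cb
  have hnu : ¬((t (x + 1) (lo + 1)).ver ∧ (t (x + 1) (lo + 1 + 1)).ver) := by
    rintro ⟨k1, k2⟩
    have := h.loc.eq_S_of_left_up hor1 k1 (by rw [add_sub_cancel_right, hT0]; rfl) k2
    rcases hTZ with k | k <;> simp [k] at this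
  have hor2 : (t (x + 1 + 1) (lo + 1)).hor :=
    (h.loc.hor_right hor1 (n0 (by unfold InSq; omega))).resolve_right fun k =>
      key (x + 1) (by omega) (by omega) k hor1
        (by rcases hTZ with k | k <;> simp [k]) hnu
  have hT1 := h.loc.eq_T_of_straight hor1 (by rw [add_sub_cancel_right, hT0]; rfl) hor2
    (by rcases hTZ with k | k <;> simp [k]) (n0 (by unfold InSq; omega))
  refine (hQ.inner (by omega)).not_two_columns (x := x) (by omega) (by omega) fun y y1 y2 => ?_
  -- The second column is known only from the row `lo + 2` upwards, which is why two frames are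
  -- removed.
  have e : ∀ z, InSq (lo + 1 + 1) (hi - 1 - 1) z y →
      KingSnake.inner (lo + 1) (hi - 1) (KingSnake.inner lo hi t) z y = t z y := fun z k =>
    (inner_of_mem k).trans (m (by unfold InSq at *; omega))
  rw [e x (by unfold InSq; omega), e (x + 1) (by unfold InSq; omega)]
  exact ⟨hT y (by omega) (by omega), h.T_of_le hT1 (by omega) (by omega)⟩

/-- Straight blocks of the bottom side. -/
theorem eq_B (h : IsValid lo hi t) (hlo : lo + 4 ≤ hi) {x : ℤ} (x1 : lo < x) (x2 : x < hi)
    (h1 : (t x lo).hor) (h2 : (t (x - 1) lo).hor) (h3 : (t (x + 1) lo).hor) : t x lo = B := by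
  have k1 := h.not_upper_right_of_straight hlo x1 x2 h1 h2 h3
  -- The composition is the reflection in the vertical axis of the square, which exchanges `tl` and
  -- `tr`.
  have k2 := h.reflect.rotate.not_upper_right_of_straight hlo (x := lo + hi - x) (by omega)
    (by omega)
  simp only [KingSnake.rotate, KingSnake.reflect, hor_rot, ver_swap, sub_sub_cancel,
    show lo + hi - (lo + hi - x - 1) = x + 1 by ring,
    show lo + hi - (lo + hi - x + 1) = x - 1 by ring] at k2
  specialize k2 h1 h3 h2
  revert h1 k1 k2
  generalize t x lo = a
  revert a; decide

theorem eq_L (h : IsValid lo hi t) (hlo : lo + 4 ≤ hi) {y : ℤ} (y1 : lo < y) (y2 : y < hi)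
    (h1 : (t lo y).ver) (h2 : (t lo (y - 1)).ver) (h3 : (t lo (y + 1)).ver) : t lo y = L := by
  have k := h.rotate.eq_B hlo (x := lo + hi - y) (by omega) (by omega)
  simp only [KingSnake.rotate, hor_rot, sub_sub_cancel,
    show lo + hi - (lo + hi - y - 1) = y + 1 by ring,
    show lo + hi - (lo + hi - y + 1) = y - 1 by ring] at k
  specialize k h1 h3 h2
  revert k
  generalize t lo y = a
  revert a; decide

theorem eq_T (h : IsValid lo hi t) (hlo : lo + 4 ≤ hi) {x : ℤ} (x1 : lo < x) (x2 : x < hi)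
    (h1 : (t x hi).hor) (h2 : (t (x - 1) hi).hor) (h3 : (t (x + 1) hi).hor) :
    t x hi = Ty.T := by
  have k := h.rotate.eq_L hlo (y := x) (by omega) (by omega)
  simp only [KingSnake.rotate, ver_rot, add_sub_cancel_left] at k
  specialize k h1 h2 h3
  revert k
  generalize t x hi = a
  revert a; decide

theorem eq_R (h : IsValid lo hi t) (hlo : lo + 4 ≤ hi) {y : ℤ} (y1 : lo < y) (y2 : y < hi)
    (h1 : (t hi y).ver) (h2 : (t hi (y - 1)).ver) (h3 : (t hi (y + 1)).ver) : t hi y = R := by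
  have k := h.rotate.eq_T hlo (x := lo + hi - y) (by omega) (by omega)
  simp only [KingSnake.rotate, hor_rot, sub_sub_cancel,
    show lo + hi - (lo + hi - y - 1) = y + 1 by ring,
    show lo + hi - (lo + hi - y + 1) = y - 1 by ring] at k
  specialize k h1 h3 h2
  revert k
  generalize t hi y = a
  revert a; decide

end IsValid

end KingSnake

/-! ### Reconstruction of a path from its interior and the type of its frame -/

namespace KingSnake

open Ty

/-- The blocks of the outermost frame when it is of type `T`. -/
def ring (T : FrameType) (lo hi x y : ℤ) : Ty :=
  if y = lo then
    if x = lo then B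
    else if x = hi then if T = .V then R else S
    else if x = hi - 1 ∧ T = .V then S else B
  else if x = hi then
    if y = hi then if T = .IV then Ty.T else Z
    else if y = hi - 1 ∧ T = .IV then Z else R
  else if y = hi then
    if x = lo then if T = .III then L else S
    else if x = lo + 1 ∧ T = .III then S else Ty.T
  else
    if y = lo + 1 then if T = .II then B else Z
    else if y = lo + 2 ∧ T = .II then Z else L

/-- `Q` surrounded by a frame of type `T`. -/
def ext (T : FrameType) (lo hi : ℤ) (Q : ℤ → ℤ → Ty) (x y : ℤ) : Ty :=
  if lo < x ∧ x < hi ∧ lo < y ∧ y < hi then Q x y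
  else if lo ≤ x ∧ x ≤ hi ∧ lo ≤ y ∧ y ≤ hi then ring T lo hi x y
  else E

/-- A frame prescribes its corners and the blocks beside its attachments. All other blocks of the
sides are straight and hence lie flat by `eq_B`, `eq_R`, `eq_T`, `eq_L`, which is where side at
least five is used. -/
theorem Frame.eq_ext {T : FrameType} {lo hi : ℤ} {t : ℤ → ℤ → Ty} (f : Frame T lo hi t)
    (h : IsValid lo hi t) (hlo : lo + 4 ≤ hi) : t = ext T lo hi (inner lo hi t) := by
  funext x y
  unfold ext
  split_ifs with h1 h2
  · rw [inner_of_mem (by unfold InSq; omega)]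
  · unfold ring
    split_ifs with c1 c2 c3 c4 c5 c6 c7 c8 c9 c10 c11 c12 c13 c14 c15 c16
    · rw [c1, c2, f.a]
    · rw [c1, c3, f.b, if_pos c4]
    · rw [c1, c3, f.b, if_neg c4]
    · rw [c1, c5.1, (f.five c5.2).1]
    · have hV : T = .V → x ≤ hi - 1 - 1 := fun e => by
        have : x ≠ hi - 1 := fun e' => c5 ⟨e', e⟩
        omega
      rw [c1]
      exact h.eq_B hlo (by omega) (by omega)
          (f.bottom _ (by omega) (by omega) fun e => by have := hV e; omega)
        (f.bottom _ (by omega) (by omega) fun e => by have := hV e; omega)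
        (f.bottom _ (by omega) (by omega) fun e => by have := hV e; omega)
    · rw [c6, c7, f.c, if_pos c8]
    · rw [c6, c7, f.c, if_neg c8]
    · rw [c6, c9.1, (f.four c9.2).1]
    · have hV : T = .IV → y ≤ hi - 1 - 1 := fun e => by
        have : y ≠ hi - 1 := fun e' => c9 ⟨e', e⟩
        omega
      rw [c6]
      exact h.eq_R hlo (by omega) (by omega)
          (f.right _ (by omega) (by omega) fun e => by have := hV e; omega)
        (f.right _ (by omega) (by omega) fun e => by have := hV e; omega)
        (f.right _ (by omega) (by omega) fun e => by have := hV e; omega)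
    · rw [c10, c11, f.d, if_pos c12]
    · rw [c10, c11, f.d, if_neg c12]
    · rw [c10, c13.1, (f.three c13.2).1]
    · have hV : T = .III → lo + 1 + 1 ≤ x := fun e => by
        have : x ≠ lo + 1 := fun e' => c13 ⟨e', e⟩
        omega
      rw [c10]
      exact h.eq_T hlo (by omega) (by omega)
          (f.top _ (by omega) (by omega) fun e => by have := hV e; omega)
        (f.top _ (by omega) (by omega) fun e => by have := hV e; omega)
        (f.top _ (by omega) (by omega) fun e => by have := hV e; omega)
    · rw [show x = lo by omega, c14, f.second, if_pos c15]
    · rw [show x = lo by omega, c14, f.second, if_neg c15]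
    · rw [show x = lo by omega, c16.1, (f.two c16.2).2.1]
    · have hV : T = .II → lo + 1 + 1 + 1 ≤ y := fun e => by
        have : y ≠ lo + 2 := fun e' => c16 ⟨e', e⟩
        omega
      rw [show x = lo by omega]
      exact h.eq_L hlo (by omega) (by omega)
          (f.left _ (by omega) (by omega) fun e => by have := hV e; omega)
        (f.left _ (by omega) (by omega) fun e => by have := hV e; omega)
        (f.left _ (by omega) (by omega) fun e => by have := hV e; omega)
  · exact h.eq_E (by unfold InSq; omega)

section Closed

variable {t : ℤ → ℤ → Ty} {A : ℤ → ℤ → Prop} (hA : Closed t A)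
include hA

theorem Closed.row {a b y : ℤ} (hab : a ≤ b) (h : ∀ x, a ≤ x → x ≤ b → (t x y).hor) :
    A a y ↔ A b y := by
  induction b, hab using Int.leInduction with
  | base => rfl
  | succ b hb ih =>
    rw [ih fun x h1 h2 => h x h1 (by omega)]
    exact hA.1 b y (h b hb (by omega)) (h _ (by omega) le_rfl)

theorem Closed.column {a b x : ℤ} (hab : a ≤ b) (h : ∀ y, a ≤ y → y ≤ b → (t x y).ver) :
    A x a ↔ A x b := by
  induction b, hab using Int.leInduction with
  | base => rfl
  | succ b hb ih =>
    rw [ih fun x h1 h2 => h x h1 (by omega)]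
    exact hA.2 x b (h b hb (by omega)) (h _ (by omega) le_rfl)

end Closed

/-- A path in the inner blocks is extended to a path by a frame of one of the five types. -/
theorem IsValid.of_inner {T : FrameType} {lo hi : ℤ} {t : ℤ → ℤ → Ty}
    (hsupp : ∀ x y, t x y ≠ E ↔ InSq lo hi x y) (hloc : IsLocal t) (f : Frame T lo hi t)
    (h : IsValid (lo + 1) (hi - 1) (KingSnake.inner lo hi t)) : IsValid lo hi t where
  supp := hsupp
  loc := hloc
  conn A hA := by
    have hs := f.size
    have inn : ∀ x y, InSq (lo + 1) (hi - 1) x y → (A x y ↔ A (lo + 1) (lo + 1)) := by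
      have hc : Closed (KingSnake.inner lo hi t) A := by
        refine ⟨fun x y k1 k2 => hA.1 x y ?_ ?_, fun x y k1 k2 => hA.2 x y ?_ ?_⟩
        · rwa [inner_of_mem (h.inSq_of_hor k1)] at k1
        · rwa [inner_of_mem (h.inSq_of_hor k2)] at k2
        · rwa [inner_of_mem (h.inSq_of_ver k1)] at k1
        · rwa [inner_of_mem (h.inSq_of_ver k2)] at k2
      intro x y m
      have n1 := (h.supp x y).2 m
      have n2 := (h.supp (lo + 1) (lo + 1)).2 (by unfold InSq; omega)
      exact ⟨h.conn A hc _ _ _ _ n1 n2, h.conn A hc _ _ _ _ n2 n1⟩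
    have e1 : A lo (lo + 1) ↔ A (lo + 1) (lo + 1) :=
      hA.1 _ _ (by rw [f.second]; split_ifs <;> rfl) f.entry
    -- The frame is followed backwards from its entry: up the left side, along the top, down the
    -- right side, back along the bottom. Just after the second end the value of `A` is taken from
    -- the second attachment instead.
    have lef : ∀ y, lo + 1 ≤ y → y ≤ hi → (A lo y ↔ A (lo + 1) (lo + 1)) := by
      intro y y1 y2
      by_cases hT : T = .II
      · obtain ⟨k1, k2, k3⟩ := f.two hT
        rcases eq_or_ne y (lo + 1) with rfl | hy
        · exact e1
        rw [← hA.column (a := lo + 2) (b := y) (by omega)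
          (fun z z1 z2 => f.left z (by omega) (by omega) (by omega)),
          hA.1 _ _ (by rw [k2]; rfl) k3, inn _ _ (by unfold InSq; omega)]
      · rw [← hA.column (a := lo + 1) (b := y) (by omega)
          (fun z z1 z2 => f.left z (by omega) (by omega) (fun e => absurd e hT)), e1]
    have top : ∀ x, lo ≤ x → x ≤ hi → (A x hi ↔ A (lo + 1) (lo + 1)) := by
      intro x x1 x2
      rcases eq_or_ne x lo with rfl | hx
      · exact lef hi (by omega) le_rfl
      by_cases hT : T = .III
      · obtain ⟨k1, k2⟩ := f.three hT
        have := hA.2 (lo + 1) (hi - 1) k2 (by rw [sub_add_cancel, k1]; rfl)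
        rw [sub_add_cancel] at this
        rw [← hA.row (a := lo + 1) (b := x) (by omega)
          (fun z z1 z2 => f.top z (by omega) (by omega) (by omega)), ← this,
          inn _ _ (by unfold InSq; omega)]
      · rw [← hA.row (a := lo) (b := x) (by omega)
          (fun z z1 z2 => f.top z (by omega) (by omega) (fun e => absurd e hT)),
          lef hi (by omega) le_rfl]
    have rig : ∀ y, lo ≤ y → y ≤ hi → (A hi y ↔ A (lo + 1) (lo + 1)) := by
      intro y y1 y2
      rcases eq_or_ne y hi with rfl | hy
      · exact top y (by omega) le_rfl
      by_cases hT : T = .IV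
      · obtain ⟨k1, k2⟩ := f.four hT
        have := hA.1 (hi - 1) (hi - 1) k2 (by rw [sub_add_cancel, k1]; rfl)
        rw [sub_add_cancel] at this
        rw [hA.column (a := y) (b := hi - 1) (by omega)
          (fun z z1 z2 => f.right z (by omega) (by omega) (by omega)), ← this,
          inn _ _ (by unfold InSq; omega)]
      · rw [hA.column (a := y) (b := hi) (by omega)
          (fun z z1 z2 => f.right z (by omega) (by omega) (fun e => absurd e hT)),
          top hi (by omega) le_rfl]
    have bot : ∀ x, lo ≤ x → x ≤ hi → (A x lo ↔ A (lo + 1) (lo + 1)) := by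
      intro x x1 x2
      rcases eq_or_ne x hi with rfl | hx
      · exact rig lo (by omega) (by omega)
      by_cases hT : T = .V
      · obtain ⟨k1, k2⟩ := f.five hT
        rw [hA.row (a := x) (b := hi - 1) (by omega)
          (fun z z1 z2 => f.bottom z (by omega) (by omega) (by omega)),
          hA.2 _ _ (by rw [k1]; rfl) k2, inn _ _ (by unfold InSq; omega)]
      · rw [hA.row (a := x) (b := hi) (by omega)
          (fun z z1 z2 => f.bottom z (by omega) (by omega) (fun e => absurd e hT)),
          rig lo (by omega) (by omega)]
    have all : ∀ x y, t x y ≠ E → (A x y ↔ A (lo + 1) (lo + 1)) := by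
      intro x y m
      rw [hsupp] at m
      by_cases hm : InSq (lo + 1) (hi - 1) x y
      · exact inn x y hm
      unfold InSq at m hm
      obtain rfl | rfl | rfl | ⟨rfl, h1⟩ : y = lo ∨ y = hi ∨ x = hi ∨ (x = lo ∧ lo < y) := by omega
      · exact bot x (by omega) (by omega)
      · exact top x (by omega) (by omega)
      · exact rig y (by omega) (by omega)
      · exact lef y (by omega) (by omega)
    intro x y x' y' m m' hx
    rw [all _ _ m'] ; rwa [all _ _ m] at hx

section Ext

variable {T : FrameType} {lo hi : ℤ} {Q : ℤ → ℤ → Ty}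

theorem inner_ext (hQ : IsValid (lo + 1) (hi - 1) Q) : inner lo hi (ext T lo hi Q) = Q := by
  funext x y
  unfold inner ext
  split_ifs with h1 h2
  · rfl
  · unfold InSq at h1; omega
  · unfold InSq at h1; omega
  · exact (hQ.eq_E h1).symm

theorem ext_supp (hQ : IsValid (lo + 1) (hi - 1) Q) (x y : ℤ) :
    ext T lo hi Q x y ≠ E ↔ InSq lo hi x y := by
  have := hQ.supp x y
  unfold InSq at *
  unfold ext
  split_ifs with h1 h2
  · rw [this]; omega
  · simp only [show (lo ≤ x ∧ x ≤ hi) ∧ lo ≤ y ∧ y ≤ hi by omega]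
    unfold ring
    split_ifs <;> decide
  · simp only [ne_eq, not_true_eq_false, false_iff]; omega

/-- For types other than I, the second attachment requires an inner block that is ready to be
joined. It is the second end in the inner frame of the same type; in type III, for instance, the `L`
in the inner upper left corner is `ver`. -/
theorem frame_ext {T' : FrameType} (f : Frame T' (lo + 1) (hi - 1) Q) (hlo : lo + 4 ≤ hi)
    (hT : T = .I ∨ T' = T) : Frame T lo hi (ext T lo hi Q) := by
  have q : ∀ x y, lo < x → x < hi → lo < y → y < hi → ext T lo hi Q x y = Q x y :=
    fun x y h1 h2 h3 h4 => if_pos ⟨h1, h2, h3, h4⟩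
  have r : ∀ x y, ¬(lo < x ∧ x < hi ∧ lo < y ∧ y < hi) → lo ≤ x → x ≤ hi → lo ≤ y → y ≤ hi →
      ext T lo hi Q x y = ring T lo hi x y :=
    fun x y h h1 h2 h3 h4 => by rw [ext, if_neg h, if_pos ⟨h1, h2, h3, h4⟩]
  have hTT : T ≠ .I → T' = T := fun h => hT.resolve_left h
  refine ⟨by omega, fun x h1 h2 h3 => ?_, fun x h1 h2 h3 => ?_, fun x h1 h2 h3 => ?_,
    fun x h1 h2 h3 => ?_, ?_, ?_, ?_, ?_, ?_, ?_, ?_, ?_, ?_, ?_⟩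
  · rw [r _ _ (by omega) (by omega) (by omega) (by omega) (by omega), ring]
    cases T <;> simp only [reduceCtorEq, false_imp_iff, forall_const] at h3 ⊢ <;> split_ifs <;>
      first | rfl | contradiction | omega
  · rw [r _ _ (by omega) (by omega) (by omega) (by omega) (by omega), ring]
    cases T <;> simp only [reduceCtorEq, false_imp_iff, forall_const] at h3 ⊢ <;> split_ifs <;>
      first | rfl | contradiction | omega
  · rw [r _ _ (by omega) (by omega) (by omega) (by omega) (by omega), ring]
    cases T <;> simp only [reduceCtorEq, false_imp_iff, forall_const] at h3 ⊢ <;> split_ifs <;>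
      first | rfl | contradiction | omega
  · rw [r _ _ (by omega) (by omega) (by omega) (by omega) (by omega), ring]
    cases T <;> simp only [reduceCtorEq, false_imp_iff, forall_const] at h3 ⊢ <;> split_ifs <;>
      first | rfl | contradiction | omega
  · rw [r _ _ (by omega) (by omega) (by omega) (by omega) (by omega), ring, if_pos rfl, if_pos rfl]
  · rw [r _ _ (by omega) (by omega) (by omega) (by omega) (by omega), ring, if_pos rfl,
      if_neg (by omega), if_pos rfl]
  · rw [r _ _ (by omega) (by omega) (by omega) (by omega) (by omega), ring, if_neg (by omega),
      if_pos rfl, if_pos rfl]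
  · rw [r _ _ (by omega) (by omega) (by omega) (by omega) (by omega), ring, if_neg (by omega),
      if_neg (by omega), if_pos rfl, if_pos rfl]
  · rw [q _ _ (by omega) (by omega) (by omega) (by omega), f.a]; rfl
  · rw [r _ _ (by omega) (by omega) (by omega) (by omega) (by omega), ring, if_neg (by omega),
      if_neg (by omega), if_neg (by omega), if_pos rfl]
  · rintro rfl
    obtain rfl := hTT (by decide)
    refine ⟨by omega, ?_, ?_⟩
    · rw [r _ _ (by omega) (by omega) (by omega) (by omega) (by omega), ring, if_neg (by omega),
        if_neg (by omega), if_neg (by omega), if_neg (by omega), if_pos ⟨rfl, rfl⟩]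
    · rw [q _ _ (by omega) (by omega) (by omega) (by omega)]
      have := f.second
      rw [show lo + 1 + 1 = lo + 2 by ring, if_pos rfl] at this
      rw [this]; rfl
  · rintro rfl
    obtain rfl := hTT (by decide)
    refine ⟨?_, ?_⟩
    · rw [r _ _ (by omega) (by omega) (by omega) (by omega) (by omega), ring, if_neg (by omega),
        if_neg (by omega), if_pos rfl, if_neg (by omega), if_pos ⟨rfl, rfl⟩]
    · rw [q _ _ (by omega) (by omega) (by omega) (by omega), f.d, if_pos rfl]; rfl
  · rintro rfl
    obtain rfl := hTT (by decide)
    refine ⟨?_, ?_⟩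
    · rw [r _ _ (by omega) (by omega) (by omega) (by omega) (by omega), ring, if_neg (by omega),
        if_pos rfl, if_neg (by omega), if_pos ⟨rfl, rfl⟩]
    · rw [q _ _ (by omega) (by omega) (by omega) (by omega), f.c, if_pos rfl]; rfl
  · rintro rfl
    obtain rfl := hTT (by decide)
    refine ⟨?_, ?_⟩
    · rw [r _ _ (by omega) (by omega) (by omega) (by omega) (by omega), ring, if_pos rfl,
        if_neg (by omega), if_neg (by omega), if_pos ⟨rfl, rfl⟩]
    · rw [q _ _ (by omega) (by omega) (by omega) (by omega), f.b, if_pos rfl]; rfl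

end Ext

end KingSnake

/-! ### Local conditions around an added frame, reduced to finitely many positions -/

namespace KingSnake

open Ty

/-- The positions of a coordinate relative to an interval. -/
inductive Pos
  | out | l | l1 | l2 | m | h1 | h
  deriving DecidableEq

namespace Pos

instance : Fintype Pos := ⟨{out, l, l1, l2, m, h1, h}, fun x => by cases x <;> decide⟩

def inside : Pos → Bool
  | out | l | h => false
  | _ => true

/-- `p.next q`: the position after `p` can be `q`. -/
def next : Pos → Pos → Bool
  | out, out | out, l | l, l1 | l1, l2 | l2, m | l2, h1 | m, m | m, h1 | h1, h | h, out => true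
  | _, _ => false

/-- The five named positions are distinct once `lo + 4 ≤ hi`; only then is the order of the tests
immaterial. -/
def of (lo hi x : ℤ) : Pos :=
  if x = lo then l else if x = lo + 1 then l1 else if x = lo + 2 then l2 else if x = hi then h
  else if x = hi - 1 then h1 else if lo < x ∧ x < hi then m else out

theorem next_of {lo hi : ℤ} (hlo : lo + 4 ≤ hi) (x : ℤ) :
    (of lo hi x).next (of lo hi (x + 1)) := by
  unfold of
  split_ifs <;> first | rfl | omega

/-- The outermost frame in terms of positions. -/
def ring (T : FrameType) : Pos → Pos → Ty
  | l, l => B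
  | h, l => if T = .V then R else S
  | h1, l => if T = .V then S else B
  | _, l => B
  | h, h => if T = .IV then Ty.T else Z
  | h, h1 => if T = .IV then Z else R
  | h, _ => R
  | l, h => if T = .III then L else S
  | l1, h => if T = .III then S else Ty.T
  | _, h => Ty.T
  | _, l1 => if T = .II then B else Z
  | _, l2 => if T = .II then Z else L
  | _, _ => L

def ext (T : FrameType) (q : Ty) (a b : Pos) : Ty :=
  if a.inside && b.inside then q else if a = out ∨ b = out then E else ring T a b

/-- An extended block depends only on the inner type and the two positions, so each local condition
becomes a statement about finitely many cases, which can be decided by exhaustion. -/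
theorem ext_eq {lo hi : ℤ} (hlo : lo + 4 ≤ hi) (T : FrameType) (Q : ℤ → ℤ → Ty) (x y : ℤ) :
    KingSnake.ext T lo hi Q x y = ext T (Q x y) (of lo hi x) (of lo hi y) := by
  have key : ∀ z : ℤ, ((of lo hi z).inside = true ↔ lo < z ∧ z < hi) ∧
      (of lo hi z = out ↔ ¬(lo ≤ z ∧ z ≤ hi)) ∧ (of lo hi z = l ↔ z = lo) ∧
      (of lo hi z = l1 ↔ z = lo + 1) ∧ (of lo hi z = l2 ↔ z = lo + 2) ∧
      (of lo hi z = h1 ↔ z = hi - 1) ∧ (of lo hi z = h ↔ z = hi) := by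
    intro z
    unfold of
    split_ifs <;> simp only [inside, true_iff, false_iff, Bool.false_eq_true] <;> omega
  obtain ⟨x1, x2, x3, x4, -, x6, x7⟩ := key x
  obtain ⟨y1, y2, y3, y4, y5, y6, y7⟩ := key y
  have e1 : (lo < x ∧ x < hi ∧ lo < y ∧ y < hi) ↔
      ((of lo hi x).inside && (of lo hi y).inside) = true := by
    rw [Bool.and_eq_true, x1, y1, and_assoc]
  have e2 : (lo ≤ x ∧ x ≤ hi ∧ lo ≤ y ∧ y ≤ hi) ↔ ¬(of lo hi x = out ∨ of lo hi y = out) := by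
    rw [x2, y2, not_or, not_not, not_not, and_assoc]
  unfold KingSnake.ext KingSnake.ring ext
  simp only [e1, e2, ← x3, ← x4, ← x6, ← x7, ← y3, ← y4, ← y5, ← y6, ← y7]
  generalize of lo hi x = a
  generalize of lo hi y = b
  clear * -
  cases a <;> cases b <;> simp only [reduceCtorEq, inside, ring, Bool.and_true, Bool.and_false,
    Bool.false_eq_true, if_true, if_false, false_and, true_and, or_true, true_or, or_self, not_true,
    not_false_iff]

/-- The inner blocks next to the places where the frame is joined to the inner path. -/
def special (T : FrameType) (q : Ty) : Pos → Pos → Bool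
  | l1, l1 => q = B
  | l1, l2 => T ≠ .II ∨ q = B
  | l1, h1 => T ≠ .III ∨ q = L
  | h1, h1 => T ≠ .IV ∨ q = Ty.T
  | h1, l1 => T ≠ .V ∨ q = R
  | _, _ => true

theorem special_of {T T' : FrameType} {lo hi : ℤ} {Q : ℤ → ℤ → Ty}
    (f : Frame T' (lo + 1) (hi - 1) Q) (hT : T = .I ∨ T' = T) (x y : ℤ) :
    special T (Q x y) (of lo hi x) (of lo hi y) := by
  have c1 := f.a
  have c2 := f.b
  have c3 := f.c
  have c4 := f.d
  have c5 := f.second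
  have key : ∀ z : ℤ, (of lo hi z = l1 → z = lo + 1) ∧ (of lo hi z = l2 → z = lo + 1 + 1) ∧
      (of lo hi z = h1 → z = hi - 1) := by
    intro z
    unfold of
    split_ifs <;> simp only [false_imp_iff, true_and, and_true, forall_const] <;> omega
  have kx := key x
  have ky := key y
  generalize of lo hi x = a at *
  generalize of lo hi y = b at *
  unfold special
  split
  · rw [kx.1 rfl, ky.1 rfl, c1]; rfl
  · rw [kx.1 rfl, ky.2.1 rfl, c5]; rcases hT with rfl | rfl <;> cases T' <;> rfl
  · rw [kx.1 rfl, ky.2.2 rfl, c4]; rcases hT with rfl | rfl <;> cases T' <;> rfl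
  · rw [kx.2.2 rfl, ky.2.2 rfl, c3]; rcases hT with rfl | rfl <;> cases T' <;> rfl
  · rw [kx.2.2 rfl, ky.1 rfl, c2]; rcases hT with rfl | rfl <;> cases T' <;> rfl
  · rfl

theorem h_ext (T : FrameType) : ∀ a a' b : Pos, a.next a' → ∀ q, special T q a b →
    ∀ q', special T q' a' b → hOK q q' → hOK (ext T q a b) (ext T q' a' b) := by
  cases T <;> decide +kernel

theorem v_ext (T : FrameType) : ∀ b b' a : Pos, b.next b' → ∀ q, special T q a b →
    ∀ q', special T q' a b' → vOK q q' → vOK (ext T q a b) (ext T q' a b') := by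
  cases T <;> decide +kernel

theorem d_ext (T : FrameType) : ∀ a a' : Pos, a.next a' → ∀ b b' : Pos, b.next b' →
    ∀ q, special T q a b → ∀ q', special T q' a' b' → dOK q q' →
    dOK (ext T q a b) (ext T q' a' b') := by
  cases T <;> decide +kernel

theorem e_ext (T : FrameType) : ∀ a a' : Pos, a.next a' → ∀ b b' : Pos, b.next b' →
    ∀ q, special T q a b' → ∀ q', special T q' a' b → eOK q q' →
    eOK (ext T q a b') (ext T q' a' b) := by
  cases T <;> decide +kernel

/-- `(ext T q a b).hor` in terms of `q.hor`. -/
def extHor (T : FrameType) (q : Bool) (a b : Pos) : Bool :=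
  if a.inside && b.inside then q else (ext T E a b).hor

def extVer (T : FrameType) (q : Bool) (a b : Pos) : Bool :=
  if a.inside && b.inside then q else (ext T E a b).ver

/-- The turn condition sees its four neighbours only through `hor` and `ver`. With Booleans in place
of types, the exhaustive check has `2⁴` instead of `7⁴` combinations of neighbours. -/
theorem hor_ext (T : FrameType) (q : Ty) (a b : Pos) :
    (ext T q a b).hor = extHor T q.hor a b := by
  unfold extHor ext; split_ifs <;> rfl

theorem ver_ext (T : FrameType) (q : Ty) (a b : Pos) :
    (ext T q a b).ver = extVer T q.ver a b := by
  unfold extVer ext; split_ifs <;> rfl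

/-- The premises are interleaved with the quantifiers, so that the evaluation discards impossible
positions and types early. -/
theorem turn_ext (T : FrameType) : ∀ a a' : Pos, a.next a' → ∀ b b' : Pos, b.next b' →
    ∀ q, special T q a' b' → ∀ a'' : Pos, a'.next a'' → ∀ b'' : Pos, b'.next b'' →
    ∀ i j k l, turnOK q i j k l → turnOK (ext T q a' b') (extHor T i a b') (extHor T j a'' b')
      (extVer T k a' b) (extVer T l a' b'') := by
  cases T <;> decide +kernel

end Pos

theorem isLocal_ext {T T' : FrameType} {lo hi : ℤ} {Q : ℤ → ℤ → Ty} (h : IsLocal Q)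
    (f : Frame T' (lo + 1) (hi - 1) Q) (hlo : lo + 4 ≤ hi) (hT : T = .I ∨ T' = T) :
    IsLocal (ext T lo hi Q) where
  h x y := by
    simp only [Pos.ext_eq hlo]
    exact Pos.h_ext T _ _ _ (Pos.next_of hlo x) _ (Pos.special_of f hT x y) _
      (Pos.special_of f hT _ y) (h.h x y)
  v x y := by
    simp only [Pos.ext_eq hlo]
    exact Pos.v_ext T _ _ _ (Pos.next_of hlo y) _ (Pos.special_of f hT x y) _
      (Pos.special_of f hT x _) (h.v x y)
  d x y := by
    simp only [Pos.ext_eq hlo]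
    exact Pos.d_ext T _ _ (Pos.next_of hlo x) _ _ (Pos.next_of hlo y) _
      (Pos.special_of f hT x y) _ (Pos.special_of f hT _ _) (h.d x y)
  e x y := by
    simp only [Pos.ext_eq hlo]
    exact Pos.e_ext T _ _ (Pos.next_of hlo x) _ _ (Pos.next_of hlo y) _
      (Pos.special_of f hT x _) _ (Pos.special_of f hT _ y) (h.e x y)
  turn x y := by
    simp only [Pos.ext_eq hlo, Pos.hor_ext, Pos.ver_ext]
    have p : ∀ z, (Pos.of lo hi (z - 1)).next (Pos.of lo hi z) := fun z => by
      have := Pos.next_of hlo (z - 1)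
      rwa [sub_add_cancel] at this
    exact Pos.turn_ext T _ _ (p x) _ _ (p y) _ (Pos.special_of f hT x y) _
      (Pos.next_of hlo x) _ (Pos.next_of hlo y) _ _ _ _ (h.turn x y)

theorem isValid_ext {T T' : FrameType} {lo hi : ℤ} {Q : ℤ → ℤ → Ty}
    (h : IsValid (lo + 1) (hi - 1) Q) (f : Frame T' (lo + 1) (hi - 1) Q) (hlo : lo + 4 ≤ hi)
    (hT : T = .I ∨ T' = T) : IsValid lo hi (ext T lo hi Q) :=
  IsValid.of_inner (ext_supp h) (isLocal_ext h.loc f hlo hT) (frame_ext f hlo hT)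
    (by rwa [inner_ext h])

end KingSnake

/-! ### Recursion for the numbers of paths, and the action of the eight symmetries -/

namespace KingSnake

open Ty

instance : Fintype FrameType :=
  ⟨{.I, .II, .III, .IV, .V}, fun T => by cases T <;> decide⟩

/-- The paths whose outermost frame is of type `T`. -/
def frames (T : FrameType) (lo hi : ℤ) : Set (ℤ → ℤ → Ty) :=
  {t | IsValid lo hi t ∧ Frame T lo hi t}

/-- The second end shows in one of the corners `b`, `c`, `d` or in the block above `a`, and these
four blocks distinguish the types. -/
theorem Frame.unique {T T' : FrameType} {lo hi : ℤ} {t : ℤ → ℤ → Ty} (f : Frame T lo hi t)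
    (f' : Frame T' lo hi t) : T = T' := by
  have b := f.b.symm.trans f'.b
  have c := f.c.symm.trans f'.c
  have d := f.d.symm.trans f'.d
  have e := f.second.symm.trans f'.second
  clear f f'
  revert b c d e
  cases T <;> cases T' <;> decide

theorem injOn_ext (T : FrameType) (lo hi : ℤ) :
    Set.InjOn (ext T lo hi) {Q | IsValid (lo + 1) (hi - 1) Q} := fun Q hQ Q' hQ' e => by
  rw [← inner_ext (T := T) hQ, e, inner_ext hQ']

theorem setOf_isValid_corner {lo hi : ℤ} (hlo : lo + 2 ≤ hi) :
    {t | IsValid lo hi t ∧ t lo lo = B} = ⋃ T, frames T lo hi := by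
  ext t
  simp only [Set.mem_iUnion]
  constructor
  · rintro ⟨h, k⟩
    obtain ⟨T, f⟩ := h.exists_frame hlo k
    exact ⟨T, h, f⟩
  · rintro ⟨T, h, f⟩
    exact ⟨h, f.a⟩

theorem encard_iUnion_frames (lo hi : ℤ) :
    (⋃ T, frames T lo hi).encard = (frames .I lo hi).encard + (frames .II lo hi).encard +
      (frames .III lo hi).encard + (frames .IV lo hi).encard + (frames .V lo hi).encard := by
  have d : ∀ T T', T ≠ T' → Disjoint (frames T lo hi) (frames T' lo hi) := fun T T' hne =>
    Set.disjoint_left.2 fun t h h' => hne (h.2.unique h'.2)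
  rw [← Set.encard_union_eq (d _ _ (by decide)), ← Set.encard_union_eq, ← Set.encard_union_eq,
    ← Set.encard_union_eq]
  · congr 1
    ext t
    simp only [Set.mem_iUnion, Set.mem_union]
    constructor
    · rintro ⟨T, h⟩; cases T <;> tauto
    · rintro ((((h | h) | h) | h) | h) <;> exact ⟨_, h⟩
  all_goals
    simp only [Set.disjoint_union_left]
    simp only [d _ _ (show FrameType.I ≠ .V by decide), d _ _ (show FrameType.II ≠ .V by decide),
      d _ _ (show FrameType.III ≠ .V by decide), d _ _ (show FrameType.IV ≠ .V by decide),
      d _ _ (show FrameType.I ≠ .IV by decide), d _ _ (show FrameType.II ≠ .IV by decide),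
      d _ _ (show FrameType.III ≠ .IV by decide), d _ _ (show FrameType.I ≠ .III by decide),
      d _ _ (show FrameType.II ≠ .III by decide), and_self]

/-- Removing and adding a frame are inverse to each other, and the type is inherited in both
directions. -/
theorem encard_frames {T : FrameType} {lo hi : ℤ} (hlo : lo + 4 ≤ hi) (hT : T ≠ .I) :
    (frames T lo hi).encard = (frames T (lo + 1) (hi - 1)).encard := by
  have inj : Set.InjOn (ext T lo hi) (frames T (lo + 1) (hi - 1)) :=
    (injOn_ext T lo hi).mono fun Q hQ => hQ.1
  rw [← inj.encard_image]
  congr 1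
  ext t
  constructor
  · rintro ⟨h, f⟩
    exact ⟨inner lo hi t, ⟨h.inner (by omega), f.inner_frame h hlo hT⟩, (f.eq_ext h hlo).symm⟩
  · rintro ⟨Q, ⟨h, f⟩, rfl⟩
    exact ⟨isValid_ext h f hlo (Or.inr rfl), frame_ext f hlo (Or.inr rfl)⟩

/-- The interior of a type I frame may be any path with its start normalised, whatever its own frame
type. -/
theorem encard_frames_one {lo hi : ℤ} (hlo : lo + 4 ≤ hi) :
    (frames .I lo hi).encard = (⋃ T, frames T (lo + 1) (hi - 1)).encard := by
  have inj : Set.InjOn (ext .I lo hi) (⋃ T, frames T (lo + 1) (hi - 1)) :=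
    (injOn_ext .I lo hi).mono fun Q hQ => by
      obtain ⟨T, h, f⟩ := Set.mem_iUnion.1 hQ
      exact h
  rw [← inj.encard_image]
  congr 1
  ext t
  constructor
  · rintro ⟨h, f⟩
    rw [← setOf_isValid_corner (by omega)]
    refine ⟨inner lo hi t, ⟨h.inner (by omega), ?_⟩, (f.eq_ext h hlo).symm⟩
    rw [inner_of_mem (by unfold InSq; omega)]
    exact f.inner_corner h hlo
  · rintro ⟨Q, hQ, rfl⟩
    obtain ⟨T, h, f⟩ := Set.mem_iUnion.1 hQ
    exact ⟨isValid_ext h f hlo (Or.inl rfl), frame_ext f hlo (Or.inl rfl)⟩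

/-- The numbers of the paths with a frame of each type, for squares of a fixed parity. -/
theorem encard_frames_add {lo hi : ℤ} (hlo : lo + 2 ≤ hi) {N : FrameType → ℕ}
    (hN : ∀ T, (frames T lo hi).encard = N T) (m : ℕ) :
    (∀ T ≠ .I, (frames T (lo - m) (hi + m)).encard = N T) ∧
    (frames .I (lo - m) (hi + m)).encard =
      (N .I + m * (N .II + N .III + N .IV + N .V) : ℕ) := by
  induction m with
  | zero => simp [hN]
  | succ m ih =>
    have e1 : lo - ((m + 1 : ℕ) : ℤ) + 1 = lo - m := by push_cast; ring
    have e2 : hi + ((m + 1 : ℕ) : ℤ) - 1 = hi + m := by push_cast; ring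
    constructor
    · intro T hT
      rw [encard_frames (by omega) hT, e1, e2, ih.1 T hT]
    · rw [encard_frames_one (by omega), e1, e2, encard_iUnion_frames, ih.2,
        ih.1 _ (by decide), ih.1 _ (by decide), ih.1 _ (by decide), ih.1 _ (by decide)]
      norm_cast
      ring

/-- The number of the ends that lie in corners. -/
def cornerEnds (lo hi : ℤ) (t : ℤ → ℤ → Ty) : ℕ :=
  let e (a : Ty) : ℕ := if a.hor && a.ver then 0 else 1
  e (t lo lo) + e (t hi lo) + e (t hi hi) + e (t lo hi)

theorem cornerEnds_rotate (lo hi : ℤ) (t : ℤ → ℤ → Ty) :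
    cornerEnds lo hi (rotate (lo + hi) t) = cornerEnds lo hi t := by
  simp only [cornerEnds, rotate, hor_rot, ver_rot, add_sub_cancel_left, add_sub_cancel_right,
    Bool.and_comm (ver _)]
  ring

theorem cornerEnds_reflect (lo hi : ℤ) (t : ℤ → ℤ → Ty) :
    cornerEnds lo hi (reflect t) = cornerEnds lo hi t := by
  simp only [cornerEnds, reflect, hor_swap, ver_swap, Bool.and_comm (ver _)]
  ring

theorem cornerEnds_sym (lo hi : ℤ) (g : Fin 4 × Fin 2) (t : ℤ → ℤ → Ty) :
    cornerEnds lo hi (sym (lo + hi) g t) = cornerEnds lo hi t := by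
  obtain ⟨i, j⟩ := g
  fin_cases i <;> fin_cases j <;>
    simp [sym, Function.iterate_succ_apply, cornerEnds_rotate, cornerEnds_reflect]

theorem bijective_sym (s : ℤ) (g : Fin 4 × Fin 2) : Function.Bijective (sym s g) := by
  have h1 : Function.Bijective (rotate s) := by
    refine ⟨fun t t' e => ?_, fun t => ⟨rotate s (rotate s (rotate s t)), ?_⟩⟩
    · rw [← rotate_rotate_rotate_rotate s t, e, rotate_rotate_rotate_rotate]
    · exact rotate_rotate_rotate_rotate s t
  have h2 : Function.Bijective reflect :=
    ⟨fun t t' e => by rw [← reflect_reflect t, e, reflect_reflect],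
      fun t => ⟨reflect t, reflect_reflect t⟩⟩
  exact (h1.iterate _).comp (h2.iterate _)

/-- For each corner that is an end, exactly one symmetry moves it to the lower left with the path
starting along the bottom: one of `B`, `L` there demands a rotation, the other a rotation after a
reflection. -/
theorem IsValid.card_sym {lo hi : ℤ} {t : ℤ → ℤ → Ty} (h : IsValid lo hi t) (hlo : lo + 2 ≤ hi) :
    (Finset.univ.filter fun g => sym (lo + hi) g t lo lo = B).card = cornerEnds lo hi t := by
  simp only [Finset.card_filter, Fintype.sum_prod_type, Fin.sum_univ_four, Fin.sum_univ_two,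
    sym_corner, cornerEnds]
  have c1 := h.corner hlo
  have c2 := h.corner_lower_right hlo
  have c3 := h.corner_upper_right hlo
  have c4 := h.corner_upper_left hlo
  have d1 : t lo lo ∈ ({B, L, Z} : Finset Ty) := by
    simp only [Finset.mem_insert, Finset.mem_singleton]; tauto
  have d2 : t hi lo ∈ ({R, B, S} : Finset Ty) := by
    simp only [Finset.mem_insert, Finset.mem_singleton]; tauto
  have d3 : t hi hi ∈ ({Ty.T, R, Z} : Finset Ty) := by
    simp only [Finset.mem_insert, Finset.mem_singleton]; tauto
  have d4 : t lo hi ∈ ({L, Ty.T, S} : Finset Ty) := by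
    simp only [Finset.mem_insert, Finset.mem_singleton]; tauto
  clear c1 c2 c3 c4
  revert d1 d2 d3 d4
  generalize t lo lo = a, t hi lo = b, t hi hi = c, t lo hi = d
  intro d1 d2 d3 d4
  simp only [Finset.mem_insert, Finset.mem_singleton] at d1 d2 d3 d4
  rcases d1 with rfl | rfl | rfl <;> rcases d2 with rfl | rfl | rfl <;>
    rcases d3 with rfl | rfl | rfl <;> rcases d4 with rfl | rfl | rfl <;> rfl

theorem Frame.cornerEnds_eq {T : FrameType} {lo hi : ℤ} {t : ℤ → ℤ → Ty} (f : Frame T lo hi t) :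
    cornerEnds lo hi t = if T = .I ∨ T = .II then 1 else 2 := by
  unfold cornerEnds
  rw [f.a, f.b, f.c, f.d]
  cases T <;> decide

theorem finite_setOf_isValid {lo hi : ℤ} (hlo : lo + 2 ≤ hi)
    (hfin : ∀ T, (frames T lo hi).Finite) : {t | IsValid lo hi t}.Finite := by
  have : (⋃ g, sym (lo + hi) g ⁻¹' {t | IsValid lo hi t ∧ t lo lo = B}).Finite := by
    refine Set.finite_iUnion fun g => Set.Finite.preimage (bijective_sym _ g).1.injOn ?_
    rw [setOf_isValid_corner hlo]
    exact Set.finite_iUnion hfin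
  refine this.subset fun t h => ?_
  obtain ⟨g, hg⟩ := IsValid.exists_sym h hlo
  exact Set.mem_iUnion.2 ⟨g, (isValid_sym_iff g).2 h, hg⟩

open Classical in
/-- The paths with `m` ends in corners are, up to symmetry, those that start in the lower left
corner along the bottom side, and each of them arises from `m` symmetries. -/
theorem mul_ncard_cornerEnds {lo hi : ℤ} (hlo : lo + 2 ≤ hi)
    (hfin : {t | IsValid lo hi t}.Finite) (m : ℕ) :
    m * {t | IsValid lo hi t ∧ cornerEnds lo hi t = m}.ncard =
      8 * {t | (IsValid lo hi t ∧ cornerEnds lo hi t = m) ∧ t lo lo = B}.ncard := by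
  have hf : {t | IsValid lo hi t ∧ cornerEnds lo hi t = m}.Finite := hfin.subset fun t h => h.1
  obtain ⟨X, hX⟩ := hf.exists_finset
  have e1 : {t | IsValid lo hi t ∧ cornerEnds lo hi t = m} = (X : Set _) := by
    ext t; exact (hX t).symm
  have e2 : {t | (IsValid lo hi t ∧ cornerEnds lo hi t = m) ∧ t lo lo = B} =
      (X.filter fun t => t lo lo = B : Finset _) := by
    ext t; rw [Finset.coe_filter]; exact and_congr_left fun _ => (hX t).symm
  rw [e1, e2, Set.ncard_coe_finset, Set.ncard_coe_finset]
  have key : ∀ g, (X.filter fun t => sym (lo + hi) g t lo lo = B).card =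
      (X.filter fun t => t lo lo = B).card := by
    intro g
    have hg : ∀ t, sym (lo + hi) g t ∈ X ↔ t ∈ X := fun t => by
      rw [hX, hX]; exact and_congr (isValid_sym_iff g) (by rw [cornerEnds_sym])
    refine Finset.card_bij (fun t _ => sym (lo + hi) g t) ?_ ?_ ?_
    · intro t ht
      rw [Finset.mem_filter] at ht ⊢
      exact ⟨(hg t).2 ht.1, ht.2⟩
    · exact fun t _ t' _ e => (bijective_sym _ g).1 e
    · intro u hu
      obtain ⟨t, rfl⟩ := (bijective_sym (lo + hi) g).2 u
      rw [Finset.mem_filter] at hu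
      exact ⟨t, Finset.mem_filter.2 ⟨(hg t).1 hu.1, hu.2⟩, rfl⟩
  -- Double counting of the pairs of a path and a symmetry that normalises it.
  have count : ∑ t ∈ X, (Finset.univ.filter fun g => sym (lo + hi) g t lo lo = B).card =
      ∑ g, (X.filter fun t => sym (lo + hi) g t lo lo = B).card := by
    simp only [Finset.card_filter]
    exact Finset.sum_comm
  rw [Finset.sum_congr rfl fun t ht => by
    rw [IsValid.card_sym ((hX t).1 ht).1 hlo, ((hX t).1 ht).2]] at count
  simp only [key, Finset.sum_const, smul_eq_mul] at count
  rw [mul_comm, count]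
  rfl

/-- The number of all paths. -/
theorem ncard_setOf_isValid {lo hi : ℤ} (hlo : lo + 2 ≤ hi) {N : FrameType → ℕ}
    (hN : ∀ T, (frames T lo hi).encard = N T) :
    {t | IsValid lo hi t}.ncard = 8 * (N .I + N .II) + 4 * (N .III + N .IV + N .V) := by
  have hf : ∀ T, (frames T lo hi).Finite := fun T =>
    Set.finite_of_encard_eq_coe (hN T)
  have hn : ∀ T, (frames T lo hi).ncard = N T := fun T => by
    rw [Set.ncard_def, hN, ENat.toNat_natCast]
  have d : ∀ T T', T ≠ T' → Disjoint (frames T lo hi) (frames T' lo hi) := fun T T' hne =>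
    Set.disjoint_left.2 fun t h h' => hne (h.2.unique h'.2)
  have hfin := finite_setOf_isValid hlo hf
  -- Up to symmetry, each normalised path accounts for eight paths if one end lies in a corner, and
  -- for four on average if both do.
  have m1 := mul_ncard_cornerEnds hlo hfin 1
  have m2 := mul_ncard_cornerEnds hlo hfin 2
  have s1 : {t | (IsValid lo hi t ∧ cornerEnds lo hi t = 1) ∧ t lo lo = B} =
      frames .I lo hi ∪ frames .II lo hi := by
    ext t
    constructor
    · rintro ⟨⟨h, k⟩, k'⟩
      obtain ⟨T, f⟩ := h.exists_frame hlo k'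
      rw [f.cornerEnds_eq] at k
      cases T
      · exact Or.inl ⟨h, f⟩
      · exact Or.inr ⟨h, f⟩
      all_goals exact absurd k (by decide)
    · rintro (⟨h, f⟩ | ⟨h, f⟩) <;> exact ⟨⟨h, f.cornerEnds_eq⟩, f.a⟩
  have s2 : {t | (IsValid lo hi t ∧ cornerEnds lo hi t = 2) ∧ t lo lo = B} =
      frames .III lo hi ∪ (frames .IV lo hi ∪ frames .V lo hi) := by
    ext t
    constructor
    · rintro ⟨⟨h, k⟩, k'⟩
      obtain ⟨T, f⟩ := h.exists_frame hlo k'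
      rw [f.cornerEnds_eq] at k
      cases T
      · exact absurd k (by decide)
      · exact absurd k (by decide)
      · exact Or.inl ⟨h, f⟩
      · exact Or.inr (Or.inl ⟨h, f⟩)
      · exact Or.inr (Or.inr ⟨h, f⟩)
    · rintro (⟨h, f⟩ | ⟨h, f⟩ | ⟨h, f⟩) <;> exact ⟨⟨h, f.cornerEnds_eq⟩, f.a⟩
  have s3 : {t | IsValid lo hi t} = {t | IsValid lo hi t ∧ cornerEnds lo hi t = 1} ∪
      {t | IsValid lo hi t ∧ cornerEnds lo hi t = 2} := by
    ext t
    constructor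
    · intro h
      obtain ⟨g, hg⟩ := IsValid.exists_sym h hlo
      obtain ⟨T, f⟩ := ((isValid_sym_iff g).2 h).exists_frame hlo hg
      have k := f.cornerEnds_eq
      rw [cornerEnds_sym] at k
      cases T
      · exact Or.inl ⟨h, k⟩
      · exact Or.inl ⟨h, k⟩
      all_goals exact Or.inr ⟨h, k⟩
    · rintro (h | h) <;> exact h.1
  rw [s1, Set.ncard_union_eq (d _ _ (by decide)) (hf _) (hf _), hn, hn] at m1
  rw [s2, Set.ncard_union_eq (Set.disjoint_union_right.2 ⟨d _ _ (by decide), d _ _ (by decide)⟩)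
    (hf _) ((hf _).union (hf _)), Set.ncard_union_eq (d _ _ (by decide)) (hf _) (hf _),
    hn, hn, hn] at m2
  rw [s3, Set.ncard_union_eq (Set.disjoint_left.2 fun t h h' => by
    have := h.2.symm.trans h'.2; omega) (hfin.subset fun t h => h.1) (hfin.subset fun t h => h.1)]
  omega

/-- Moving a path. -/
theorem IsValid.shift {lo hi : ℤ} {t : ℤ → ℤ → Ty} (h : IsValid lo hi t) (a : ℤ) :
    IsValid (lo - a) (hi - a) fun x y => t (x + a) (y + a) where
  supp x y := by rw [h.supp]; unfold InSq; omega
  loc := by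
    constructor
    · intro x y; have := h.loc.h (x + a) (y + a); rwa [add_right_comm] at this
    · intro x y; have := h.loc.v (x + a) (y + a); rwa [add_right_comm y] at this
    · intro x y
      have := h.loc.d (x + a) (y + a); rwa [add_right_comm x, add_right_comm y] at this
    · intro x y
      have := h.loc.e (x + a) (y + a); rwa [add_right_comm x, add_right_comm y] at this
    · intro x y
      have := h.loc.turn (x + a) (y + a)
      rwa [add_right_comm x, add_right_comm y, ← sub_add_eq_add_sub, ← sub_add_eq_add_sub] at this
  conn A hA x y x' y' k k' hx := by
    have := h.conn (fun x y => A (x - a) (y - a))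
      ⟨fun x y h1 h2 => ?_, fun x y h1 h2 => ?_⟩ _ _ _ _ k k' (by simpa using hx)
    · simpa using this
    · have := hA.1 (x - a) (y - a) (by simpa using h1)
        (by simpa [sub_add_eq_add_sub] using h2)
      rwa [sub_add_eq_add_sub] at this
    · have := hA.2 (x - a) (y - a) (by simpa using h1)
        (by simpa [sub_add_eq_add_sub] using h2)
      rwa [sub_add_eq_add_sub y] at this

theorem ncard_setOf_isValid_shift (lo hi a : ℤ) :
    {t | IsValid (lo - a) (hi - a) t}.ncard = {t | IsValid lo hi t}.ncard := by
  have inj : Function.Injective fun (t : ℤ → ℤ → Ty) x y => t (x + a) (y + a) := by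
    intro t t' e
    funext x y
    have := congrFun (congrFun e (x - a)) (y - a)
    simpa using this
  rw [← Set.ncard_image_of_injective {t | IsValid lo hi t} inj]
  congr 1
  ext t
  constructor
  · intro h
    refine ⟨fun x y => t (x - a) (y - a), ?_, by simp⟩
    have := IsValid.shift h (-a)
    simpa [sub_eq_add_neg] using this
  · rintro ⟨t, h, rfl⟩
    exact IsValid.shift h a

end KingSnake

/-! ### A computable enumeration for small squares -/

namespace KingSnake

open Ty

/-- The conditions which a frame of type `T` of the square `[1, K]²` imposes on the block
`(a, b)`. -/
def dom (T : FrameType) (K a b : ℕ) (c : Ty) : Bool :=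
  (c ≠ E) &&
  (b != 1 || (T = .V && a == K) || c.hor) &&
  (a != K || (T = .IV && b == K) || c.ver) &&
  (b != K || (T = .III && a == 1) || c.hor) &&
  (a != 1 || b == 1 || (T = .II && b == 2) || c.ver) &&
  (a != 1 || b != 1 || c = B) &&
  (a != K || b != 1 || c = if T = .V then R else S) &&
  (a != K || b != K || c = if T = .IV then Ty.T else Z) &&
  (a != 1 || b != K || c = if T = .III then L else S) &&
  (a != 2 || b != 2 || c.hor) &&
  (a != 1 || b != 2 || c = if T = .II then B else Z) &&
  match T with
  | .I => true
  | .II => (a != 1 || b != 3 || c = Z) && (a != 2 || b != 3 || c.hor)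
  | .III => (a != 2 || b != K || c = S) && (a != 2 || b + 1 != K || c.ver)
  | .IV => (a != K || b + 1 != K || c = Z) && (a + 1 != K || b + 1 != K || c.hor)
  | .V => (a + 1 != K || b != 1 || c = S) && (a + 1 != K || b != 2 || c.ver)

/-- The block `(a, b)` of the square `[1, K]²` when `l` lists its first `n + 1` blocks in reverse
order, row by row. -/
def look (K n : ℕ) (l : List Ty) (a b : ℕ) : Ty :=
  match a, b with
  | a + 1, b + 1 => if a < K ∧ b < K then l.getD (n - (b * K + a)) E else E
  | _, _ => E

/-- The condition on a block and its four neighbours. -/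
def turnAt (g : ℕ → ℕ → Ty) (a b : ℕ) : Bool :=
  let c := g a b
  let l := (g (a - 1) b).hor
  let r := (g (a + 1) b).hor
  let d := (g a (b - 1)).ver
  let u := (g a (b + 1)).ver
  -- The second condition, that the block is not isolated, prunes the search.
  turnOK c l r d u && ((c.hor && (l || r)) || (c.ver && (d || u)))

/-- The conditions that involve the block `(a, b)` and the earlier ones. -/
def stepOK (K : ℕ) (g : ℕ → ℕ → Ty) (a b : ℕ) : Bool :=
  hOK (g (a - 1) b) (g a b) && vOK (g a (b - 1)) (g a b) && dOK (g (a - 1) (b - 1)) (g a b) &&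
  -- In the row by row order, a new block completes the neighbourhood of the block below it, in the
  -- top row also that of the block to its left, and at the very end its own.
  eOK (g a b) (g (a + 1) (b - 1)) && (b == 1 || turnAt g a (b - 1)) &&
  (b != K || a == 1 || turnAt g (a - 1) b) && (b != K || a != K || turnAt g a b)

/-- The arrangements of the first `n` blocks. -/
def enum (T : FrameType) (K : ℕ) : ℕ → List (List Ty)
  | 0 => [[]]
  | n + 1 =>
    (enum T K n).flatMap fun l =>
      (([L, R, B, Ty.T, S, Z].filter (dom T K (n % K + 1) (n / K + 1))).map (· :: l)).filter
        fun l => stepOK K (look K n l) (n % K + 1) (n / K + 1)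

/-- A computable version of `Joined`. Since coordinates count from one, truncated subtraction leads
at most to the empty row or column `0`. -/
def Adjoined (g : ℕ → ℕ → Ty) (p q : ℕ × ℕ) : Bool :=
  ((p.1 + 1 == q.1 || q.1 + 1 == p.1) && p.2 == q.2 && (g p.1 p.2).hor && (g q.1 q.2).hor) ||
  ((p.2 + 1 == q.2 || q.2 + 1 == p.2) && p.1 == q.1 && (g p.1 p.2).ver && (g q.1 q.2).ver)

/-- The arguments are the remaining number of steps, the previous block and the current block. The
walk does not turn back, so where degrees are at most two it is forced. -/
def trace (g : ℕ → ℕ → Ty) : ℕ → ℕ × ℕ → ℕ × ℕ → List (ℕ × ℕ)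
  | 0, _, q => [q]
  | n + 1, p, q =>
    q :: match [(q.1 - 1, q.2), (q.1 + 1, q.2), (q.1, q.2 - 1), (q.1, q.2 + 1)].find?
        fun r => r != p && Adjoined g q r with
      | none => []
      | some r => trace g n q r

def cells (K : ℕ) : List (ℕ × ℕ) :=
  (List.range K).flatMap fun b => (List.range K).map fun a => (a + 1, b + 1)

def isClosed (g : ℕ → ℕ → Ty) (l : List (ℕ × ℕ)) : Bool :=
  l.all fun q => [(q.1 - 1, q.2), (q.1 + 1, q.2), (q.1, q.2 - 1), (q.1, q.2 + 1)].all
    fun r => !Adjoined g q r || l.contains r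

def localAt (g : ℕ → ℕ → Ty) (a b : ℕ) : Bool :=
  hOK (g a b) (g (a + 1) b) && vOK (g a b) (g a (b + 1)) && dOK (g a b) (g (a + 1) (b + 1)) &&
  eOK (g a b) (g (a + 1) (b - 1)) && turnAt g a b

/-- Whether the walk from the lower left corner visits all blocks. -/
def visitsAll (K : ℕ) (g : ℕ → ℕ → Ty) : Bool :=
  (cells K).all fun p => (trace g (K * K) (0, 0) (1, 1)).contains p

/-- The number of the paths among the given arrangements, provided that the conditions which can be
computed decide which of them are paths. -/
def tally (T : FrameType) (K : ℕ) : List (List Ty) → Option ℕ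
  | [] => some 0
  | l :: ls =>
    let g := look K (K * K - 1) l
    if visitsAll K g then
      if (cells K).all fun p => localAt g p.1 p.2 && dom T K p.1 p.2 (g p.1 p.2) then
        (tally T K ls).map (· + 1)
      else none
    else if isClosed g (trace g (K * K) (0, 0) (1, 1)) then tally T K ls else none

end KingSnake

/-! ### Completeness of the enumeration -/

namespace KingSnake

open Ty

/-- The blocks with coordinates counted from one. -/
def grid (t : ℤ → ℤ → Ty) (a b : ℕ) : Ty := t (a - 1) (b - 1)

theorem grid_succ_succ (t : ℤ → ℤ → Ty) (a b : ℕ) : grid t (a + 1) (b + 1) = t a b := by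
  simp [grid]

theorem grid_succ (t : ℤ → ℤ → Ty) (a b : ℕ) : grid t (a + 1) b = t a (b - 1) := by
  simp [grid]

theorem grid_succ' (t : ℤ → ℤ → Ty) (a b : ℕ) : grid t a (b + 1) = t (a - 1) b := by
  simp [grid]

/-- The first `n` blocks in reverse order. -/
def code (K : ℕ) (t : ℤ → ℤ → Ty) : ℕ → List Ty
  | 0 => []
  | n + 1 => grid t (n % K + 1) (n / K + 1) :: code K t n

theorem length_code (K : ℕ) (t : ℤ → ℤ → Ty) (n : ℕ) : (code K t n).length = n := by
  induction n with
  | zero => rfl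
  | succ n ih => simp [code, ih]

theorem getD_code (K : ℕ) (t : ℤ → ℤ → Ty) {m n : ℕ} (h : m ≤ n) :
    (code K t (n + 1)).getD (n - m) E = grid t (m % K + 1) (m / K + 1) := by
  induction n, h using Nat.le_induction with
  | base => simp [code]
  | succ n hn ih =>
    rw [code, show n + 1 - m = n - m + 1 by omega, List.getD_cons_succ, ih]

theorem look_eq_E {K n : ℕ} {l : List Ty} {a b : ℕ} (h : a = 0 ∨ b = 0 ∨ K < a ∨ K < b) :
    look K n l a b = E := by
  unfold look
  split
  · rw [if_neg (by omega)]
  · rfl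

theorem look_succ_succ {K n : ℕ} {l : List Ty} {a b : ℕ} (ha : a < K) (hb : b < K) :
    look K n l (a + 1) (b + 1) = l.getD (n - (b * K + a)) E :=
  if_pos ⟨ha, hb⟩

/-- Blocks of the square that have not been placed yet must be excluded: for them the truncated
index would return the newest block. -/
theorem look_code {K n : ℕ} {t : ℤ → ℤ → Ty} (ht : ∀ x y, ¬InSq 0 (K - 1) x y → t x y = E)
    {a b : ℕ} (h : a = 0 ∨ b = 0 ∨ K < a ∨ K < b ∨ (b - 1) * K + (a - 1) ≤ n) :
    look K n (code K t (n + 1)) a b = grid t a b := by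
  by_cases h' : a = 0 ∨ b = 0 ∨ K < a ∨ K < b
  · rw [look_eq_E h', grid, ht _ _ (by unfold InSq; omega)]
  · obtain ⟨a, rfl⟩ : ∃ a', a = a' + 1 := ⟨a - 1, by omega⟩
    obtain ⟨b, rfl⟩ : ∃ b', b = b' + 1 := ⟨b - 1, by omega⟩
    have hm : b * K + a ≤ n := by
      rcases h with h | h | h | h | h
      any_goals omega
      simpa using h
    rw [look_succ_succ (by omega) (by omega), getD_code K t hm, add_comm (b * K),
      Nat.add_mul_mod_self_right, Nat.mod_eq_of_lt (by omega), Nat.add_mul_div_right _ _ (by omega),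
      Nat.div_eq_of_lt (by omega), zero_add]

/-- An isolated block would be a whole component. -/
theorem IsValid.deg_pos {lo hi : ℤ} {t : ℤ → ℤ → Ty} (h : IsValid lo hi t) (hlo : lo + 1 ≤ hi)
    {x y : ℤ} (m : InSq lo hi x y) :
    ((t x y).hor && ((t (x - 1) y).hor || (t (x + 1) y).hor)) ||
      ((t x y).ver && ((t x (y - 1)).ver || (t x (y + 1)).ver)) := by
  by_contra k
  simp only [Bool.or_eq_true, Bool.and_eq_true, not_or, not_and_or] at k
  obtain ⟨x', y', m', hne⟩ : ∃ x' y', InSq lo hi x' y' ∧ ¬(x' = x ∧ y' = y) := by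
    unfold InSq at *
    by_cases e : x = lo
    · exact ⟨hi, y, by omega, by omega⟩
    · exact ⟨lo, y, by omega, by omega⟩
  refine h.not_closed (A := fun a b => a = x ∧ b = y) ⟨fun a b h1 h2 => ?_, fun a b h1 h2 => ?_⟩
    m m' ⟨rfl, rfl⟩ hne
  · constructor
    · rintro ⟨rfl, rfl⟩; tauto
    · rintro ⟨rfl, rfl⟩
      rw [add_sub_cancel_right] at k
      tauto
  · constructor
    · rintro ⟨rfl, rfl⟩; tauto
    · rintro ⟨rfl, rfl⟩
      rw [add_sub_cancel_right] at k
      tauto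

section

variable {K : ℕ} {T : FrameType} {t : ℤ → ℤ → Ty}

theorem IsValid.turnAt_grid (h : IsValid 0 (K - 1) t) (hK : 2 ≤ K) {a b : ℕ} (ha : a < K)
    (hb : b < K) : turnAt (grid t) (a + 1) (b + 1) := by
  have h1 := h.loc.turn a b
  have h2 := h.deg_pos (by omega) (x := a) (y := b) (by unfold InSq; omega)
  simp only [turnAt, Nat.add_sub_cancel, grid_succ, grid_succ', Nat.cast_add, Nat.cast_one,
    add_sub_cancel_right]
  rw [h1, h2]; rfl

theorem IsValid.stepOK (h : IsValid 0 (K - 1) t) (hK : 2 ≤ K) {g : ℕ → ℕ → Ty} {a b : ℕ}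
    (ha : a < K) (hb : b < K)
    (hg : ∀ a' b', a' = 0 ∨ b' = 0 ∨ K < a' ∨ K < b' ∨ b' ≤ b ∨ (b' = b + 1 ∧ a' ≤ a + 1) →
      g a' b' = grid t a' b') : KingSnake.stepOK K g (a + 1) (b + 1) := by
  have e1 : ((a + 1 : ℕ) : ℤ) = a + 1 := by push_cast; rfl
  have c1 := h.loc.h (a - 1) b
  have c2 := h.loc.v a (b - 1)
  have c3 := h.loc.d (a - 1) (b - 1)
  have c4 := h.loc.e a (b - 1)
  rw [sub_add_cancel] at c1 c2 c3 c4
  rw [sub_add_cancel] at c3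
  have f1 : b + 1 = 1 ∨ turnAt g (a + 1) b := by
    by_cases e : b = 0
    · left; omega
    · right
      obtain ⟨b', rfl⟩ : ∃ b', b = b' + 1 := ⟨b - 1, by omega⟩
      have := h.turnAt_grid hK ha (b := b') (by omega)
      rw [← this, turnAt, turnAt, hg _ _ (by omega), hg _ _ (by omega), hg _ _ (by omega),
        hg _ _ (by omega), hg _ _ (by omega)]
  have f2 : b + 1 ≠ K ∨ a + 1 = 1 ∨ turnAt g a (b + 1) := by
    by_cases e : b + 1 = K
    · right
      by_cases e' : a = 0
      · left; omega
      · right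
        obtain ⟨a', rfl⟩ : ∃ a', a = a' + 1 := ⟨a - 1, by omega⟩
        have := h.turnAt_grid hK (a := a') (by omega) hb
        rw [← this, turnAt, turnAt, hg _ _ (by omega), hg _ _ (by omega), hg _ _ (by omega),
          hg _ _ (by omega), hg _ _ (by omega)]
    · exact Or.inl e
  have f3 : (b + 1 ≠ K ∨ a + 1 ≠ K) ∨ turnAt g (a + 1) (b + 1) := by
    by_cases e : b + 1 = K ∧ a + 1 = K
    · right
      have := h.turnAt_grid hK ha hb
      rw [← this, turnAt, turnAt, hg _ _ (by omega), hg _ _ (by omega), hg _ _ (by omega),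
        hg _ _ (by omega), hg _ _ (by omega)]
    · left; omega
  simp only [KingSnake.stepOK, Bool.and_eq_true, Bool.or_eq_true, beq_iff_eq, bne_iff_ne,
    Nat.add_sub_cancel]
  refine ⟨⟨⟨⟨⟨⟨?_, ?_⟩, ?_⟩, ?_⟩, f1⟩, ?_⟩, f3⟩
  · rwa [hg _ _ (by omega), hg _ _ (by omega), grid_succ_succ, grid_succ']
  · rwa [hg _ _ (by omega), hg _ _ (by omega), grid_succ_succ, grid_succ]
  · rwa [hg _ _ (by omega), hg _ _ (by omega), grid_succ_succ, grid]
  · rwa [hg _ _ (by omega), hg _ _ (by omega), grid_succ_succ, grid_succ, e1]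
  · rwa [or_assoc]

theorem Frame.dom (f : Frame T 0 (K - 1) t) (ht : ∀ x y, InSq 0 (K - 1) x y → t x y ≠ E)
    {a b : ℕ} (ha : a < K) (hb : b < K) :
    dom T K (a + 1) (b + 1) (grid t (a + 1) (b + 1)) := by
  have hs := f.size
  have p0 := ht a b (by unfold InSq; omega)
  have p1 := f.bottom a
  have p2 := f.right b
  have p3 := f.top a
  have p4 := f.left b
  have pa := f.a
  have pb := f.b
  have pc := f.c
  have pd := f.d
  have pe := f.entry
  have ps := f.second
  have q2 := f.two
  have q3 := f.three
  have q4 := f.four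
  have q5 := f.five
  have key : ∀ (x y : ℤ) {P : Ty → Prop}, P (t x y) → x = a → y = b → P (t a b) := by
    rintro x y P h rfl rfl; exact h
  rw [grid_succ_succ]
  simp only [KingSnake.dom, Bool.and_eq_true, Bool.or_eq_true, beq_iff_eq, bne_iff_ne,
    decide_eq_true_eq]
  refine ⟨⟨⟨⟨⟨⟨⟨⟨⟨⟨⟨p0, ?_⟩, ?_⟩, ?_⟩, ?_⟩, ?_⟩, ?_⟩, ?_⟩, ?_⟩, ?_⟩, ?_⟩, ?_⟩
  · rw [or_iff_not_imp_left]; intro k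
    have : T = .V → a ≠ K - 1 := fun e e' => k (Or.inr ⟨e, by omega⟩)
    exact key a 0 (P := fun c => c.hor)
        (p1 (by omega) (by omega) fun e => by have := this e; omega) rfl (by omega)
  · rw [or_iff_not_imp_left]; intro k
    have : T = .IV → b ≠ K - 1 := fun e e' => k (Or.inr ⟨e, by omega⟩)
    exact key (K - 1) b (P := fun c => c.ver)
        (p2 (by omega) (by omega) fun e => by have := this e; omega) (by omega) rfl
  · rw [or_iff_not_imp_left]; intro k
    have : T = .III → a ≠ 0 := fun e e' => k (Or.inr ⟨e, by omega⟩)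
    exact key a (K - 1) (P := fun c => c.hor)
        (p3 (by omega) (by omega) fun e => by have := this e; omega) rfl (by omega)
  · rw [or_iff_not_imp_left]; intro k
    have : T = .II → b ≠ 1 := fun e e' => k (Or.inr ⟨e, by omega⟩)
    exact key 0 b (P := fun c => c.ver)
        (p4 (by omega) (by omega) fun e => by have := this e; omega) (by omega) rfl
  · rw [or_iff_not_imp_left]; intro k
    exact key 0 0 (P := (· = B)) pa (by omega) (by omega)
  · rw [or_iff_not_imp_left]; intro k
    exact key (K - 1) 0 (P := (· = _)) pb (by omega) (by omega)
  · rw [or_iff_not_imp_left]; intro k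
    exact key (K - 1) (K - 1) (P := (· = _)) pc (by omega) (by omega)
  · rw [or_iff_not_imp_left]; intro k
    exact key 0 (K - 1) (P := (· = _)) pd (by omega) (by omega)
  · rw [or_iff_not_imp_left]; intro k
    exact key (0 + 1) (0 + 1) (P := fun c => c.hor) pe (by omega) (by omega)
  · rw [or_iff_not_imp_left]; intro k
    exact key 0 (0 + 1) (P := (· = _)) ps (by omega) (by omega)
  · cases T
    · rfl
    · obtain ⟨-, r1, r2⟩ := q2 rfl
      simp only [Bool.and_eq_true, Bool.or_eq_true, bne_iff_ne, decide_eq_true_eq]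
      constructor <;> rw [or_iff_not_imp_left] <;> intro k
      · exact key 0 (0 + 2) (P := (· = _)) r1 (by omega) (by omega)
      · exact key (0 + 1) (0 + 2) (P := fun c => c.hor) r2 (by omega) (by omega)
    · obtain ⟨r1, r2⟩ := q3 rfl
      simp only [Bool.and_eq_true, Bool.or_eq_true, bne_iff_ne, decide_eq_true_eq]
      constructor <;> rw [or_iff_not_imp_left] <;> intro k
      · exact key (0 + 1) (K - 1) (P := (· = _)) r1 (by omega) (by omega)
      · exact key (0 + 1) (K - 1 - 1) (P := fun c => c.ver) r2 (by omega) (by omega)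
    · obtain ⟨r1, r2⟩ := q4 rfl
      simp only [Bool.and_eq_true, Bool.or_eq_true, bne_iff_ne, decide_eq_true_eq]
      constructor <;> rw [or_iff_not_imp_left] <;> intro k
      · exact key (K - 1) (K - 1 - 1) (P := (· = _)) r1 (by omega) (by omega)
      · exact key (K - 1 - 1) (K - 1 - 1) (P := fun c => c.hor) r2 (by omega) (by omega)
    · obtain ⟨r1, r2⟩ := q5 rfl
      simp only [Bool.and_eq_true, Bool.or_eq_true, bne_iff_ne, decide_eq_true_eq]
      constructor <;> rw [or_iff_not_imp_left] <;> intro k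
      · exact key (K - 1 - 1) 0 (P := (· = _)) r1 (by omega) (by omega)
      · exact key (K - 1 - 1) (0 + 1) (P := fun c => c.ver) r2 (by omega) (by omega)

/-- The hypothesis `hII` supplies the size condition in `Frame.two`, which `dom` does not test. -/
theorem frame_of_dom (hK : 3 ≤ K) (hII : T = .II → 4 ≤ K)
    (h : ∀ a b, a < K → b < K → dom T K (a + 1) (b + 1) (grid t (a + 1) (b + 1))) :
    Frame T 0 (K - 1) t := by
  simp only [grid_succ_succ, dom, Bool.and_eq_true, Bool.or_eq_true, beq_iff_eq, bne_iff_ne,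
    decide_eq_true_eq] at h
  have key : ∀ {x y : ℤ}, 0 ≤ x → x ≤ K - 1 → 0 ≤ y → y ≤ K - 1 →
    ∃ a b : ℕ, x = a ∧ y = b ∧ a < K ∧ b < K := fun {x y} h1 h2 h3 h4 =>
    ⟨x.toNat, y.toNat, by omega, by omega, by omega, by omega⟩
  refine ⟨by omega, ?_, ?_, ?_, ?_, ?_, ?_, ?_, ?_, ?_, ?_, ?_, ?_, ?_, ?_⟩
  · intro x h1 h2 h3
    obtain ⟨a, b, e1, e2, ha, hb⟩ := key h1 h2 le_rfl (by omega)
    obtain ⟨⟨⟨⟨⟨⟨⟨⟨⟨⟨⟨-, p⟩, -⟩, -⟩, -⟩, -⟩, -⟩, -⟩, -⟩, -⟩, -⟩, -⟩ := h a b ha hb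
    rw [e1, e2]
    refine p.resolve_left ?_
    rintro (k | ⟨k, k'⟩)
    · omega
    · have := h3 k; omega
  · intro y h1 h2 h3
    obtain ⟨a, b, e1, e2, ha, hb⟩ := key (x := K - 1) (by omega) (by omega) h1 h2
    obtain ⟨⟨⟨⟨⟨⟨⟨⟨⟨⟨⟨-, -⟩, p⟩, -⟩, -⟩, -⟩, -⟩, -⟩, -⟩, -⟩, -⟩, -⟩ := h a b ha hb
    rw [e1, e2]
    refine p.resolve_left ?_
    rintro (k | ⟨k, k'⟩)
    · omega
    · have := h3 k; omega
  · intro x h1 h2 h3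
    obtain ⟨a, b, e1, e2, ha, hb⟩ := key (y := K - 1) h1 h2 (by omega) (by omega)
    obtain ⟨⟨⟨⟨⟨⟨⟨⟨⟨⟨⟨-, -⟩, -⟩, p⟩, -⟩, -⟩, -⟩, -⟩, -⟩, -⟩, -⟩, -⟩ := h a b ha hb
    rw [e1, e2]
    refine p.resolve_left ?_
    rintro (k | ⟨k, k'⟩)
    · omega
    · have := h3 k; omega
  · intro y h1 h2 h3
    obtain ⟨a, b, e1, e2, ha, hb⟩ := key (x := 0) (y := y) le_rfl (by omega) (by omega) h2
    obtain ⟨⟨⟨⟨⟨⟨⟨⟨⟨⟨⟨-, -⟩, -⟩, -⟩, p⟩, -⟩, -⟩, -⟩, -⟩, -⟩, -⟩, -⟩ := h a b ha hb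
    rw [e1, e2]
    refine p.resolve_left ?_
    rintro ((k | k) | ⟨k, k'⟩)
    · omega
    · omega
    · have := h3 k; omega
  · obtain ⟨a, b, e1, e2, ha, hb⟩ := key (x := 0) (y := 0) le_rfl (by omega) (by omega) (by omega)
    obtain ⟨⟨⟨⟨⟨⟨⟨⟨⟨⟨⟨-, -⟩, -⟩, -⟩, -⟩, p⟩, -⟩, -⟩, -⟩, -⟩, -⟩, -⟩ := h a b ha hb
    rw [show t 0 0 = t a b by rw [← e1, ← e2]]
    exact p.resolve_left (by omega)
  · obtain ⟨a, b, e1, e2, ha, hb⟩ :=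
      key (x := K - 1) (y := 0) (by omega) (by omega) (by omega) (by omega)
    obtain ⟨⟨⟨⟨⟨⟨⟨⟨⟨⟨⟨-, -⟩, -⟩, -⟩, -⟩, -⟩, p⟩, -⟩, -⟩, -⟩, -⟩, -⟩ := h a b ha hb
    rw [show t (K - 1) 0 = t a b by rw [← e1, ← e2]]
    exact p.resolve_left (by omega)
  · obtain ⟨a, b, e1, e2, ha, hb⟩ :=
      key (x := K - 1) (y := K - 1) (by omega) (by omega) (by omega) (by omega)
    obtain ⟨⟨⟨⟨⟨⟨⟨⟨⟨⟨⟨-, -⟩, -⟩, -⟩, -⟩, -⟩, -⟩, p⟩, -⟩, -⟩, -⟩, -⟩ := h a b ha hb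
    rw [show t (K - 1) (K - 1) = t a b by rw [← e1, ← e2]]
    exact p.resolve_left (by omega)
  · obtain ⟨a, b, e1, e2, ha, hb⟩ :=
      key (x := 0) (y := K - 1) (by omega) (by omega) (by omega) (by omega)
    obtain ⟨⟨⟨⟨⟨⟨⟨⟨⟨⟨⟨-, -⟩, -⟩, -⟩, -⟩, -⟩, -⟩, -⟩, p⟩, -⟩, -⟩, -⟩ := h a b ha hb
    rw [show t 0 (K - 1) = t a b by rw [← e1, ← e2]]
    exact p.resolve_left (by omega)
  · obtain ⟨a, b, e1, e2, ha, hb⟩ :=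
      key (x := 0 + 1) (y := 0 + 1) (by omega) (by omega) (by omega) (by omega)
    obtain ⟨⟨⟨⟨⟨⟨⟨⟨⟨⟨⟨-, -⟩, -⟩, -⟩, -⟩, -⟩, -⟩, -⟩, -⟩, p⟩, -⟩, -⟩ := h a b ha hb
    rw [show t (0 + 1) (0 + 1) = t a b by rw [← e1, ← e2]]
    exact p.resolve_left (by omega)
  · obtain ⟨a, b, e1, e2, ha, hb⟩ :=
      key (x := 0) (y := 0 + 1) (by omega) (by omega) (by omega) (by omega)
    obtain ⟨⟨⟨⟨⟨⟨⟨⟨⟨⟨⟨-, -⟩, -⟩, -⟩, -⟩, -⟩, -⟩, -⟩, -⟩, -⟩, p⟩, -⟩ := h a b ha hb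
    rw [show t 0 (0 + 1) = t a b by rw [← e1, ← e2]]
    exact p.resolve_left (by omega)
  · rintro rfl
    have := hII rfl
    simp only [Bool.and_eq_true, Bool.or_eq_true, bne_iff_ne, decide_eq_true_eq] at h
    refine ⟨by omega, ?_, ?_⟩
    · have := ((h 0 2 (by omega) (by omega)).2.1).resolve_left (by omega)
      simpa using this
    · have := ((h 1 2 (by omega) (by omega)).2.2).resolve_left (by omega)
      simpa using this
  · rintro rfl
    simp only [Bool.and_eq_true, Bool.or_eq_true, bne_iff_ne, decide_eq_true_eq] at h
    refine ⟨?_, ?_⟩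
    · have := ((h 1 (K - 1) (by omega) (by omega)).2.1).resolve_left (by omega)
      simpa [Nat.cast_sub (show 1 ≤ K by omega)] using this
    · have := ((h 1 (K - 2) (by omega) (by omega)).2.2).resolve_left (by omega)
      simpa [Nat.cast_sub (show 2 ≤ K by omega), sub_sub, one_add_one_eq_two] using this
  · rintro rfl
    simp only [Bool.and_eq_true, Bool.or_eq_true, bne_iff_ne, decide_eq_true_eq] at h
    refine ⟨?_, ?_⟩
    · have := ((h (K - 1) (K - 2) (by omega) (by omega)).2.1).resolve_left (by omega)
      simpa [Nat.cast_sub (show 1 ≤ K by omega), Nat.cast_sub (show 2 ≤ K by omega), sub_sub,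
        one_add_one_eq_two] using this
    · have := ((h (K - 2) (K - 2) (by omega) (by omega)).2.2).resolve_left (by omega)
      simpa [Nat.cast_sub (show 2 ≤ K by omega), sub_sub, one_add_one_eq_two] using this
  · rintro rfl
    simp only [Bool.and_eq_true, Bool.or_eq_true, bne_iff_ne, decide_eq_true_eq] at h
    refine ⟨?_, ?_⟩
    · have := ((h (K - 2) 0 (by omega) (by omega)).2.1).resolve_left (by omega)
      simpa [Nat.cast_sub (show 2 ≤ K by omega), sub_sub, one_add_one_eq_two] using this
    · have := ((h (K - 2) 1 (by omega) (by omega)).2.2).resolve_left (by omega)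
      simpa [Nat.cast_sub (show 2 ≤ K by omega), sub_sub, one_add_one_eq_two] using this

/-- The blocks of a path occur among the arrangements. -/
theorem code_mem_enum (hK : 2 ≤ K) (h : IsValid 0 (K - 1) t) (f : Frame T 0 (K - 1) t) (n : ℕ)
    (hn : n ≤ K * K) : code K t n ∈ enum T K n := by
  induction n with
  | zero => simp [code, enum]
  | succ n ih =>
    have ha : n % K < K := Nat.mod_lt _ (by omega)
    have hb : n / K < K := Nat.div_lt_of_lt_mul (by omega)
    have hd := f.dom (fun x y => (h.supp x y).2) ha hb
    have hE : grid t (n % K + 1) (n / K + 1) ∈ [L, R, B, Ty.T, S, Z] := by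
      have : grid t (n % K + 1) (n / K + 1) ≠ E := by
        rw [grid_succ_succ]
        exact (h.supp _ _).2 (by
          generalize n % K = a at *; generalize n / K = b at *; unfold InSq; omega)
      revert this
      generalize grid t (n % K + 1) (n / K + 1) = c
      revert c; decide
    rw [enum, List.mem_flatMap]
    refine ⟨_, ih (by omega), ?_⟩
    rw [List.mem_filter, List.mem_map]
    refine ⟨⟨_, List.mem_filter.2 ⟨hE, hd⟩, rfl⟩, ?_⟩
    refine h.stepOK hK ha hb fun a b hab => look_code (fun x y => h.eq_E) ?_
    have := Nat.div_add_mod' n K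
    rcases hab with h | h | h | h | h | ⟨rfl, h⟩
    · omega
    · omega
    · omega
    · omega
    · by_cases h' : a = 0 ∨ b = 0 ∨ K < a
      · omega
      · have : (b - 1 + 1) * K ≤ n / K * K := Nat.mul_le_mul_right _ (by omega)
        rw [add_mul] at this
        omega
    · rw [Nat.add_sub_cancel]; omega

theorem nodup_enum (T : FrameType) (K n : ℕ) : (enum T K n).Nodup := by
  induction n with
  | zero => simp [enum]
  | succ n ih =>
    rw [enum, List.nodup_flatMap]
    refine ⟨fun l _ => List.Nodup.filter _ (List.Nodup.map (fun a b e => (List.cons.inj e).1)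
      (List.Nodup.filter _ (by decide))), ?_⟩
    refine ih.imp fun {l l'} hne m h1 h2 => ?_
    obtain ⟨c, -, e1⟩ := List.mem_map.1 (List.mem_filter.1 h1).1
    obtain ⟨c', -, e2⟩ := List.mem_map.1 (List.mem_filter.1 h2).1
    rw [← e2] at e1
    exact hne (List.cons.inj e1).2

theorem length_of_mem_enum {n : ℕ} {l : List Ty} (h : l ∈ enum T K n) : l.length = n := by
  induction n generalizing l with
  | zero => simpa [enum] using h
  | succ n ih =>
    rw [enum, List.mem_flatMap] at h
    obtain ⟨l', h', h⟩ := h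
    obtain ⟨c, -, rfl⟩ := List.mem_map.1 (List.mem_filter.1 h).1
    simp [ih h']

end

end KingSnake

/-! ### Correctness of the tally, and the initial values of the count -/

namespace KingSnake

open Ty

/-- The arrangement with a given list of blocks. -/
def ofCode (K : ℕ) (l : List Ty) : ℤ → ℤ → Ty := fun x y =>
  look K (K * K - 1) l (x + 1).toNat (y + 1).toNat

theorem grid_ofCode (K : ℕ) (l : List Ty) : grid (ofCode K l) = look K (K * K - 1) l := by
  funext a b
  simp [grid, ofCode]

theorem code_ofCode {K : ℕ} {l : List Ty} (hK : 0 < K) (hl : l.length = K * K) :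
    code K (ofCode K l) (K * K) = l := by
  obtain ⟨N, hN⟩ : ∃ N, K * K = N + 1 := ⟨K * K - 1, by have := Nat.mul_pos hK hK; omega⟩
  refine List.ext_getElem (by rw [length_code, hl]) fun i h1 h2 => ?_
  rw [hl] at h2
  have hm : N - i < K * K := by omega
  rw [← List.getD_eq_getElem _ E, ← List.getD_eq_getElem _ E, hN,
    show i = N - (N - i) by omega, getD_code _ _ (by omega), grid_ofCode,
    look_succ_succ (Nat.mod_lt _ hK) (Nat.div_lt_of_lt_mul hm), Nat.div_add_mod', hN,
    Nat.add_sub_cancel]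

section

variable {K : ℕ} {T : FrameType} {t : ℤ → ℤ → Ty}

theorem look_code_eq_grid (hK : 0 < K) (ht : ∀ x y, ¬InSq 0 (K - 1) x y → t x y = E) :
    look K (K * K - 1) (code K t (K * K)) = grid t := by
  obtain ⟨N, hN⟩ : ∃ N, K * K = N + 1 := ⟨K * K - 1, by have := Nat.mul_pos hK hK; omega⟩
  funext a b
  rw [hN, Nat.add_sub_cancel]
  refine look_code ht ?_
  by_contra h
  have h' : (b - 1 + 1) * K ≤ K * K := Nat.mul_le_mul_right _ (by omega)
  rw [add_mul] at h'
  omega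

theorem injOn_code (hK : 0 < K) :
    Set.InjOn (fun t => code K t (K * K)) {t | IsValid 0 (K - 1) t} := by
  intro t h t' h' e
  have key := (look_code_eq_grid hK fun x y => h.eq_E).symm.trans
    ((congrArg (look K (K * K - 1)) e).trans (look_code_eq_grid hK fun x y => h'.eq_E))
  funext x y
  by_cases m : InSq 0 (K - 1) x y
  · have := congrFun (congrFun key (x.toNat + 1)) (y.toNat + 1)
    rw [grid_succ_succ, grid_succ_succ] at this
    unfold InSq at m
    rwa [Int.toNat_of_nonneg m.1.1, Int.toNat_of_nonneg m.2.1] at this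
  · rw [h.eq_E m, h'.eq_E m]

theorem isLocal_of_grid (ht : ∀ x y, ¬InSq 0 (K - 1) x y → t x y = E)
    (h : ∀ a b, a < K → b < K → localAt (grid t) (a + 1) (b + 1)) : IsLocal t := by
  have key : ∀ x y, InSq 0 (K - 1) x y → (hOK (t x y) (t (x + 1) y) ∧ vOK (t x y) (t x (y + 1)) ∧
      dOK (t x y) (t (x + 1) (y + 1)) ∧ eOK (t x y) (t (x + 1) (y - 1))) ∧
      turnOK (t x y) (t (x - 1) y).hor (t (x + 1) y).hor (t x (y - 1)).ver
        (t x (y + 1)).ver := by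
    intro x y m
    unfold InSq at m
    have := h x.toNat y.toNat (by omega) (by omega)
    simp only [localAt, turnAt, Nat.add_sub_cancel, grid_succ, grid_succ', Nat.cast_add,
      Nat.cast_one, add_sub_cancel_right, Int.toNat_of_nonneg m.1.1, Int.toNat_of_nonneg m.2.1,
      Bool.and_eq_true] at this
    tauto
  have aux : ∀ a : Ty, hOK E a ∧ vOK E a ∧ dOK E a ∧ eOK E a ∧ eOK a E := by decide
  refine ⟨fun x y => ?_, fun x y => ?_, fun x y => ?_, fun x y => ?_, fun x y => ?_⟩
  · by_cases m : InSq 0 (K - 1) x y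
    · exact (key x y m).1.1
    · rw [ht x y m]; exact (aux _).1
  · by_cases m : InSq 0 (K - 1) x y
    · exact (key x y m).1.2.1
    · rw [ht x y m]; exact (aux _).2.1
  · by_cases m : InSq 0 (K - 1) x y
    · exact (key x y m).1.2.2.1
    · rw [ht x y m]; exact (aux _).2.2.1
  -- This condition is read off at the upper of the two blocks, whereas `IsLocal.e` is indexed by
  -- the row below.
  · by_cases m : InSq 0 (K - 1) x (y + 1)
    · have := (key x (y + 1) m).1.2.2.2
      rwa [add_sub_cancel_right] at this
    · rw [ht _ _ m]; exact (aux _).2.2.2.1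
  · by_cases m : InSq 0 (K - 1) x y
    · exact (key x y m).2
    · rw [ht x y m]; rfl

/-- Each step of the walk follows a join, so a predicate invariant under joins is constant along it.
-/
theorem trace_iff {g : ℕ → ℕ → Ty} {A : ℕ × ℕ → Prop} (hA : ∀ p q, Adjoined g p q → (A p ↔ A q))
    (n : ℕ) (p q : ℕ × ℕ) : ∀ c ∈ trace g n p q, A c ↔ A q := by
  induction n generalizing p q with
  | zero => simp [trace]
  | succ n ih =>
    intro c hc
    rw [trace, List.mem_cons] at hc
    rcases hc with rfl | hc
    · rfl
    · split at hc
      · simp at hc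
      · next r hr =>
        have := List.find?_some hr
        rw [Bool.and_eq_true] at this
        rw [ih _ _ c hc, hA q r this.2]

theorem Closed.adjoined {A : ℤ → ℤ → Prop} (hA : Closed t A) {p q : ℕ × ℕ}
    (h : Adjoined (grid t) p q) : A (p.1 - 1) (p.2 - 1) ↔ A (q.1 - 1) (q.2 - 1) := by
  obtain ⟨a, b⟩ := p
  obtain ⟨c, d⟩ := q
  simp only [Adjoined, grid, Bool.or_eq_true, Bool.and_eq_true, beq_iff_eq] at h
  rcases h with ⟨⟨⟨rfl | rfl, rfl⟩, h1⟩, h2⟩ | ⟨⟨⟨rfl | rfl, rfl⟩, h1⟩, h2⟩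
  · have := hA.1 (a - 1) (b - 1) h1 (by push_cast at h2; rwa [sub_add_eq_add_sub])
    push_cast
    rwa [sub_add_eq_add_sub] at this
  · have := hA.1 (c - 1) (b - 1) h2 (by push_cast at h1; rwa [sub_add_eq_add_sub])
    push_cast
    rw [sub_add_eq_add_sub] at this
    exact this.symm
  · have := hA.2 (a - 1) (b - 1) h1 (by push_cast at h2; rwa [sub_add_eq_add_sub (b : ℤ)])
    push_cast
    rwa [sub_add_eq_add_sub (b : ℤ)] at this
  · have := hA.2 (a - 1) (d - 1) h2 (by push_cast at h1; rwa [sub_add_eq_add_sub (d : ℤ)])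
    push_cast
    rw [sub_add_eq_add_sub (d : ℤ)] at this
    exact this.symm

theorem mem_cells {p : ℕ × ℕ} : p ∈ cells K ↔ ∃ a b, a < K ∧ b < K ∧ p = (a + 1, b + 1) := by
  simp only [cells, List.mem_flatMap, List.mem_range, List.mem_map]
  constructor
  · rintro ⟨b, hb, a, ha, rfl⟩; exact ⟨a, b, ha, hb, rfl⟩
  · rintro ⟨a, b, ha, hb, rfl⟩; exact ⟨b, hb, a, ha, rfl⟩

theorem closed_of_isClosed (ht : ∀ x y, ¬InSq 0 (K - 1) x y → t x y = E) {v : List (ℕ × ℕ)}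
    (h : isClosed (grid t) v) : Closed t fun x y => ((x + 1).toNat, (y + 1).toNat) ∈ v := by
  have hE : hor E = false ∧ ver E = false := by decide
  have key : ∀ q ∈ v, ∀ r ∈ [(q.1 - 1, q.2), (q.1 + 1, q.2), (q.1, q.2 - 1), (q.1, q.2 + 1)],
      Adjoined (grid t) q r → r ∈ v := by
    intro q hq r hr k
    have := List.all_eq_true.1 (List.all_eq_true.1 h q hq) r hr
    simpa [k] using this
  constructor
  · intro x y h1 h2
    have m : InSq 0 (K - 1) x y := by
      by_contra m
      rw [ht x y m, hE.1] at h1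
      contradiction
    unfold InSq at m
    obtain ⟨a, rfl⟩ := Int.eq_ofNat_of_zero_le m.1.1
    obtain ⟨b, rfl⟩ := Int.eq_ofNat_of_zero_le m.2.1
    have e1 : ((a : ℤ) + 1).toNat = a + 1 := by omega
    have e2 : ((b : ℤ) + 1).toNat = b + 1 := by omega
    have e3 : ((a : ℤ) + 1 + 1).toNat = a + 1 + 1 := by omega
    beta_reduce
    rw [e1, e2, e3]
    rw [show (a : ℤ) + 1 = (a + 1 : ℕ) by push_cast; rfl] at h2
    rw [← grid_succ_succ t] at h1 h2
    exact ⟨fun hv => key _ hv _ (by simp) (by simp [Adjoined, h1, h2]),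
      fun hv => key _ hv _ (by simp) (by simp [Adjoined, h1, h2])⟩
  · intro x y h1 h2
    have m : InSq 0 (K - 1) x y := by
      by_contra m
      rw [ht x y m, hE.2] at h1
      contradiction
    unfold InSq at m
    obtain ⟨a, rfl⟩ := Int.eq_ofNat_of_zero_le m.1.1
    obtain ⟨b, rfl⟩ := Int.eq_ofNat_of_zero_le m.2.1
    have e1 : ((a : ℤ) + 1).toNat = a + 1 := by omega
    have e2 : ((b : ℤ) + 1).toNat = b + 1 := by omega
    have e3 : ((b : ℤ) + 1 + 1).toNat = b + 1 + 1 := by omega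
    beta_reduce
    rw [e1, e2, e3]
    rw [show (b : ℤ) + 1 = (b + 1 : ℕ) by push_cast; rfl] at h2
    rw [← grid_succ_succ t] at h1 h2
    exact ⟨fun hv => key _ hv _ (by simp) (by simp [Adjoined, h1, h2]),
      fun hv => key _ hv _ (by simp) (by simp [Adjoined, h1, h2])⟩

theorem mem_trace (g : ℕ → ℕ → Ty) (n : ℕ) (p q : ℕ × ℕ) : q ∈ trace g n p q := by
  cases n <;> simp [trace]

theorem visitsAll_iff : visitsAll K (grid t) ↔
    ∀ a b, a < K → b < K → (a + 1, b + 1) ∈ trace (grid t) (K * K) (0, 0) (1, 1) := by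
  simp only [visitsAll, List.all_eq_true, mem_cells, List.contains_iff_mem]
  constructor
  · intro h a b ha hb; exact h _ ⟨a, b, ha, hb, rfl⟩
  · rintro h _ ⟨a, b, ha, hb, rfl⟩; exact h a b ha hb

/-- A result other than `none` certifies that every verdict is conclusive: an accepted arrangement
satisfies all local and frame conditions, and in a rejected one the visited blocks are closed under
joins. -/
theorem tally_spec {L : List (List Ty)} {N : ℕ} (h : tally T K L = some N) :
    (L.filter fun l => visitsAll K (look K (K * K - 1) l)).length = N ∧
    ∀ l ∈ L, if visitsAll K (look K (K * K - 1) l) then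
        (cells K).all fun p => localAt (look K (K * K - 1) l) p.1 p.2 &&
          dom T K p.1 p.2 (look K (K * K - 1) l p.1 p.2)
      else isClosed (look K (K * K - 1) l) (trace (look K (K * K - 1) l) (K * K) (0, 0) (1, 1)) := by
  induction L generalizing N with
  | nil => simpa [tally] using h
  | cons l L ih =>
    rw [tally] at h
    split_ifs at h with h1 h2 h3
    · obtain ⟨M, hM, rfl⟩ := Option.map_eq_some_iff.1 h
      obtain ⟨k1, k2⟩ := ih hM
      refine ⟨by rw [List.filter_cons, if_pos h1, List.length_cons, k1], ?_⟩
      intro l' hl'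
      rcases List.mem_cons.1 hl' with rfl | hl'
      · rw [if_pos h1]; exact h2
      · exact k2 l' hl'
    · obtain ⟨k1, k2⟩ := ih h
      refine ⟨by rw [List.filter_cons, if_neg h1, k1], ?_⟩
      intro l' hl'
      rcases List.mem_cons.1 hl' with rfl | hl'
      · rw [if_neg h1]; exact h3
      · exact k2 l' hl'

theorem isValid_ofCode {l : List Ty}
    (h : ∀ a b, a < K → b < K → localAt (grid (ofCode K l)) (a + 1) (b + 1) ∧
      grid (ofCode K l) (a + 1) (b + 1) ≠ E)
    (hv : visitsAll K (grid (ofCode K l))) : IsValid 0 (K - 1) (ofCode K l) := by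
  have hout : ∀ x y, ¬InSq 0 (K - 1) x y → ofCode K l x y = E := fun x y m =>
    look_eq_E (by unfold InSq at m; omega)
  refine ⟨fun x y => ⟨fun h => ?_, fun m => ?_⟩, isLocal_of_grid hout fun a b ha hb =>
    (h a b ha hb).1, fun A hA => ?_⟩
  · by_contra m; exact h (hout x y m)
  · unfold InSq at m
    have := (h x.toNat y.toNat (by omega) (by omega)).2
    rwa [grid_succ_succ, Int.toNat_of_nonneg m.1.1, Int.toNat_of_nonneg m.2.1] at this
  · have all : ∀ x y, ofCode K l x y ≠ E → (A x y ↔ A 0 0) := by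
      intro x y hne
      have m : InSq 0 (K - 1) x y := by by_contra m; exact hne (hout x y m)
      unfold InSq at m
      have := trace_iff (fun p q => hA.adjoined) _ _ _ _
        (visitsAll_iff.1 hv x.toNat y.toNat (by omega) (by omega))
      simpa [Int.toNat_of_nonneg m.1.1, Int.toNat_of_nonneg m.2.1] using this
    intro x y x' y' m m' hx
    rw [all _ _ m'] ; rwa [all _ _ m] at hx

/-- The code of a path is among the arrangements, and its walk visits all blocks, since otherwise
the visited set would be a proper union of components. Conversely, a walk through all blocks proves
connectedness of an accepted arrangement. -/
theorem encard_frames_of_tally (hK : 3 ≤ K) (hII : T = .II → 4 ≤ K) {N : ℕ}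
    (hN : tally T K (enum T K (K * K)) = some N) : (frames T 0 (K - 1)).encard = N := by
  obtain ⟨h1, h2⟩ := tally_spec hN
  have inj : Set.InjOn (fun t => code K t (K * K)) (frames T 0 (K - 1)) :=
    (injOn_code (by omega)).mono fun t ht => ht.1
  rw [← inj.encard_image, ← h1]
  have hnd := (nodup_enum T K (K * K)).filter fun l => visitsAll K (look K (K * K - 1) l)
  rw [← List.toFinset_card_of_nodup hnd, ← Set.encard_coe_eq_coe_finsetCard]
  congr 1
  ext l
  rw [List.coe_toFinset]
  simp only [Set.mem_image, List.mem_filter, Set.mem_ofPred_eq]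
  constructor
  · rintro ⟨t, ⟨h, f⟩, rfl⟩
    have hl := code_mem_enum (by omega) h f (K * K) le_rfl
    refine ⟨hl, ?_⟩
    have := h2 _ hl
    rw [look_code_eq_grid (by omega) fun x y => h.eq_E] at this ⊢
    by_contra hv
    rw [if_neg hv] at this
    refine hv (visitsAll_iff.2 fun a b ha hb => ?_)
    have hc := closed_of_isClosed (fun x y => h.eq_E) this
    have := h.conn _ hc 0 0 a b ((h.supp _ _).2 (by unfold InSq; omega))
      ((h.supp _ _).2 (by unfold InSq; omega)) (mem_trace ..)
    simpa using this
  · rintro ⟨hl, hv⟩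
    have hc := code_ofCode (by omega) (length_of_mem_enum hl)
    refine ⟨ofCode K l, ?_, hc⟩
    have := h2 l hl
    rw [if_pos hv] at this
    rw [← grid_ofCode] at this hv
    have hall : ∀ a b, a < K → b < K → localAt (grid (ofCode K l)) (a + 1) (b + 1) ∧
        dom T K (a + 1) (b + 1) (grid (ofCode K l) (a + 1) (b + 1)) := by
      intro a b ha hb
      have := List.all_eq_true.1 this _ (mem_cells.2 ⟨a, b, ha, hb, rfl⟩)
      rwa [Bool.and_eq_true] at this
    exact ⟨isValid_ofCode (fun a b ha hb => ⟨(hall a b ha hb).1, by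
      have := (hall a b ha hb).2
      simp only [dom, Bool.and_eq_true, decide_eq_true_eq] at this
      exact this.1.1.1.1.1.1.1.1.1.1.1⟩) hv, frame_of_dom hK hII fun a b ha hb => (hall a b ha hb).2⟩

end

theorem encard_frames_three (T : FrameType) : (frames T 0 2).encard =
    (match T with | .I => 8 | .II => 0 | .III => 1 | .IV => 6 | .V => 1 : ℕ) := by
  by_cases hT : T = .II
  · subst hT
    rw [show frames .II 0 2 = ∅ from Set.eq_empty_of_forall_notMem fun t ht => by
      have := (ht.2.two rfl).1; omega]
    simp
  · refine encard_frames_of_tally (K := 3) le_rfl (fun e => absurd e hT) ?_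
    cases T <;> first | exact absurd rfl hT | decide +kernel

set_option maxHeartbeats 4000000 in
theorem encard_frames_four (T : FrameType) : (frames T 0 3).encard =
    (match T with | .I => 9 | .II => 6 | .III => 1 | .IV => 0 | .V => 1 : ℕ) := by
  refine encard_frames_of_tally (K := 4) (by omega) (fun _ => le_rfl) ?_
  cases T <;> decide +kernel

/-- After `m` added frames the weighted totals are `8 (8 + 8 m) + 4 · 8 = 32 (2 m + 3)` and `8 (9 +
8 m + 6) + 4 · 2 = 32 (2 m + 4)`. The shift is needed because adding frames extends the square in
all directions. -/
theorem ncard_setOf_isValid_eq {k : ℕ} (hk : 3 ≤ k) :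
    {t | IsValid 0 (k - 1) t}.ncard = 32 * k := by
  obtain ⟨m, rfl | rfl⟩ : ∃ m, k = 2 * m + 3 ∨ k = 2 * m + 4 := ⟨(k - 3) / 2, by omega⟩
  · obtain ⟨h1, h2⟩ := encard_frames_add (by norm_num) encard_frames_three m
    rw [← ncard_setOf_isValid_shift _ _ m,
      show ((2 * m + 3 : ℕ) : ℤ) - 1 - m = 2 + m by push_cast; ring,
      ncard_setOf_isValid (N := fun T => match T with
        | .I => 8 + m * 8 | .II => 0 | .III => 1 | .IV => 6 | .V => 1) (by omega)]
    · dsimp only; ring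
    · intro T
      cases T
      · exact h2
      all_goals exact h1 _ (by decide)
  · obtain ⟨h1, h2⟩ := encard_frames_add (by norm_num) encard_frames_four m
    rw [← ncard_setOf_isValid_shift _ _ m,
      show ((2 * m + 4 : ℕ) : ℤ) - 1 - m = 3 + m by push_cast; ring,
      ncard_setOf_isValid (N := fun T => match T with
        | .I => 9 + m * 8 | .II => 6 | .III => 1 | .IV => 0 | .V => 1) (by omega)]
    · dsimp only; ring
    · intro T
      cases T
      · exact h2
      all_goals exact h1 _ (by decide)

end KingSnake

/-! ### Cells of the snake in terms of blocks -/

namespace KingSnake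

open Ty

/-- Two cells joined by an edge of the king graph. -/
def KingAdj (p q : ℤ × ℤ) : Prop := p ≠ q ∧ |p.1 - q.1| ≤ 1 ∧ |p.2 - q.2| ≤ 1

/-- Whether the cell `p` lies in the snake with the blocks `t`. -/
def mem (t : ℤ → ℤ → Ty) (p : ℤ × ℤ) : Bool :=
  let c := t (p.1 / 2) (p.2 / 2)
  if p.1 % 2 = 0 then if p.2 % 2 = 0 then c.bl else c.tl
  else if p.2 % 2 = 0 then c.br else c.tr

section

variable {t : ℤ → ℤ → Ty} {p : ℤ × ℤ} {x y : ℤ}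

theorem mem_bl (h1 : p.1 = 2 * x) (h2 : p.2 = 2 * y) : mem t p = (t x y).bl := by
  simp only [mem, show p.1 % 2 = 0 by omega, show p.2 % 2 = 0 by omega, if_true,
    show p.1 / 2 = x by omega, show p.2 / 2 = y by omega]

theorem mem_br (h1 : p.1 = 2 * x + 1) (h2 : p.2 = 2 * y) : mem t p = (t x y).br := by
  simp only [mem, show ¬p.1 % 2 = 0 by omega, show p.2 % 2 = 0 by omega, if_true, if_false,
    show p.1 / 2 = x by omega, show p.2 / 2 = y by omega]

theorem mem_tl (h1 : p.1 = 2 * x) (h2 : p.2 = 2 * y + 1) : mem t p = (t x y).tl := by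
  simp only [mem, show p.1 % 2 = 0 by omega, show ¬p.2 % 2 = 0 by omega, if_true, if_false,
    show p.1 / 2 = x by omega, show p.2 / 2 = y by omega]

theorem mem_tr (h1 : p.1 = 2 * x + 1) (h2 : p.2 = 2 * y + 1) : mem t p = (t x y).tr := by
  simp only [mem, show ¬p.1 % 2 = 0 by omega, show ¬p.2 % 2 = 0 by omega, if_false,
    show p.1 / 2 = x by omega, show p.2 / 2 = y by omega]

theorem exists_cell (p : ℤ × ℤ) : ∃ x y, (p.1 = 2 * x ∨ p.1 = 2 * x + 1) ∧
    (p.2 = 2 * y ∨ p.2 = 2 * y + 1) :=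
  ⟨p.1 / 2, p.2 / 2, by omega, by omega⟩

theorem ne_E_of_mem (h : mem t p) : t (p.1 / 2) (p.2 / 2) ≠ E := by
  intro e
  unfold mem at h
  rw [e] at h
  revert h
  split_ifs <;> decide

theorem exists_mem (h : t x y ≠ E) : ∃ p, mem t p ∧ p.1 / 2 = x ∧ p.2 / 2 = y := by
  have : (t x y).bl ∨ (t x y).br ∨ (t x y).tl ∨ (t x y).tr := by
    revert h; generalize t x y = c; revert c; decide
  rcases this with k | k | k | k
  · exact ⟨(2 * x, 2 * y), by rwa [mem_bl rfl rfl], by omega, by omega⟩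
  · exact ⟨(2 * x + 1, 2 * y), by rwa [mem_br rfl rfl], by omega, by omega⟩
  · exact ⟨(2 * x, 2 * y + 1), by rwa [mem_tl rfl rfl], by omega, by omega⟩
  · exact ⟨(2 * x + 1, 2 * y + 1), by rwa [mem_tr rfl rfl], by omega, by omega⟩

/-- No block contains three cells of the snake. -/
theorem eq_of_mem {q r : ℤ × ℤ} (hp : mem t p) (hq : mem t q) (hr : mem t r)
    (h1 : q.1 / 2 = p.1 / 2) (h2 : q.2 / 2 = p.2 / 2) (h3 : r.1 / 2 = p.1 / 2)
    (h4 : r.2 / 2 = p.2 / 2) (hpq : q ≠ p) (hpr : r ≠ p) : q = r := by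
  have aux : ∀ (c : Ty) (i j i' j' i'' j'' : Bool),
      (if i then if j then c.bl else c.tl else if j then c.br else c.tr) = true →
      (if i' then if j' then c.bl else c.tl else if j' then c.br else c.tr) = true →
      (if i'' then if j'' then c.bl else c.tl else if j'' then c.br else c.tr) = true →
      ¬(i' = i ∧ j' = j) → ¬(i'' = i ∧ j'' = j) → i' = i'' ∧ j' = j'' := by decide +kernel
  obtain ⟨p1, p2⟩ := p
  obtain ⟨q1, q2⟩ := q
  obtain ⟨r1, r2⟩ := r
  simp only [mem] at *
  rw [h1, h2] at hq
  rw [h3, h4] at hr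
  rw [ne_eq, Prod.mk.injEq] at hpq hpr
  rw [Prod.mk.injEq]
  have := aux (t (p1 / 2) (p2 / 2)) (p1 % 2 = 0) (p2 % 2 = 0) (q1 % 2 = 0) (q2 % 2 = 0)
    (r1 % 2 = 0) (r2 % 2 = 0) (by simpa only [decide_eq_true_eq] using hp)
    (by simpa only [decide_eq_true_eq] using hq) (by simpa only [decide_eq_true_eq] using hr)
    (by simp only [decide_eq_decide]; omega) (by simp only [decide_eq_decide]; omega)
  simp only [decide_eq_decide] at this
  omega

theorem right_of_mem (h : mem t p) (h1 : p.1 = 2 * x + 1) (h2 : p.2 / 2 = y) :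
    (t x y).br || (t x y).tr := by
  rw [Bool.or_eq_true]
  rcases Int.emod_two_eq_zero_or_one p.2 with k | k
  · rw [mem_br h1 (y := y) (by omega)] at h; exact Or.inl h
  · rw [mem_tr h1 (y := y) (by omega)] at h; exact Or.inr h

theorem left_of_mem (h : mem t p) (h1 : p.1 = 2 * x) (h2 : p.2 / 2 = y) :
    (t x y).bl || (t x y).tl := by
  rw [Bool.or_eq_true]
  rcases Int.emod_two_eq_zero_or_one p.2 with k | k
  · rw [mem_bl h1 (y := y) (by omega)] at h; exact Or.inl h
  · rw [mem_tl h1 (y := y) (by omega)] at h; exact Or.inr h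

theorem upper_of_mem (h : mem t p) (h1 : p.1 / 2 = x) (h2 : p.2 = 2 * y + 1) :
    (t x y).tl || (t x y).tr := by
  rw [Bool.or_eq_true]
  rcases Int.emod_two_eq_zero_or_one p.1 with k | k
  · rw [mem_tl (x := x) (by omega) h2] at h; exact Or.inl h
  · rw [mem_tr (x := x) (by omega) h2] at h; exact Or.inr h

theorem lower_of_mem (h : mem t p) (h1 : p.1 / 2 = x) (h2 : p.2 = 2 * y) :
    (t x y).bl || (t x y).br := by
  rw [Bool.or_eq_true]
  rcases Int.emod_two_eq_zero_or_one p.1 with k | k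
  · rw [mem_bl (x := x) (by omega) h2] at h; exact Or.inl h
  · rw [mem_br (x := x) (by omega) h2] at h; exact Or.inr h

theorem exists_mem_right (h : (t x y).hor) :
    ∃ p, mem t p ∧ p.1 = 2 * x + 1 ∧ (p.2 = 2 * y ∨ p.2 = 2 * y + 1) := by
  have : (t x y).br ∨ (t x y).tr := by
    revert h; generalize t x y = c; revert c; decide
  rcases this with k | k
  · exact ⟨(2 * x + 1, 2 * y), by rwa [mem_br rfl rfl], rfl, Or.inl rfl⟩
  · exact ⟨(2 * x + 1, 2 * y + 1), by rwa [mem_tr rfl rfl], rfl, Or.inr rfl⟩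

theorem exists_mem_left (h : (t x y).hor) :
    ∃ p, mem t p ∧ p.1 = 2 * x ∧ (p.2 = 2 * y ∨ p.2 = 2 * y + 1) := by
  have : (t x y).bl ∨ (t x y).tl := by
    revert h; generalize t x y = c; revert c; decide
  rcases this with k | k
  · exact ⟨(2 * x, 2 * y), by rwa [mem_bl rfl rfl], rfl, Or.inl rfl⟩
  · exact ⟨(2 * x, 2 * y + 1), by rwa [mem_tl rfl rfl], rfl, Or.inr rfl⟩

theorem exists_mem_upper (h : (t x y).ver) :
    ∃ p, mem t p ∧ (p.1 = 2 * x ∨ p.1 = 2 * x + 1) ∧ p.2 = 2 * y + 1 := by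
  have : (t x y).tl ∨ (t x y).tr := by
    revert h; generalize t x y = c; revert c; decide
  rcases this with k | k
  · exact ⟨(2 * x, 2 * y + 1), by rwa [mem_tl rfl rfl], Or.inl rfl, rfl⟩
  · exact ⟨(2 * x + 1, 2 * y + 1), by rwa [mem_tr rfl rfl], Or.inr rfl, rfl⟩

theorem exists_mem_lower (h : (t x y).ver) :
    ∃ p, mem t p ∧ (p.1 = 2 * x ∨ p.1 = 2 * x + 1) ∧ p.2 = 2 * y := by
  have : (t x y).bl ∨ (t x y).br := by
    revert h; generalize t x y = c; revert c; decide
  rcases this with k | k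
  · exact ⟨(2 * x, 2 * y), by rwa [mem_bl rfl rfl], Or.inl rfl, rfl⟩
  · exact ⟨(2 * x + 1, 2 * y), by rwa [mem_br rfl rfl], Or.inr rfl, rfl⟩

/-- Adjacent cells of the snake lie in the same block or in blocks that are joined. -/
theorem joined_of_kingAdj (hh : ∀ x y, hOK (t x y) (t (x + 1) y))
    (hv : ∀ x y, vOK (t x y) (t x (y + 1))) (hd : ∀ x y, dOK (t x y) (t (x + 1) (y + 1)))
    (he : ∀ x y, eOK (t x (y + 1)) (t (x + 1) y)) {q : ℤ × ℤ} (hp : mem t p) (hq : mem t q)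
    (h : KingAdj p q) : (p.1 / 2 = q.1 / 2 ∧ p.2 / 2 = q.2 / 2) ∨
      Joined t (p.1 / 2, p.2 / 2) (q.1 / 2, q.2 / 2) := by
  have hor_of : ∀ a b : Ty, hOK a b → (a.br || a.tr) → (b.bl || b.tl) → a.hor ∧ b.hor := by decide
  have ver_of : ∀ a b : Ty, vOK a b → (a.tl || a.tr) → (b.bl || b.br) → a.ver ∧ b.ver := by decide
  obtain ⟨-, h1, h2⟩ := h
  rw [abs_le] at h1 h2
  have c1 : ∀ {p q : ℤ × ℤ}, mem t p → mem t q → p.1 / 2 + 1 = q.1 / 2 → p.2 / 2 = q.2 / 2 →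
      p.1 - q.1 ≤ 1 → -1 ≤ p.1 - q.1 →
      (t (p.1 / 2) (p.2 / 2)).hor ∧ (t (q.1 / 2) (q.2 / 2)).hor := by
    intro p q hp hq e1 e2 h1 h2
    have := hh (p.1 / 2) (p.2 / 2)
    rw [e1] at this
    nth_rw 2 [e2] at this
    exact hor_of _ _ this (right_of_mem hp (by omega) rfl) (left_of_mem hq (by omega) rfl)
  have c2 : ∀ {p q : ℤ × ℤ}, mem t p → mem t q → p.1 / 2 = q.1 / 2 → p.2 / 2 + 1 = q.2 / 2 →
      p.2 - q.2 ≤ 1 → -1 ≤ p.2 - q.2 →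
      (t (p.1 / 2) (p.2 / 2)).ver ∧ (t (q.1 / 2) (q.2 / 2)).ver := by
    intro p q hp hq e1 e2 h1 h2
    have := hv (p.1 / 2) (p.2 / 2)
    rw [e2] at this
    nth_rw 2 [e1] at this
    exact ver_of _ _ this (upper_of_mem hp rfl (by omega)) (lower_of_mem hq rfl (by omega))
  have c3 : ∀ {p q : ℤ × ℤ}, mem t p → mem t q → p.1 / 2 + 1 = q.1 / 2 → p.2 / 2 + 1 = q.2 / 2 →
      -1 ≤ p.1 - q.1 → -1 ≤ p.2 - q.2 → False := by
    intro p q hp hq e1 e2 h1 h2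
    have := hd (p.1 / 2) (p.2 / 2)
    rw [e1, e2] at this
    rw [mem_tr (x := p.1 / 2) (y := p.2 / 2) (by omega) (by omega)] at hp
    rw [mem_bl (x := q.1 / 2) (y := q.2 / 2) (by omega) (by omega)] at hq
    simp [dOK, hp, hq] at this
  have c4 : ∀ {p q : ℤ × ℤ}, mem t p → mem t q → p.1 / 2 + 1 = q.1 / 2 → p.2 / 2 = q.2 / 2 + 1 →
      -1 ≤ p.1 - q.1 → p.2 - q.2 ≤ 1 → False := by
    intro p q hp hq e1 e2 h1 h2
    have := he (p.1 / 2) (q.2 / 2)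
    rw [e1, ← e2] at this
    rw [mem_br (x := p.1 / 2) (y := p.2 / 2) (by omega) (by omega)] at hp
    rw [mem_tl (x := q.1 / 2) (y := q.2 / 2) (by omega) (by omega)] at hq
    simp [eOK, hp, hq] at this
  unfold Joined
  dsimp only
  rcases (by omega : p.1 / 2 = q.1 / 2 ∨ p.1 / 2 + 1 = q.1 / 2 ∨ q.1 / 2 + 1 = p.1 / 2) with
    e1 | e1 | e1 <;>
  rcases (by omega : p.2 / 2 = q.2 / 2 ∨ p.2 / 2 + 1 = q.2 / 2 ∨ q.2 / 2 + 1 = p.2 / 2) with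
    e2 | e2 | e2
  · exact Or.inl ⟨e1, e2⟩
  · exact Or.inr (Or.inr ⟨e1, Or.inl e2.symm, c2 hp hq e1 e2 (by omega) (by omega)⟩)
  · exact Or.inr (Or.inr ⟨e1, Or.inr e2.symm,
      (c2 hq hp e1.symm e2 (by omega) (by omega)).symm⟩)
  · exact Or.inr (Or.inl ⟨e2, Or.inl e1.symm, c1 hp hq e1 e2 (by omega) (by omega)⟩)
  · exact (c3 hp hq e1 e2 (by omega) (by omega)).elim
  · exact (c4 hp hq e1 e2.symm (by omega) (by omega)).elim
  · exact Or.inr (Or.inl ⟨e2, Or.inr e1.symm,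
      (c1 hq hp e1 e2.symm (by omega) (by omega)).symm⟩)
  · exact (c4 hq hp e1 e2.symm (by omega) (by omega)).elim
  · exact (c3 hq hp e1 e2 (by omega) (by omega)).elim

/-- Joined blocks contain adjacent cells of the snake. -/
theorem exists_kingAdj {a b : ℤ × ℤ} (h : Joined t a b) :
    ∃ p q, mem t p ∧ mem t q ∧ KingAdj p q ∧ (p.1 / 2 = a.1 ∧ p.2 / 2 = a.2) ∧
      q.1 / 2 = b.1 ∧ q.2 / 2 = b.2 := by
  have key : ∀ {p q : ℤ × ℤ}, -1 ≤ p.1 - q.1 → p.1 - q.1 ≤ 1 → -1 ≤ p.2 - q.2 → p.2 - q.2 ≤ 1 →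
      ¬(p.1 = q.1 ∧ p.2 = q.2) → KingAdj p q := fun h1 h2 h3 h4 h5 =>
    ⟨fun e => h5 (by rw [e]; exact ⟨rfl, rfl⟩), abs_le.2 ⟨h1, h2⟩, abs_le.2 ⟨h3, h4⟩⟩
  rcases h with ⟨e, e' | e', h1, h2⟩ | ⟨e, e' | e', h1, h2⟩
  · obtain ⟨p, hp, p1, p2⟩ := exists_mem_right h1
    obtain ⟨q, hq, q1, q2⟩ := exists_mem_left h2
    exact ⟨p, q, hp, hq, key (by omega) (by omega) (by omega) (by omega) (by omega), by omega,
      by omega⟩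
  · obtain ⟨p, hp, p1, p2⟩ := exists_mem_left h1
    obtain ⟨q, hq, q1, q2⟩ := exists_mem_right h2
    exact ⟨p, q, hp, hq, key (by omega) (by omega) (by omega) (by omega) (by omega), by omega,
      by omega⟩
  · obtain ⟨p, hp, p1, p2⟩ := exists_mem_upper h1
    obtain ⟨q, hq, q1, q2⟩ := exists_mem_lower h2
    exact ⟨p, q, hp, hq, key (by omega) (by omega) (by omega) (by omega) (by omega), by omega,
      by omega⟩
  · obtain ⟨p, hp, p1, p2⟩ := exists_mem_lower h1
    obtain ⟨q, hq, q1, q2⟩ := exists_mem_upper h2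
    exact ⟨p, q, hp, hq, key (by omega) (by omega) (by omega) (by omega) (by omega), by omega,
      by omega⟩

/-- The neighbours of a cell. -/
def around (p : ℤ × ℤ) : List (ℤ × ℤ) :=
  [(p.1 - 1, p.2 - 1), (p.1, p.2 - 1), (p.1 + 1, p.2 - 1), (p.1 - 1, p.2), (p.1 + 1, p.2),
    (p.1 - 1, p.2 + 1), (p.1, p.2 + 1), (p.1 + 1, p.2 + 1)]

theorem mem_around {q : ℤ × ℤ} (h : KingAdj p q) : q ∈ around p := by
  obtain ⟨p1, p2⟩ := p
  obtain ⟨q1, q2⟩ := q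
  obtain ⟨h1, h2, h3⟩ := h
  rw [abs_le] at h2 h3
  simp only [around, List.mem_cons, Prod.mk.injEq, List.not_mem_nil, ne_eq, or_false] at *
  omega

/-- The neighbours of a cell lie in its own block and in the three blocks around one corner of it.
For each position of the cell this is an exhaustive check over four types; the two remaining
neighbouring blocks enter only through the Booleans of `turnOK`. -/
theorem IsLocal.countP_around (h : IsLocal t) (hp : mem t p) : (around p).countP (mem t) ≤ 2 := by
  obtain ⟨x, y, hx, hy⟩ := exists_cell p
  obtain ⟨p1, p2⟩ := p
  have hT := h.turn x y
  simp only [around, List.countP_cons, List.countP_nil]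
  dsimp only at hx hy
  rcases hx with rfl | rfl <;> rcases hy with rfl | rfl
  · have h1 := h.h (x - 1) y
    have h2 := h.v x (y - 1)
    have h3 := h.d (x - 1) (y - 1)
    rw [mem_bl (x := x) (y := y) rfl rfl] at hp
    rw [mem_tr (x := x) (y := y) (by ring) (by ring),
      mem_tl (x := x) (y := y) (by ring) (by ring),
      mem_tr (x := x - 1) (y := y) (by ring) (by ring),
      mem_br (x := x) (y := y) (by ring) (by ring),
      mem_br (x := x - 1) (y := y) (by ring) (by ring),
      mem_tr (x := x) (y := y - 1) (by ring) (by ring),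
      mem_tl (x := x) (y := y - 1) (by ring) (by ring),
      mem_tr (x := x - 1) (y := y - 1) (by ring) (by ring)]
    rw [sub_add_cancel] at h1 h2 h3
    rw [sub_add_cancel] at h3
    generalize t x y = a, t (x - 1) y = b, t x (y - 1) = d, t (x - 1) (y - 1) = c,
      (t (x + 1) y).hor = i, (t x (y + 1)).ver = j at hp h1 h2 h3 hT ⊢
    clear h
    revert h3; revert c; revert hT; revert i j; revert h2; revert d; revert h1; revert b; revert hp
    revert a
    decide +kernel
  · have h1 := h.h (x - 1) y
    have h2 := h.v x y
    have h3 := h.e (x - 1) y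
    rw [mem_tl (x := x) (y := y) rfl rfl] at hp
    rw [mem_br (x := x) (y := y + 1) (by ring) (by ring),
      mem_bl (x := x) (y := y + 1) (by ring) (by ring),
      mem_br (x := x - 1) (y := y + 1) (by ring) (by ring),
      mem_tr (x := x) (y := y) (by ring) (by ring),
      mem_tr (x := x - 1) (y := y) (by ring) (by ring),
      mem_br (x := x) (y := y) (by ring) (by ring),
      mem_bl (x := x) (y := y) (by ring) (by ring),
      mem_br (x := x - 1) (y := y) (by ring) (by ring)]
    rw [sub_add_cancel] at h1 h3
    generalize t x y = a, t (x - 1) y = b, t x (y + 1) = d, t (x - 1) (y + 1) = c,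
      (t (x + 1) y).hor = i, (t x (y - 1)).ver = j at hp h1 h2 h3 hT ⊢
    clear h
    revert h3; revert c; revert hT; revert i j; revert h2; revert d; revert h1; revert b; revert hp
    revert a
    decide +kernel
  · have h1 := h.h x y
    have h2 := h.v x (y - 1)
    have h3 := h.e x (y - 1)
    rw [mem_br (x := x) (y := y) rfl rfl] at hp
    rw [mem_tl (x := x + 1) (y := y) (by ring) (by ring),
      mem_tr (x := x) (y := y) (by ring) (by ring),
      mem_tl (x := x) (y := y) (by ring) (by ring),
      mem_bl (x := x + 1) (y := y) (by ring) (by ring),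
      mem_bl (x := x) (y := y) (by ring) (by ring),
      mem_tl (x := x + 1) (y := y - 1) (by ring) (by ring),
      mem_tr (x := x) (y := y - 1) (by ring) (by ring),
      mem_tl (x := x) (y := y - 1) (by ring) (by ring)]
    rw [sub_add_cancel] at h2 h3
    generalize t x y = a, t (x + 1) y = b, t x (y - 1) = d, t (x + 1) (y - 1) = c,
      (t (x - 1) y).hor = i, (t x (y + 1)).ver = j at hp h1 h2 h3 hT ⊢
    clear h
    revert h3; revert c; revert hT; revert i j; revert h2; revert d; revert h1; revert b; revert hp
    revert a
    decide +kernel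
  · have h1 := h.h x y
    have h2 := h.v x y
    have h3 := h.d x y
    rw [mem_tr (x := x) (y := y) rfl rfl] at hp
    rw [mem_bl (x := x + 1) (y := y + 1) (by ring) (by ring),
      mem_br (x := x) (y := y + 1) (by ring) (by ring),
      mem_bl (x := x) (y := y + 1) (by ring) (by ring),
      mem_tl (x := x + 1) (y := y) (by ring) (by ring),
      mem_tl (x := x) (y := y) (by ring) (by ring),
      mem_bl (x := x + 1) (y := y) (by ring) (by ring),
      mem_br (x := x) (y := y) (by ring) (by ring),
      mem_bl (x := x) (y := y) (by ring) (by ring)]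
    generalize t x y = a, t (x + 1) y = b, t x (y + 1) = d, t (x + 1) (y + 1) = c,
      (t (x - 1) y).hor = i, (t x (y - 1)).ver = j at hp h1 h2 h3 hT ⊢
    clear h
    revert h3; revert c; revert hT; revert i j; revert h2; revert d; revert h1; revert b; revert hp
    revert a
    decide +kernel

end

end KingSnake

/-! ### The upper bound, and the blocks of a snake with the maximal number of cells -/

namespace KingSnake

open Ty

theorem kingAdj_iff {p q : ℤ × ℤ} : KingAdj p q ↔ ¬(p.1 = q.1 ∧ p.2 = q.2) ∧
    (-1 ≤ p.1 - q.1 ∧ p.1 - q.1 ≤ 1) ∧ -1 ≤ p.2 - q.2 ∧ p.2 - q.2 ≤ 1 := by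
  rw [KingAdj, abs_le, abs_le, ne_eq, Prod.ext_iff]

theorem card_eq_sum_blocks {k : ℕ} {F : Finset (ℤ × ℤ)}
    (hF : ∀ p ∈ F, p ∈ board (2 * k) (2 * k)) :
    F.card = ∑ b ∈ Finset.Icc (0 : ℤ) (k - 1) ×ˢ Finset.Icc (0 : ℤ) (k - 1),
      (((if (2 * b.1, 2 * b.2) ∈ F then 1 else 0) + if (2 * b.1 + 1, 2 * b.2) ∈ F then 1 else 0) +
      ((if (2 * b.1, 2 * b.2 + 1) ∈ F then 1 else 0) +
        if (2 * b.1 + 1, 2 * b.2 + 1) ∈ F then 1 else 0)) := by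
  rw [Finset.card_eq_sum_card_fiberwise (f := fun p => (p.1 / 2, p.2 / 2))
    (t := Finset.Icc (0 : ℤ) (k - 1) ×ˢ Finset.Icc (0 : ℤ) (k - 1))]
  · refine Finset.sum_congr rfl fun b _ => ?_
    obtain ⟨x, y⟩ := b
    have : (F.filter fun p => (p.1 / 2, p.2 / 2) = (x, y)) =
        (({(2 * x, 2 * y), (2 * x + 1, 2 * y), (2 * x, 2 * y + 1), (2 * x + 1, 2 * y + 1)} :
          Finset (ℤ × ℤ)).filter (· ∈ F)) := by
      ext ⟨p1, p2⟩
      simp only [Finset.mem_filter, Prod.mk.injEq, Finset.mem_insert, Finset.mem_singleton]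
      rw [and_comm]
      refine and_congr_left fun _ => ?_
      omega
    rw [this, Finset.card_filter, Finset.sum_insert, Finset.sum_insert, Finset.sum_insert,
      Finset.sum_singleton]
    · ring
    all_goals simp
  · intro p hp
    have := hF p hp
    simp only [board, Set.mem_ofPred_eq, Nat.cast_mul, Nat.cast_ofNat] at this
    simp only [Finset.coe_product, Finset.coe_Icc, Set.mem_prod, Set.mem_Icc]
    omega

section

variable {k : ℕ} {F : Finset (ℤ × ℤ)} (hF : ∀ p ∈ F, p ∈ board (2 * k) (2 * k))
  (tri : ∀ p ∈ F, ∀ q ∈ F, ∀ r ∈ F, KingAdj p q → KingAdj p r → KingAdj q r → False)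

-- Any three cells of a block are mutually adjacent.
include tri in
theorem card_block_le (b : ℤ × ℤ) :
    ((if (2 * b.1, 2 * b.2) ∈ F then 1 else 0) + if (2 * b.1 + 1, 2 * b.2) ∈ F then 1 else 0) +
      ((if (2 * b.1, 2 * b.2 + 1) ∈ F then 1 else 0) +
        if (2 * b.1 + 1, 2 * b.2 + 1) ∈ F then 1 else 0) ≤ 2 := by
  have k1 := fun h1 h2 h3 => tri (2 * b.1, 2 * b.2) h1 (2 * b.1 + 1, 2 * b.2) h2
    (2 * b.1, 2 * b.2 + 1) h3 (by simp only [kingAdj_iff]; omega)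
        (by simp only [kingAdj_iff]; omega)
    (by simp only [kingAdj_iff]; omega)
  have k2 := fun h1 h2 h3 => tri (2 * b.1, 2 * b.2) h1 (2 * b.1 + 1, 2 * b.2) h2
    (2 * b.1 + 1, 2 * b.2 + 1) h3 (by simp only [kingAdj_iff]; omega)
    (by simp only [kingAdj_iff]; omega) (by simp only [kingAdj_iff]; omega)
  have k3 := fun h1 h2 h3 => tri (2 * b.1, 2 * b.2) h1 (2 * b.1, 2 * b.2 + 1) h2
    (2 * b.1 + 1, 2 * b.2 + 1) h3 (by simp only [kingAdj_iff]; omega)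
    (by simp only [kingAdj_iff]; omega) (by simp only [kingAdj_iff]; omega)
  have k4 := fun h1 h2 h3 => tri (2 * b.1 + 1, 2 * b.2) h1 (2 * b.1, 2 * b.2 + 1) h2
    (2 * b.1 + 1, 2 * b.2 + 1) h3 (by simp only [kingAdj_iff]; omega)
    (by simp only [kingAdj_iff]; omega) (by simp only [kingAdj_iff]; omega)
  split_ifs <;> first | omega | (exfalso; tauto)

include hF tri in
/-- A set of cells without triangles contains at most half of the cells. -/
theorem card_le_of_no_triangle : F.card ≤ 2 * k ^ 2 := by
  rw [card_eq_sum_blocks hF]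
  refine (Finset.sum_le_sum fun b _ => card_block_le tri b).trans_eq ?_
  simp
  ring

theorem Closed.joined {t : ℤ → ℤ → Ty} {A : ℤ → ℤ → Prop} (hA : Closed t A) {a b : ℤ × ℤ}
    (h : Joined t a b) : A a.1 a.2 ↔ A b.1 b.2 := by
  obtain ⟨a1, a2⟩ := a
  obtain ⟨b1, b2⟩ := b
  rcases h with ⟨e, e' | e', h1, h2⟩ | ⟨e, e' | e', h1, h2⟩ <;> dsimp only at * <;> subst e e'
  · exact hA.1 _ _ h1 h2
  · exact (hA.1 _ _ h2 h1).symm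
  · exact hA.2 _ _ h1 h2
  · exact (hA.2 _ _ h2 h1).symm

-- Maximality puts two cells in every block. Then `hOK` and `vOK` express the absence of triangles,
-- while `dOK`, `eOK` and `turnOK` follow from the degree bound, and connectedness of the cells
-- passes to the blocks.
include hF tri in
theorem exists_isValid
    (deg : ∀ p ∈ F, ∀ q ∈ F, ∀ r ∈ F, ∀ s ∈ F, KingAdj p q → KingAdj p r → KingAdj p s →
      q ≠ r → q ≠ s → r ≠ s → False)
    (conn : ∀ A : ℤ × ℤ → Prop, (∀ p ∈ F, ∀ q ∈ F, KingAdj p q → A p → A q) →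
      ∀ p ∈ F, ∀ q ∈ F, A p → A q)
    (hcard : F.card = 2 * k ^ 2) :
    ∃ t, IsValid 0 (k - 1) t ∧ ∀ p, p ∈ F ↔ mem t p := by
  have two : ∀ x y, InSq 0 (k - 1) x y → ∃ c : Ty, c ≠ E ∧ ((2 * x, 2 * y) ∈ F ↔ c.bl) ∧
      ((2 * x + 1, 2 * y) ∈ F ↔ c.br) ∧ ((2 * x, 2 * y + 1) ∈ F ↔ c.tl) ∧
      ((2 * x + 1, 2 * y + 1) ∈ F ↔ c.tr) := by
    have hs := card_eq_sum_blocks hF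
    have h2 : ∑ b ∈ Finset.Icc (0 : ℤ) (k - 1) ×ˢ Finset.Icc (0 : ℤ) (k - 1), 2 = 2 * k ^ 2 := by
      simp; ring
    rw [hcard, ← h2] at hs
    -- The sum over the blocks attains its termwise upper bound, so every term does.
    have := (Finset.sum_eq_sum_iff_of_le fun b _ => card_block_le tri b).1 hs.symm
    intro x y m
    have := this (x, y) (by
      unfold InSq at m
      simp only [Finset.mem_product, Finset.mem_Icc]
      omega)
    dsimp only at this
    have aux : ∀ i j i' j' : Bool, (if i then 1 else 0) + (if j then 1 else 0) +
        ((if i' then 1 else 0) + if j' then 1 else 0) = 2 →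
        ∃ c : Ty, c ≠ E ∧ (i ↔ c.bl) ∧ (j ↔ c.br) ∧ (i' ↔ c.tl) ∧ (j' ↔ c.tr) := by decide
    have := aux (decide ((2 * x, 2 * y) ∈ F)) (decide ((2 * x + 1, 2 * y) ∈ F))
      (decide ((2 * x, 2 * y + 1) ∈ F)) (decide ((2 * x + 1, 2 * y + 1) ∈ F))
      (by simpa only [decide_eq_true_eq] using this)
    simpa only [decide_eq_true_eq] using this
  have : Nonempty Ty := ⟨E⟩
  choose! c hcE hbl hbr htl htr using two
  obtain ⟨t, ht⟩ : ∃ t : ℤ → ℤ → Ty, t = fun x y => if InSq 0 (k - 1) x y then c x y else E :=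
    ⟨_, rfl⟩
  have supp : ∀ x y, t x y ≠ E ↔ InSq 0 (k - 1) x y := by
    intro x y
    rw [ht]
    dsimp only
    split_ifs with m
    · simp [m, hcE x y m]
    · simp [m]
  have hmem : ∀ p, p ∈ F ↔ mem t p := by
    intro p
    obtain ⟨x, y, hx, hy⟩ := exists_cell p
    obtain ⟨p1, p2⟩ := p
    dsimp only at hx hy
    by_cases m : InSq 0 (k - 1) x y
    · have e : t x y = c x y := by rw [ht]; exact if_pos m
      rcases hx with rfl | rfl <;> rcases hy with rfl | rfl
      · rw [mem_bl rfl rfl, e]; exact hbl x y m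
      · rw [mem_tl rfl rfl, e]; exact htl x y m
      · rw [mem_br rfl rfl, e]; exact hbr x y m
      · rw [mem_tr rfl rfl, e]; exact htr x y m
    · refine iff_of_false (fun h => m ?_) fun h => m ?_
      · have := hF _ h
        simp only [board, Set.mem_ofPred_eq, Nat.cast_mul, Nat.cast_ofNat] at this
        unfold InSq; omega
      · have := (supp _ _).1 (ne_E_of_mem h)
        unfold InSq at *; omega
  have bl : ∀ x y, (t x y).bl → (2 * x, 2 * y) ∈ F := fun x y h => by
    rwa [hmem, mem_bl rfl rfl]
  have br : ∀ x y, (t x y).br → (2 * x + 1, 2 * y) ∈ F := fun x y h => by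
    rwa [hmem, mem_br rfl rfl]
  have tl : ∀ x y, (t x y).tl → (2 * x, 2 * y + 1) ∈ F := fun x y h => by
    rwa [hmem, mem_tl rfl rfl]
  have tr : ∀ x y, (t x y).tr → (2 * x + 1, 2 * y + 1) ∈ F := fun x y h => by
    rwa [hmem, mem_tr rfl rfl]
  have other : ∀ p ∈ F, ∃ q ∈ F, q.1 / 2 = p.1 / 2 ∧ q.2 / 2 = p.2 / 2 ∧
      ¬(q.1 = p.1 ∧ q.2 = p.2) := by
    have aux : ∀ c : Ty, c ≠ E → (c.bl ∧ c.br) ∨ (c.bl ∧ c.tl) ∨ (c.bl ∧ c.tr) ∨ (c.br ∧ c.tl) ∨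
        (c.br ∧ c.tr) ∨ (c.tl ∧ c.tr) := by decide
    intro p hp
    have hq : ∃ q ∈ F, ∃ r ∈ F, q.1 / 2 = p.1 / 2 ∧ q.2 / 2 = p.2 / 2 ∧ r.1 / 2 = p.1 / 2 ∧
        r.2 / 2 = p.2 / 2 ∧ ¬(q.1 = r.1 ∧ q.2 = r.2) := by
      rcases aux _ (ne_E_of_mem ((hmem p).1 hp)) with
        ⟨h1, h2⟩ | ⟨h1, h2⟩ | ⟨h1, h2⟩ | ⟨h1, h2⟩ | ⟨h1, h2⟩ | ⟨h1, h2⟩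
      · exact ⟨_, bl _ _ h1, _, br _ _ h2, by omega, by omega, by omega, by omega, by omega⟩
      · exact ⟨_, bl _ _ h1, _, tl _ _ h2, by omega, by omega, by omega, by omega, by omega⟩
      · exact ⟨_, bl _ _ h1, _, tr _ _ h2, by omega, by omega, by omega, by omega, by omega⟩
      · exact ⟨_, br _ _ h1, _, tl _ _ h2, by omega, by omega, by omega, by omega, by omega⟩
      · exact ⟨_, br _ _ h1, _, tr _ _ h2, by omega, by omega, by omega, by omega, by omega⟩
      · exact ⟨_, tl _ _ h1, _, tr _ _ h2, by omega, by omega, by omega, by omega, by omega⟩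
    obtain ⟨q, hq, r, hr, q1, q2, r1, r2, hne⟩ := hq
    by_cases e : q.1 = p.1 ∧ q.2 = p.2
    · exact ⟨r, hr, r1, r2, by omega⟩
    · exact ⟨q, hq, q1, q2, e⟩
  have no3 : ∀ {p q r : ℤ × ℤ}, p ∈ F → q ∈ F → r ∈ F →
      (¬(p.1 = q.1 ∧ p.2 = q.2) ∧ (-1 ≤ p.1 - q.1 ∧ p.1 - q.1 ≤ 1) ∧
        -1 ≤ p.2 - q.2 ∧ p.2 - q.2 ≤ 1) →
      (¬(p.1 = r.1 ∧ p.2 = r.2) ∧ (-1 ≤ p.1 - r.1 ∧ p.1 - r.1 ≤ 1) ∧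
        -1 ≤ p.2 - r.2 ∧ p.2 - r.2 ≤ 1) →
      ¬(¬(q.1 = r.1 ∧ q.2 = r.2) ∧ (-1 ≤ q.1 - r.1 ∧ q.1 - r.1 ≤ 1) ∧
        -1 ≤ q.2 - r.2 ∧ q.2 - r.2 ≤ 1) := fun hp hq hr h1 h2 h3 =>
    tri _ hp _ hq _ hr (kingAdj_iff.2 h1) (kingAdj_iff.2 h2) (kingAdj_iff.2 h3)
  have no4 : ∀ {p q r s : ℤ × ℤ}, p ∈ F → q ∈ F → r ∈ F → s ∈ F →
      (¬(p.1 = q.1 ∧ p.2 = q.2) ∧ (-1 ≤ p.1 - q.1 ∧ p.1 - q.1 ≤ 1) ∧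
        -1 ≤ p.2 - q.2 ∧ p.2 - q.2 ≤ 1) →
      (¬(p.1 = r.1 ∧ p.2 = r.2) ∧ (-1 ≤ p.1 - r.1 ∧ p.1 - r.1 ≤ 1) ∧
        -1 ≤ p.2 - r.2 ∧ p.2 - r.2 ≤ 1) →
      (¬(p.1 = s.1 ∧ p.2 = s.2) ∧ (-1 ≤ p.1 - s.1 ∧ p.1 - s.1 ≤ 1) ∧
        -1 ≤ p.2 - s.2 ∧ p.2 - s.2 ≤ 1) →
      ¬(¬(q.1 = r.1 ∧ q.2 = r.2) ∧ ¬(q.1 = s.1 ∧ q.2 = s.2) ∧ ¬(r.1 = s.1 ∧ r.2 = s.2)) :=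
    fun hp hq hr hs h1 h2 h3 h4 =>
      deg _ hp _ hq _ hr _ hs (kingAdj_iff.2 h1) (kingAdj_iff.2 h2) (kingAdj_iff.2 h3)
        (fun e => h4.1 (by rw [e]; exact ⟨rfl, rfl⟩))
        (fun e => h4.2.1 (by rw [e]; exact ⟨rfl, rfl⟩))
        (fun e => h4.2.2 (by rw [e]; exact ⟨rfl, rfl⟩))
  have hh : ∀ x y, hOK (t x y) (t (x + 1) y) := by
    have aux : ∀ a b : Ty, ¬hOK a b → (a.br ∧ a.tr ∧ b.bl) ∨ (a.br ∧ a.tr ∧ b.tl) ∨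
        (a.br ∧ b.bl ∧ b.tl) ∨ (a.tr ∧ b.bl ∧ b.tl) := by decide
    intro x y
    by_contra hn
    rcases aux _ _ hn with ⟨h1, h2, h3⟩ | ⟨h1, h2, h3⟩ | ⟨h1, h2, h3⟩ | ⟨h1, h2, h3⟩
    · exact no3 (br _ _ h1) (tr _ _ h2) (bl _ _ h3) (by omega) (by omega) (by omega)
    · exact no3 (br _ _ h1) (tr _ _ h2) (tl _ _ h3) (by omega) (by omega) (by omega)
    · exact no3 (br _ _ h1) (bl _ _ h2) (tl _ _ h3) (by omega) (by omega) (by omega)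
    · exact no3 (tr _ _ h1) (bl _ _ h2) (tl _ _ h3) (by omega) (by omega) (by omega)
  have hv : ∀ x y, vOK (t x y) (t x (y + 1)) := by
    have aux : ∀ a b : Ty, ¬vOK a b → (a.tl ∧ a.tr ∧ b.bl) ∨ (a.tl ∧ a.tr ∧ b.br) ∨
        (a.tl ∧ b.bl ∧ b.br) ∨ (a.tr ∧ b.bl ∧ b.br) := by decide
    intro x y
    by_contra hn
    rcases aux _ _ hn with ⟨h1, h2, h3⟩ | ⟨h1, h2, h3⟩ | ⟨h1, h2, h3⟩ | ⟨h1, h2, h3⟩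
    · exact no3 (tl _ _ h1) (tr _ _ h2) (bl _ _ h3) (by omega) (by omega) (by omega)
    · exact no3 (tl _ _ h1) (tr _ _ h2) (br _ _ h3) (by omega) (by omega) (by omega)
    · exact no3 (tl _ _ h1) (bl _ _ h2) (br _ _ h3) (by omega) (by omega) (by omega)
    · exact no3 (tr _ _ h1) (bl _ _ h2) (br _ _ h3) (by omega) (by omega) (by omega)
  have nE : ∀ {p : ℤ × ℤ}, p ∈ F → InSq 0 (k - 1) (p.1 / 2) (p.2 / 2) := fun hp =>
    (supp _ _).1 (ne_E_of_mem ((hmem _).1 hp))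
  have hd : ∀ x y, dOK (t x y) (t (x + 1) (y + 1)) := by
    intro x y
    by_contra hn
    simp only [dOK, Bool.not_eq_true', Bool.not_eq_false, Bool.and_eq_true] at hn
    have m1 := tr _ _ hn.1
    have m2 := bl _ _ hn.2
    obtain ⟨a, ha, a1, a2, a3⟩ := other _ m1
    obtain ⟨c, hc, c1, c2, c3⟩ := other _ m2
    have i1 := nE m1
    have i2 := nE m2
    have hb : t (x + 1) y ≠ E := (supp _ _).2 (by unfold InSq at *; omega)
    -- The block in the angle between two diagonally touching cells has two cells, so one of them is
    -- next to a touching cell. Together with the other touching cell and the second cell of its own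
    -- block, this gives three neighbours.
    have aux : ∀ b : Ty, b ≠ E → b.bl ∨ b.tl ∨ b.tr := by decide
    rcases aux _ hb with h | h | h
    · exact no4 m1 m2 ha (bl _ _ h) (by omega) (by omega) (by omega) (by omega)
    · exact no4 m1 m2 ha (tl _ _ h) (by omega) (by omega) (by omega) (by omega)
    · exact no4 m2 m1 hc (tr _ _ h) (by omega) (by omega) (by omega) (by omega)
  have he : ∀ x y, eOK (t x (y + 1)) (t (x + 1) y) := by
    intro x y
    by_contra hn
    simp only [eOK, Bool.not_eq_true', Bool.not_eq_false, Bool.and_eq_true] at hn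
    have m1 := br _ _ hn.1
    have m2 := tl _ _ hn.2
    obtain ⟨a, ha, a1, a2, a3⟩ := other _ m1
    obtain ⟨c, hc, c1, c2, c3⟩ := other _ m2
    have i1 := nE m1
    have i2 := nE m2
    have hb : t x y ≠ E := (supp _ _).2 (by unfold InSq at *; omega)
    have aux : ∀ b : Ty, b ≠ E → b.tl ∨ b.tr ∨ b.br := by decide
    rcases aux _ hb with h | h | h
    · exact no4 m1 m2 ha (tl _ _ h) (by omega) (by omega) (by omega) (by omega)
    · exact no4 m1 m2 ha (tr _ _ h) (by omega) (by omega) (by omega) (by omega)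
    · exact no4 m2 m1 hc (br _ _ h) (by omega) (by omega) (by omega) (by omega)
  refine ⟨t, ⟨supp, ⟨hh, hv, hd, he, ?_⟩, ?_⟩, hmem⟩
  · intro x y
    have aux : ∀ (c : Ty) (l r d u : Bool), ¬turnOK c l r d u → (c = S ∧ l ∧ d) ∨ (c = S ∧ r ∧ u) ∨
        (c = Z ∧ l ∧ u) ∨ (c = Z ∧ r ∧ d) := by decide
    by_contra hn
    rcases aux _ _ _ _ _ hn with ⟨h1, h2, h3⟩ | ⟨h1, h2, h3⟩ | ⟨h1, h2, h3⟩ | ⟨h1, h2, h3⟩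
    · obtain ⟨p, hp, p1, p2⟩ := exists_mem_right h2
      obtain ⟨q, hq, q1, q2⟩ := exists_mem_upper h3
      exact no4 (bl x y (by rw [h1]; rfl)) (tr x y (by rw [h1]; rfl)) ((hmem _).2 hp)
        ((hmem _).2 hq) (by omega) (by omega) (by omega) (by omega)
    · obtain ⟨p, hp, p1, p2⟩ := exists_mem_left h2
      obtain ⟨q, hq, q1, q2⟩ := exists_mem_lower h3
      exact no4 (tr x y (by rw [h1]; rfl)) (bl x y (by rw [h1]; rfl)) ((hmem _).2 hp)
        ((hmem _).2 hq) (by omega) (by omega) (by omega) (by omega)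
    · obtain ⟨p, hp, p1, p2⟩ := exists_mem_right h2
      obtain ⟨q, hq, q1, q2⟩ := exists_mem_lower h3
      exact no4 (tl x y (by rw [h1]; rfl)) (br x y (by rw [h1]; rfl)) ((hmem _).2 hp)
        ((hmem _).2 hq) (by omega) (by omega) (by omega) (by omega)
    · obtain ⟨p, hp, p1, p2⟩ := exists_mem_left h2
      obtain ⟨q, hq, q1, q2⟩ := exists_mem_upper h3
      exact no4 (br x y (by rw [h1]; rfl)) (tl x y (by rw [h1]; rfl)) ((hmem _).2 hp)
        ((hmem _).2 hq) (by omega) (by omega) (by omega) (by omega)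
  · intro A hA x y x' y' m m' hx
    obtain ⟨p, hp, rfl, rfl⟩ := exists_mem m
    obtain ⟨q, hq, rfl, rfl⟩ := exists_mem m'
    refine conn (fun p => A (p.1 / 2) (p.2 / 2)) (fun p hp q hq h hAp => ?_) p ((hmem p).2 hp) q
      ((hmem q).2 hq) hx
    rcases joined_of_kingAdj hh hv hd he ((hmem p).1 hp) ((hmem q).1 hq) h with ⟨e1, e2⟩ | hj
    · rwa [e1, e2] at hAp
    · exact (hA.joined hj).1 hAp

end

/-- The number of cells of a snake with two cells in each block. -/
theorem IsValid.card_cells {k : ℕ} {t : ℤ → ℤ → Ty} (h : IsValid 0 (k - 1) t) {F : Finset (ℤ × ℤ)}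
    (hF : ∀ p, p ∈ F ↔ mem t p) : F.card = 2 * k ^ 2 := by
  have hb : ∀ p ∈ F, p ∈ board (2 * k) (2 * k) := fun p hp => by
    have := (h.supp _ _).1 (ne_E_of_mem ((hF p).1 hp))
    simp only [board, Set.mem_ofPred_eq, Nat.cast_mul, Nat.cast_ofNat]
    unfold InSq at this; omega
  rw [card_eq_sum_blocks hb]
  have : ∀ b ∈ Finset.Icc (0 : ℤ) (k - 1) ×ˢ Finset.Icc (0 : ℤ) (k - 1),
      (((if (2 * b.1, 2 * b.2) ∈ F then 1 else 0) + if (2 * b.1 + 1, 2 * b.2) ∈ F then 1 else 0) +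
      ((if (2 * b.1, 2 * b.2 + 1) ∈ F then 1 else 0) +
        if (2 * b.1 + 1, 2 * b.2 + 1) ∈ F then 1 else 0)) = 2 := by
    intro b hb
    have hE := (h.supp b.1 b.2).2 (by
      simp only [Finset.mem_product, Finset.mem_Icc] at hb
      exact hb)
    simp only [hF, mem_bl (p := (2 * b.1, 2 * b.2)) rfl rfl,
      mem_br (p := (2 * b.1 + 1, 2 * b.2)) rfl rfl, mem_tl (p := (2 * b.1, 2 * b.2 + 1)) rfl rfl,
      mem_tr (p := (2 * b.1 + 1, 2 * b.2 + 1)) rfl rfl]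
    revert hE
    generalize t b.1 b.2 = c
    revert c; decide
  rw [Finset.sum_congr rfl this]
  simp
  ring

end KingSnake

/-! ### Snake paths of maximal length correspond to valid arrangements -/

namespace KingSnake

open Ty

theorem kingGraph_adj {S : Set (ℤ × ℤ)} {u v : S} : (kingGraph S).Adj u v ↔ KingAdj u.1 v.1 :=
  and_congr (not_congr Subtype.ext_iff) Iff.rfl

instance (m n : ℕ) : Finite (board m n) :=
  ((Finset.Icc (0 : ℤ) (n - 1)) ×ˢ (Finset.Icc (0 : ℤ) (m - 1))).finite_toSet.subset fun p hp => by
    simp only [board, Set.mem_ofPred_eq] at hp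
    simp only [Finset.coe_product, Finset.coe_Icc, Set.mem_prod, Set.mem_Icc]
    omega

theorem length_add_one {n : ℕ} {P : (kingGraph (board n n)).Subgraph} (hP : IsPath P) :
    length P + 1 = P.verts.ncard := by
  have := (SimpleGraph.isTree_iff_connected_and_card.1 hP.1).2
  rw [← Nat.card_coe_set_eq, ← this, length, ← SimpleGraph.Subgraph.image_coe_edgeSet_coe,
    Set.ncard_image_of_injective _ (Sym2.map.injective Subtype.val_injective),
    Nat.card_coe_set_eq]

section

variable {n : ℕ} {P : (kingGraph (board n n)).Subgraph} (hP : IsSnakePath P) {F : Finset (ℤ × ℤ)}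
  (hF : ∀ p, p ∈ F ↔ ∃ h : p ∈ board n n, ⟨p, h⟩ ∈ P.verts)
include hF

theorem card_cells_eq : F.card = P.verts.ncard := by
  rw [← Set.ncard_image_of_injective P.verts Subtype.val_injective, ← Set.ncard_coe_finset]
  congr 1
  ext p
  rw [Finset.mem_coe, hF]
  simp

include hP

theorem IsSnakePath.adj {p q : ℤ × ℤ} (hp : p ∈ F) (hq : q ∈ F) (h : KingAdj p q) :
    ∃ h1 h2 h3 h4, P.coe.Adj ⟨⟨p, h1⟩, h2⟩ ⟨⟨q, h3⟩, h4⟩ := by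
  obtain ⟨h1, h2⟩ := (hF p).1 hp
  obtain ⟨h3, h4⟩ := (hF q).1 hq
  exact ⟨h1, h2, h3, h4, hP.2 h2 h4 (kingGraph_adj.2 h)⟩

theorem IsSnakePath.no_triangle : ∀ p ∈ F, ∀ q ∈ F, ∀ r ∈ F, KingAdj p q → KingAdj p r →
    KingAdj q r → False := by
  classical
  intro p hp q hq r hr h1 h2 h3
  obtain ⟨_, _, _, _, a1⟩ := hP.adj hF hp hq h1
  obtain ⟨_, _, _, _, a2⟩ := hP.adj hF hp hr h2
  obtain ⟨_, _, _, _, a3⟩ := hP.adj hF hq hr h3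
  exact hP.1.1.isAcyclic.cliqueFree le_rfl _ (SimpleGraph.is3Clique_triple_iff.2 ⟨a1, a2, a3⟩)

theorem IsSnakePath.no_branch : ∀ p ∈ F, ∀ q ∈ F, ∀ r ∈ F, ∀ s ∈ F, KingAdj p q → KingAdj p r →
    KingAdj p s → q ≠ r → q ≠ s → r ≠ s → False := by
  intro p hp q hq r hr s hs h1 h2 h3 n1 n2 n3
  obtain ⟨b1, _, b2, _, a1⟩ := hP.adj hF hp hq h1
  obtain ⟨_, _, b3, _, a2⟩ := hP.adj hF hp hr h2
  obtain ⟨_, _, b4, _, a3⟩ := hP.adj hF hp hs h3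
  have hsub : ({⟨q, b2⟩, ⟨r, b3⟩, ⟨s, b4⟩} : Set (board n n)) ⊆ P.neighborSet ⟨p, b1⟩ := by
    rintro _ (rfl | rfl | rfl)
    exacts [a1, a2, a3]
  have h := (Set.encard_le_encard hsub).trans (hP.1.2 _)
  rw [Set.encard_eq_three.2 ⟨_, _, _, fun e => n1 (Subtype.ext_iff.1 e),
    fun e => n2 (Subtype.ext_iff.1 e), fun e => n3 (Subtype.ext_iff.1 e), rfl⟩] at h
  exact absurd h (by decide)

theorem IsSnakePath.connected (A : ℤ × ℤ → Prop)
    (hA : ∀ p ∈ F, ∀ q ∈ F, KingAdj p q → A p → A q) : ∀ p ∈ F, ∀ q ∈ F, A p → A q := by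
  intro p hp q hq
  obtain ⟨h1, h2⟩ := (hF p).1 hp
  obtain ⟨h3, h4⟩ := (hF q).1 hq
  have key : ∀ u v : P.verts, P.coe.Walk u v → A u.1.1 → A v.1.1 := by
    intro u v w
    induction w with
    | nil => exact id
    | @cons u v w h _ ih =>
      intro hu
      exact ih (hA _ ((hF _).2 ⟨u.1.2, u.2⟩) _ ((hF _).2 ⟨v.1.2, v.2⟩)
        (kingGraph_adj.1 (P.adj_sub h)) hu)
  obtain ⟨w⟩ := hP.1.1.connected ⟨⟨p, h1⟩, h2⟩ ⟨⟨q, h3⟩, h4⟩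
  exact key _ _ w

end

/-- The induced subgraph whose cells are those of the snake with the blocks `t`. -/
def snake (n : ℕ) (t : ℤ → ℤ → Ty) : (kingGraph (board n n)).Subgraph :=
  (⊤ : (kingGraph (board n n)).Subgraph).induce {v | mem t v.1}

section

variable {n k : ℕ} {t : ℤ → ℤ → Ty}

theorem mem_snake {v : board n n} : v ∈ (snake n t).verts ↔ mem t v.1 := Iff.rfl

theorem snake_adj {u v : board n n} :
    (snake n t).Adj u v ↔ mem t u.1 ∧ mem t v.1 ∧ KingAdj u.1 v.1 := by
  rw [← kingGraph_adj]; rfl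

theorem eq_snake {P : (kingGraph (board n n)).Subgraph} (hP : P.IsInduced)
    (h : ∀ v : board n n, v ∈ P.verts ↔ mem t v.1) : P = snake n t := by
  refine SimpleGraph.Subgraph.ext (Set.ext h) ?_
  funext u v
  rw [snake_adj, ← h, ← h, ← kingGraph_adj]
  exact propext ⟨fun k => ⟨P.edge_vert k, P.edge_vert k.symm, P.adj_sub k⟩,
    fun k => hP k.1 k.2.1 k.2.2⟩

theorem mem_board (hn : n = 2 * k) (h : IsValid 0 (k - 1) t) {p : ℤ × ℤ} (hp : mem t p) :
    p ∈ board n n := by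
  have := (h.supp _ _).1 (ne_E_of_mem hp)
  simp only [board, Set.mem_ofPred_eq]
  unfold InSq at this; omega

/-- Every snake path with `2 k²` cells is given by a valid choice of types. -/
theorem IsSnakePath.exists_isValid {P : (kingGraph (board n n)).Subgraph} (hP : IsSnakePath P)
    (hn : n = 2 * k) (hl : length P + 1 = 2 * k ^ 2) :
    ∃ t, IsValid 0 (k - 1) t ∧ P = snake n t := by
  obtain ⟨F, hF⟩ := (P.verts.toFinite.image Subtype.val).exists_finset
  replace hF : ∀ p, p ∈ F ↔ ∃ h : p ∈ board n n, ⟨p, h⟩ ∈ P.verts := fun p => by rw [hF]; simp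
  obtain ⟨t, ht, h⟩ := KingSnake.exists_isValid (k := k) (F := F)
    (fun p hp => by rw [← hn]; exact ((hF p).1 hp).1) (hP.no_triangle hF) (hP.no_branch hF)
    (hP.connected hF) (by rw [card_cells_eq hF, ← length_add_one hP.1, hl])
  refine ⟨t, ht, eq_snake hP.2 fun v => ?_⟩
  rw [← h, hF]
  exact ⟨fun hv => ⟨v.2, hv⟩, fun ⟨_, hv⟩ => hv⟩

theorem IsSnakePath.length_le {P : (kingGraph (board n n)).Subgraph} (hP : IsSnakePath P)
    (hn : n = 2 * k) : length P + 1 ≤ 2 * k ^ 2 := by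
  obtain ⟨F, hF⟩ := (P.verts.toFinite.image Subtype.val).exists_finset
  replace hF : ∀ p, p ∈ F ↔ ∃ h : p ∈ board n n, ⟨p, h⟩ ∈ P.verts := fun p => by rw [hF]; simp
  rw [length_add_one hP.1, ← card_cells_eq hF]
  exact card_le_of_no_triangle (fun p hp => by rw [← hn]; exact ((hF p).1 hp).1)
    (hP.no_triangle hF)

theorem injOn_snake (hn : n = 2 * k) : Set.InjOn (snake n) {t | IsValid 0 (k - 1) t} := by
  intro t h t' h' e
  have key : ∀ p, mem t p = mem t' p := by
    intro p
    rw [Bool.eq_iff_iff]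
    have : ∀ v : board n n, mem t v.1 ↔ mem t' v.1 := fun v => by
      rw [← mem_snake (n := n), ← mem_snake (n := n), e]
    exact ⟨fun hp => (this ⟨p, mem_board hn h hp⟩).1 hp,
      fun hp => (this ⟨p, mem_board hn h' hp⟩).2 hp⟩
  funext x y
  have e1 := key (2 * x, 2 * y)
  have e2 := key (2 * x + 1, 2 * y)
  have e3 := key (2 * x, 2 * y + 1)
  have e4 := key (2 * x + 1, 2 * y + 1)
  rw [mem_bl rfl rfl, mem_bl rfl rfl] at e1
  rw [mem_br rfl rfl, mem_br rfl rfl] at e2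
  rw [mem_tl rfl rfl, mem_tl rfl rfl] at e3
  rw [mem_tr rfl rfl, mem_tr rfl rfl] at e4
  revert e1 e2 e3 e4
  generalize t x y = a, t' x y = b
  revert a b; decide

theorem encard_neighborSet_snake (h : IsLocal t) (v : board n n) :
    ((snake n t).neighborSet v).encard ≤ 2 := by
  by_cases hv : mem t v.1
  · rw [← (Subtype.val_injective).encard_image]
    have hsub : Subtype.val '' (snake n t).neighborSet v ⊆
        (((around v.1).filter (mem t)).toFinset : Set (ℤ × ℤ)) := by
      rintro _ ⟨w, hw, rfl⟩
      rw [SimpleGraph.Subgraph.mem_neighborSet, snake_adj] at hw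
      rw [Finset.mem_coe, List.mem_toFinset, List.mem_filter]
      exact ⟨mem_around hw.2.2, hw.2.1⟩
    refine (Set.encard_le_encard hsub).trans ?_
    rw [Set.encard_coe_eq_coe_finsetCard]
    have := (List.toFinset_card_le _).trans ((List.countP_eq_length_filter ▸ h.countP_around hv))
    exact_mod_cast this
  · rw [show (snake n t).neighborSet v = ∅ from Set.eq_empty_of_forall_notMem fun w hw => by
      rw [SimpleGraph.Subgraph.mem_neighborSet, snake_adj] at hw
      exact hv hw.1]
    simp

/-- The two cells of a block are adjacent, and joined blocks contain adjacent cells. Hence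
reachability of all cells of a block from a fixed cell is a closed predicate. -/
theorem connected_snake (hk : 1 ≤ k) (hn : n = 2 * k) (h : IsValid 0 (k - 1) t) :
    (snake n t).coe.Connected := by
  have hb := fun {p} (hp : mem t p) => mem_board hn h hp
  obtain ⟨p₀, hp₀, -⟩ := exists_mem ((h.supp 0 0).2 (by unfold InSq; omega))
  have : Nonempty (snake n t).verts := ⟨⟨⟨p₀, hb hp₀⟩, hp₀⟩⟩
  have adj : ∀ {p q} (hp : mem t p) (hq : mem t q), KingAdj p q →
      (snake n t).coe.Adj ⟨⟨p, hb hp⟩, hp⟩ ⟨⟨q, hb hq⟩, hq⟩ := fun hp hq k =>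
    snake_adj.2 ⟨hp, hq, k⟩
  have same : ∀ {p q} (hp : mem t p) (hq : mem t q), p.1 / 2 = q.1 / 2 → p.2 / 2 = q.2 / 2 →
      (snake n t).coe.Reachable ⟨⟨p, hb hp⟩, hp⟩ ⟨⟨q, hb hq⟩, hq⟩ := by
    intro p q hp hq e1 e2
    by_cases e : p = q
    · subst e; exact SimpleGraph.Reachable.refl _
    · exact (adj hp hq (kingAdj_iff.2 ⟨fun k => e (Prod.ext k.1 k.2), by omega,
        by omega⟩)).reachable
  refine ⟨fun u v => ?_⟩
  have joined : ∀ a b : ℤ × ℤ, Joined t a b →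
      (∀ q (hq : mem t q), q.1 / 2 = a.1 → q.2 / 2 = a.2 →
        (snake n t).coe.Reachable u ⟨⟨q, hb hq⟩, hq⟩) →
      ∀ q (hq : mem t q), q.1 / 2 = b.1 → q.2 / 2 = b.2 →
        (snake n t).coe.Reachable u ⟨⟨q, hb hq⟩, hq⟩ := by
    intro a b hab H q hq q1 q2
    obtain ⟨p, r, hp, hr, hpr, hpa, hra⟩ := exists_kingAdj hab
    exact (H p hp hpa.1 hpa.2).trans ((adj hp hr hpr).reachable.trans
      (same hr hq (by omega) (by omega)))
  have key := h.conn (fun x y => ∀ q (hq : mem t q), q.1 / 2 = x → q.2 / 2 = y →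
      (snake n t).coe.Reachable u ⟨⟨q, hb hq⟩, hq⟩)
    ⟨fun x y h1 h2 => ?_, fun x y h1 h2 => ?_⟩ _ _ _ _ (ne_E_of_mem u.2) (ne_E_of_mem v.2)
    (fun q hq e1 e2 => same u.2 hq e1.symm e2.symm)
  · exact key v.1.1 v.2 rfl rfl
  · have : Joined t (x, y) (x + 1, y) := Or.inl ⟨rfl, Or.inl rfl, h1, h2⟩
    exact ⟨joined _ _ this, joined _ _ this.symm⟩
  · have : Joined t (x, y) (x, y + 1) := Or.inr ⟨rfl, Or.inl rfl, h1, h2⟩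
    exact ⟨joined _ _ this, joined _ _ this.symm⟩

/-- A valid choice of types gives a snake path if it contains a corner of the board. -/
theorem isSnakePath_snake (hk : 1 ≤ k) (hn : n = 2 * k) (h : IsValid 0 (k - 1) t)
    (hc : ∃ p : ℤ × ℤ, mem t p ∧ (p.1 = 0 ∨ p.1 = n - 1) ∧ (p.2 = 0 ∨ p.2 = n - 1)) :
    IsSnakePath (snake n t) ∧ length (snake n t) + 1 = 2 * k ^ 2 := by
  classical
  have hd := encard_neighborSet_snake (n := n) h.loc
  have : Fintype (board n n) := Fintype.ofFinite _
  have hdeg : ∀ (v) [Fintype ((snake n t).coe.neighborSet v)],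
      ((snake n t).coe.degree v : ℕ∞) = ((snake n t).neighborSet v.1).encard := fun v _ => by
    rw [SimpleGraph.Subgraph.coe_degree, ← Set.coe_fintypeCard]; rfl
  have hp : IsPath (snake n t) := by
    refine ⟨?_, hd⟩
    obtain ⟨p, hp, hp1, hp2⟩ := hc
    have hpv : (⟨p, mem_board hn h hp⟩ : board n n) ∈ (snake n t).verts := hp
    refine isTree_of_degree_le_one (connected_snake hk hn h) (fun v => ?_) (a := ⟨_, hpv⟩) ?_
    · rw [← Nat.cast_le (α := ℕ∞), hdeg]
      exact hd v.1
    · rw [← Nat.cast_le (α := ℕ∞), hdeg]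
      -- All king neighbours of a corner of the board lie in its own block, which has only one other
      -- cell of the snake. A vertex of degree at most one makes the connected graph a tree rather
      -- than a cycle.
      have : ((snake n t).neighborSet ⟨p, mem_board hn h hp⟩).encard ≤ 1 := by
        rw [Set.encard_le_one_iff]
        intro a b ha hb
        rw [SimpleGraph.Subgraph.mem_neighborSet, snake_adj] at ha hb
        have hab : ∀ {q : ℤ × ℤ}, q ∈ board n n → KingAdj p q →
            q.1 / 2 = p.1 / 2 ∧ q.2 / 2 = p.2 / 2 := by
          intro q hq hpq
          rw [kingAdj_iff] at hpq
          simp only [board, Set.mem_ofPred_eq] at hq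
          omega
        have a1 := hab a.2 ha.2.2
        have b1 := hab b.2 hb.2.2
        exact Subtype.ext (eq_of_mem hp ha.2.1 hb.2.1 a1.1 a1.2 b1.1 b1.2 ha.2.2.1.symm
          hb.2.2.1.symm)
      exact this
  refine ⟨⟨hp, fun v hv w hw k => snake_adj.2 ⟨hv, hw, kingGraph_adj.1 k⟩⟩, ?_⟩
  obtain ⟨F, hF⟩ := ((snake n t).verts.toFinite.image Subtype.val).exists_finset
  replace hF : ∀ p, p ∈ F ↔ ∃ h : p ∈ board n n, ⟨p, h⟩ ∈ (snake n t).verts :=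
    fun p => by rw [hF]; simp
  rw [length_add_one hp, ← card_cells_eq hF]
  exact h.card_cells fun p => by
    rw [hF]
    exact ⟨fun ⟨_, hp⟩ => hp, fun hp => ⟨mem_board hn h hp, hp⟩⟩

/-- A corner block that is an end covers the corner cell of the board in each of its two possible
types. -/
theorem IsValid.exists_corner_cell (hk : 3 ≤ k) (hn : n = 2 * k) (h : IsValid 0 (k - 1) t) :
    ∃ p : ℤ × ℤ, mem t p ∧ (p.1 = 0 ∨ p.1 = n - 1) ∧ (p.2 = 0 ∨ p.2 = n - 1) := by
  rcases h.exists_corner (by omega) with e | e | e | e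
  · exact ⟨(2 * 0, 2 * 0), by rw [mem_bl rfl rfl]; rcases e with e | e <;> rw [e] <;> rfl,
      by omega, by omega⟩
  · exact ⟨(2 * (k - 1) + 1, 2 * 0), by rw [mem_br rfl rfl]; rcases e with e | e <;> rw [e] <;> rfl,
      by omega, by omega⟩
  · exact ⟨(2 * (k - 1) + 1, 2 * (k - 1) + 1),
      by rw [mem_tr rfl rfl]; rcases e with e | e <;> rw [e] <;> rfl, by omega, by omega⟩
  · exact ⟨(2 * 0, 2 * (k - 1) + 1), by rw [mem_tl rfl rfl]; rcases e with e | e <;> rw [e] <;> rfl,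
      by omega, by omega⟩

end

end KingSnake

/-! ### The block graph, the spiral shape, and the conclusion -/

namespace KingSnake

open Ty

section

variable {n k : ℕ} {t : ℤ → ℤ → Ty}

theorem mem_block {p b : ℤ × ℤ} : p ∈ block b ↔ p.1 / 2 = b.1 ∧ p.2 / 2 = b.2 := by
  simp only [block, Set.mem_ofPred_eq]
  omega

/-- Under the local conditions, edges between different blocks occur exactly at joins; in particular
none passes between diagonally neighbouring blocks. -/
theorem blockGraph_snake (hn : n = 2 * (n / 2)) (h : IsValid 0 ((n / 2 : ℕ) - 1) t) :
    blockGraph (snake n t) = joinGraph t (board (n / 2) (n / 2)) := by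
  ext b c
  constructor
  · rintro ⟨hne, u, v, huv, hu, hv⟩
    rw [mem_block] at hu hv
    rw [snake_adj] at huv
    rcases joined_of_kingAdj h.loc.h h.loc.v h.loc.d h.loc.e huv.1 huv.2.1 huv.2.2 with e | hj
    · exact absurd (Subtype.ext (Prod.ext (by omega) (by omega))) hne
    · rwa [hu.1, hu.2, hv.1, hv.2] at hj
  · intro hj
    obtain ⟨p, q, hp, hq, hpq, hpb, hqc⟩ := exists_kingAdj hj
    exact ⟨hj.ne, ⟨p, mem_board hn h hp⟩, ⟨q, mem_board hn h hq⟩, snake_adj.2 ⟨hp, hq, hpq⟩,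
      mem_block.2 hpb, mem_block.2 hqc⟩

theorem mem_board_iff {p : ℤ × ℤ} : p ∈ board k k ↔ InSq 0 (k - 1) p.1 p.2 := by
  simp only [board, Set.mem_ofPred_eq]
  unfold InSq; omega

theorem IsValid.isHamiltonianPath (hk : 3 ≤ k) (h : IsValid 0 (k - 1) t) :
    IsHamiltonianPath (gridGraph (board k k)) (joinGraph t (board k k)) := by
  classical
  have : Fintype (board k k) := Fintype.ofFinite _
  have hdeg : ∀ v : board k k, (joinGraph t (board k k)).degree v ≤ 2 := fun v =>
    (joinGraph_degree_le t _ v).trans (h.loc.deg_le _ _)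
  refine ⟨fun a b hab => ?_, ?_, fun v => ?_⟩
  · obtain ⟨⟨a1, a2⟩, ha⟩ := a
    obtain ⟨⟨b1, b2⟩, hb⟩ := b
    have key : ∀ z : ℤ, |z - z| = 0 ∧ |z - (z + 1)| = 1 ∧ |z + 1 - z| = 1 := by simp
    rcases hab with ⟨e, e' | e', -⟩ | ⟨e, e' | e', -⟩ <;> dsimp only at e e' <;> subst e e' <;>
      simp [gridGraph, GridAdj]
  · obtain ⟨x, y, m, hxy⟩ : ∃ x y, InSq 0 (k - 1) x y ∧ KingSnake.deg t x y ≤ 1 := by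
      have no : ¬Ty.hor L ∧ ¬Ty.hor R ∧ ¬Ty.ver B ∧ ¬Ty.ver Ty.T := by decide
      have m : ∀ x y : ℤ, (x = 0 ∨ x = k - 1) → (y = 0 ∨ y = k - 1) → InSq 0 (k - 1) x y := by
        unfold InSq; omega
      rcases h.exists_corner (by omega) with (e | e) | (e | e) | (e | e) | (e | e)
      · exact ⟨_, _, m 0 0 (by omega) (by omega), h.deg_left (by rw [e]; exact no.2.2.1)⟩
      · exact ⟨_, _, m 0 0 (by omega) (by omega), h.deg_bottom (by rw [e]; exact no.1)⟩
      · exact ⟨_, _, m (k - 1) 0 (by omega) (by omega), h.deg_bottom (by rw [e]; exact no.2.1)⟩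
      · exact ⟨_, _, m (k - 1) 0 (by omega) (by omega), h.deg_right (by rw [e]; exact no.2.2.1)⟩
      · exact ⟨_, _, m (k - 1) (k - 1) (by omega) (by omega),
          h.deg_right (by rw [e]; exact no.2.2.2)⟩
      · exact ⟨_, _, m (k - 1) (k - 1) (by omega) (by omega), h.deg_top (by rw [e]; exact no.2.1)⟩
      · exact ⟨_, _, m 0 (k - 1) (by omega) (by omega), h.deg_top (by rw [e]; exact no.1)⟩
      · exact ⟨_, _, m 0 (k - 1) (by omega) (by omega), h.deg_left (by rw [e]; exact no.2.2.2)⟩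
    exact isTree_of_degree_le_one (h.connected (by omega) fun p => mem_board_iff) hdeg
      (a := ⟨(x, y), mem_board_iff.2 m⟩) ((joinGraph_degree_le t _ _).trans hxy)
  · rw [← Set.coe_fintypeCard, SimpleGraph.card_neighborSet_eq_degree]
    exact_mod_cast hdeg v

theorem Joined.of_rotate {s : ℤ} {a b : ℤ × ℤ} (h : Joined (rotate s t) a b) :
    Joined t (a.2, s - a.1) (b.2, s - b.1) := by
  unfold Joined rotate at *
  simp only [hor_rot, ver_rot] at h
  dsimp only
  rcases h with ⟨h1, h2, h3, h4⟩ | ⟨h1, h2, h3, h4⟩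
  · exact Or.inr ⟨h1, by omega, h3, h4⟩
  · exact Or.inl ⟨by omega, h2, h3, h4⟩

theorem Joined.of_reflect {a b : ℤ × ℤ} (h : Joined (reflect t) a b) :
    Joined t (a.2, a.1) (b.2, b.1) := by
  unfold Joined reflect at *
  simp only [hor_swap, ver_swap] at h
  dsimp only
  rcases h with ⟨h1, h2, h3, h4⟩ | ⟨h1, h2, h3, h4⟩
  · exact Or.inr ⟨h1, h2, h3, h4⟩
  · exact Or.inl ⟨h1, h2, h3, h4⟩

/-- `t'` arises from `t` by a symmetry of the board. -/
def Similar (k : ℕ) (t t' : ℤ → ℤ → Ty) : Prop :=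
  ∃ f : Equiv.Perm (board k k), IsSymmetry f ∧
    ∀ a b, Joined t' (f a).1 (f b).1 → Joined t a.1 b.1

theorem Similar.refl (k : ℕ) (t : ℤ → ℤ → Ty) : Similar k t t :=
  ⟨1, fun _ _ => rfl, fun _ _ => id⟩

theorem Similar.trans {t t' t'' : ℤ → ℤ → Ty} (h : Similar k t t') (h' : Similar k t' t'') :
    Similar k t t'' := by
  obtain ⟨f, hf, H⟩ := h
  obtain ⟨f', hf', H'⟩ := h'
  exact ⟨f' * f, fun a b => (hf' (f a) (f b)).trans (hf a b), fun a b h => H _ _ (H' _ _ h)⟩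

theorem similar_rotate (k : ℕ) (t : ℤ → ℤ → Ty) : Similar k t (rotate (k - 1) t) := by
  refine ⟨⟨fun a => ⟨(k - 1 - a.1.2, a.1.1), ?_⟩, fun a => ⟨(a.1.2, k - 1 - a.1.1), ?_⟩,
    fun a => ?_, fun a => ?_⟩, fun a b => ?_, fun a b h => ?_⟩
  · have := a.2
    simp only [board, Set.mem_ofPred_eq] at this ⊢
    omega
  · have := a.2
    simp only [board, Set.mem_ofPred_eq] at this ⊢
    omega
  · simp
  · simp
  · simp only [Equiv.coe_fn_mk]; ring
  · simpa using h.of_rotate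

theorem similar_reflect (k : ℕ) (t : ℤ → ℤ → Ty) : Similar k t (reflect t) := by
  refine ⟨⟨fun a => ⟨(a.1.2, a.1.1), ?_⟩, fun a => ⟨(a.1.2, a.1.1), ?_⟩,
    fun a => ?_, fun a => ?_⟩, fun a b => ?_, fun a b h => ?_⟩
  · have := a.2
    simp only [board, Set.mem_ofPred_eq] at this ⊢
    omega
  · have := a.2
    simp only [board, Set.mem_ofPred_eq] at this ⊢
    omega
  · simp
  · simp
  · simp only [Equiv.coe_fn_mk]; ring
  · simpa using h.of_reflect

theorem similar_sym (k : ℕ) (g : Fin 4 × Fin 2) (t : ℤ → ℤ → Ty) :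
    Similar k t (sym (k - 1) g t) := by
  have h1 : ∀ (i : ℕ) (t : ℤ → ℤ → Ty), Similar k t ((rotate (k - 1))^[i] t) := by
    intro i
    induction i with
    | zero => exact Similar.refl k
    | succ i ih =>
      intro t
      rw [Function.iterate_succ_apply]
      exact (similar_rotate k t).trans (ih _)
  have h2 : ∀ (i : ℕ) (t : ℤ → ℤ → Ty), Similar k t (reflect^[i] t) := by
    intro i
    induction i with
    | zero => exact Similar.refl k
    | succ i ih =>
      intro t
      rw [Function.iterate_succ_apply]
      exact (similar_reflect k t).trans (ih _)
  exact (h2 _ _).trans (h1 _ _)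

theorem IsValid.isSpiral (hn : n = 2 * (n / 2)) (hk : 3 ≤ n / 2)
    (h : IsValid 0 ((n / 2 : ℕ) - 1) t) : IsSpiral (snake n t) := by
  rw [IsSpiral, blockGraph_snake hn h]
  refine ⟨h.isHamiltonianPath hk, ?_⟩
  obtain ⟨g, hg⟩ := h.exists_sym (by omega)
  have h' := (isValid_sym_iff g).2 h
  rw [zero_add] at h' hg
  obtain ⟨f, hf, H⟩ := similar_sym (n / 2) g t
  refine ⟨f, hf, h'.isRegular hk hg fun a b hab => ?_⟩
  have hne : a ≠ b := SimpleGraph.Adj.ne (G := joinGraph (sym ((n / 2 : ℕ) - 1) g t) _) hab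
  rw [SimpleGraph.map_adj']
  exact ⟨hne, f.symm a, f.symm b, H _ _ (by simpa using hab), by simp, by simp⟩

end

/-- A snake path on the board of side two. -/
theorem isValid_one : IsValid 0 ((1 : ℕ) - 1) fun x y => if x = 0 ∧ y = 0 then B else E := by
  have hE : hor E = false ∧ ver E = false := by decide
  refine ⟨fun x y => ?_, ⟨fun x y => ?_, fun x y => ?_, fun x y => ?_, fun x y => ?_,
    fun x y => ?_⟩, fun A _ x y x' y' h h' hx => ?_⟩
  · unfold InSq
    push_cast
    split_ifs
    · simp only [ne_eq, reduceCtorEq, not_false_eq_true, true_iff]; omega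
    · simp only [ne_eq, not_true_eq_false, false_iff]; omega
  · split_ifs <;> first | omega | rfl
  · split_ifs <;> first | omega | rfl
  · split_ifs <;> first | omega | rfl
  · split_ifs <;> first | omega | rfl
  · split_ifs <;> rfl
  · have e : x = 0 ∧ y = 0 := by by_contra e; exact h (if_neg e)
    have e' : x' = 0 ∧ y' = 0 := by by_contra e; exact h' (if_neg e)
    rw [e'.1, e'.2]
    rwa [e.1, e.2] at hx

/-- A snake path on the board of side four. -/
theorem isValid_two : IsValid 0 ((2 : ℕ) - 1) (ofCode 2 [Z, S, S, B]) := by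
  refine isValid_ofCode ?_ ?_
  · rw [grid_ofCode]
    intro a b ha hb
    interval_cases a <;> interval_cases b <;> decide
  · rw [grid_ofCode]
    decide

/-- Boards of side two and four are settled by explicit examples; from `k = 3` on, existence follows
from the count being nonzero. -/
theorem exists_isValid_corner {n k : ℕ} (hk : 1 ≤ k) (hn : n = 2 * k) :
    ∃ t, IsValid 0 (k - 1) t ∧
      ∃ p : ℤ × ℤ, mem t p ∧ (p.1 = 0 ∨ p.1 = n - 1) ∧ (p.2 = 0 ∨ p.2 = n - 1) := by
  rcases (by omega : k = 1 ∨ k = 2 ∨ 3 ≤ k) with rfl | rfl | hk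
  · exact ⟨_, isValid_one, (0, 0), rfl, Or.inl rfl, Or.inl rfl⟩
  · exact ⟨_, isValid_two, (0, 0), rfl, Or.inl rfl, Or.inl rfl⟩
  · have : {t | IsValid 0 (k - 1) t}.ncard ≠ 0 := by
      rw [ncard_setOf_isValid_eq hk]; omega
    obtain ⟨t, ht⟩ := Set.nonempty_of_ncard_ne_zero this
    exact ⟨t, ht, IsValid.exists_corner_cell hk hn ht⟩

theorem setOf_isSnakePath {n k : ℕ} (hk : 3 ≤ k) (hn : n = 2 * k) :
    {P : (kingGraph (board n n)).Subgraph | IsSnakePath P ∧ length P = 2 * k ^ 2 - 1} =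
      snake n '' {t | IsValid 0 (k - 1) t} := by
  have hpos : 0 < 2 * k ^ 2 := by positivity
  ext P
  constructor
  · rintro ⟨hP, hl⟩
    obtain ⟨t, ht, rfl⟩ := hP.exists_isValid hn (by omega)
    exact ⟨t, ht, rfl⟩
  · rintro ⟨t, ht, rfl⟩
    obtain ⟨h1, h2⟩ := isSnakePath_snake (by omega) hn ht (IsValid.exists_corner_cell hk hn ht)
    exact ⟨h1, by omega⟩

end KingSnake

theorem theorem1 (n : ℕ) (hpos : 0 < n) (heven : Even n) :
    IsGreatest
      {l : ℕ | ∃ P : (KingSnake.kingGraph (KingSnake.board n n)).Subgraph,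
        KingSnake.IsSnakePath P ∧ KingSnake.length P = l} (n ^ 2 / 2 - 1) ∧
    (6 ≤ n →
      {P : (KingSnake.kingGraph (KingSnake.board n n)).Subgraph |
        KingSnake.IsSnakePath P ∧ KingSnake.length P = n ^ 2 / 2 - 1}.ncard = 16 * n ∧
      ∀ P : (KingSnake.kingGraph (KingSnake.board n n)).Subgraph,
        KingSnake.IsSnakePath P → KingSnake.length P = n ^ 2 / 2 - 1 →
          KingSnake.IsSpiral P) := by
  have hn : n = 2 * (n / 2) := by have := heven.two_dvd; omega
  have hsq : n ^ 2 / 2 = 2 * (n / 2) ^ 2 := by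
    conv_lhs => rw [hn]
    rw [mul_pow, show 2 ^ 2 * (n / 2) ^ 2 = 2 * (n / 2) ^ 2 * 2 by ring, Nat.mul_div_cancel _
        two_pos]
  rw [hsq]
  refine ⟨⟨?_, ?_⟩, fun h6 => ⟨?_, fun P hP hl => ?_⟩⟩
  · obtain ⟨t, ht, hc⟩ := KingSnake.exists_isValid_corner (k := n / 2) (by omega) hn
    obtain ⟨h1, h2⟩ := KingSnake.isSnakePath_snake (by omega) hn ht hc
    exact ⟨_, h1, by omega⟩
  · rintro _ ⟨P, hP, rfl⟩
    have := hP.length_le hn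
    omega
  · rw [KingSnake.setOf_isSnakePath (by omega) hn,
      (KingSnake.injOn_snake hn).ncard_image, KingSnake.ncard_setOf_isValid_eq (by omega)]
    omega
  · have h0 : 0 < (n / 2) ^ 2 := Nat.pow_pos (by omega)
    obtain ⟨t, ht, rfl⟩ := hP.exists_isValid hn (by omega)
    exact KingSnake.IsValid.isSpiral hn (by omega) ht
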